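/- **Theorem 7.** Work in complex Euclidean space $\mathbb C^3$ with coordinates $(x_1,x_2,x_3)$, momenta $(p_1,p_2,p_3)$, Poisson bracket $\{f,g\}=\sum_j(\partial_{x_j}f\,\partial_{p_j}g-\partial_{p_j}f\,\partial_{x_j}g)$, and subscripts on $V$ denoting partial derivatives. A *Euclidean superintegrable system with nondegenerate potential* on a connected open set $U\subseteq\mathbb C^3$ is given by analytic functions $A^{ij},B^{ij},C^{ij}$ on $U$ (symmetric in $i,j\in\{1,2,3\}$, zero for $i=j=1$) such that: 1. (nondegeneracy) for each $x\in U$ and arbitrary prescribed values of $V,V_1,V_2,V_3,V_{11}$ at $x$ there is exactly one germ at $x$ of an analytic solution $V$ of $$V_{ij}=\delta_{ij}V_{11}+A^{ij}V_1+B^{ij}V_2+C^{ij}V_3,\qquad 1\le i,j\le 3;\tag{1}$$ 2. (superintegrability) there are five symmetric matrices $a_{(h)}=(a_{(h)}^{ij})$ of analytic functions on $U$, the first being the identity matrix, which are linearly independent at every point of $U$, such that for every $x\in U$ and every germ $V$ at $x$ of a solution of (1) there are analytic germs $W_{(h)}$ at $x$ for which $S_h=\sum_{i,j}a_{(h)}^{ij}p_ip_j+W_{(h)}$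 satisfies $\{p_1^2+p_2^2+p_3^2+V,\;S_h\}=0$; and for every $x\in U$, for a suitable such $V$ and $W_{(h)}$, the five functions $S_h$ on phase space are functionally independent over $x$ (their differentials are linearly independent at $(x,p)$ for some $p$). The points of $U$ are then regular points of the system. Write $$D=(A^{12},A^{13},A^{22},A^{23},A^{33},B^{12},B^{22},B^{23},B^{33},C^{33}),$$ and let $\Sigma$ be the ideal of the polynomial ring over $\mathbb C$ in these ten variables generated by $$\begin{aligned} I^{(a)}&=-A^{22}B^{23}+B^{23}A^{33}+B^{12}A^{13}+A^{23}B^{22}-A^{12}A^{23}-A^{23}B^{33},\\ I^{(b)}&=(A^{33})^2+B^{12}A^{33}-A^{33}A^{22}-A^{12}B^{33}-A^{13}C^{33}+A^{12}B^{22}-B^{12}A^{22}+A^{13}B^{23}-(A^{12})^2,\\ I^{(c)}&=B^{23}C^{33}+B^{12}A^{33}+(B^{12})^2+B^{22}B^{33}-(B^{33})^2-A^{12}B^{33}-(B^{23})^2,\\ I^{(d)}&=-B^{12}A^{23}-A^{33}A^{23}+A^{13}B^{33}+A^{12}B^{23},\\ I^{(e)}&=-B^{23}A^{23}+C^{33}A^{23}+A^{22}B^{33}-A^{33}B^{33}+B^{12}A^{12},\\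 I^{(f)}&=A^{13}C^{33}+2A^{13}B^{23}+B^{22}B^{33}-(B^{33})^2+A^{33}A^{22}-(A^{33})^2+2A^{12}B^{22}\\ &\quad+(A^{12})^2-2B^{12}A^{22}+(B^{12})^2+B^{23}C^{33}-(B^{23})^2-3(A^{23})^2. \end{aligned}$$ (i) Let $x_0\in\mathbb C^3$ and let $d\in\mathbb C^{10}$ be a common zero of $I^{(a)},\dots,I^{(f)}$. Then there is a Euclidean superintegrable system with nondegenerate potential on some connected open neighbourhood of $x_0$ with $D(x_0)=d$, and it is unique: if two such systems, on $U\ni x_0$ and $U'\ni x_0$, both satisfy $D(x_0)=d$, then all their functions $A^{ij},B^{ij},C^{ij}$ agree on every connected subset of $U\cap U'$ that contains $x_0$. (ii) There are homogeneous quadratic polynomials $P_{\ell,k}$ ($1\le\ell\le3$, $1\le k\le10$) in the ten variables such that every Euclidean superintegrable system with nondegenerate potential satisfies the derivative relations $\partial_{x_\ell}D_k=P_{\ell,k}(D)$ at every point of its domain, and such that $\Sigma$ is closed under them: for each $\ell$, the $\mathbb C$-linear derivation of the polynomial ring that sends the $k$-th variable to $P_{\ell,k}$ maps $\Sigma$ into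 $\Sigma$. -/

import Mathlib

open Filter Topology

noncomputable section

namespace Superintegrable

/-- Complex Euclidean 3-space, with the coordinates `x₁, x₂, x₃` indexed by `0, 1, 2`. -/
abbrev Space : Type := Fin 3 → ℂ

/-- The partial derivative `∂f/∂x_i`. -/
def pd (i : Fin 3) (f : Space → ℂ) (x : Space) : ℂ := fderiv ℂ f x (Pi.single i 1)

/-! ### Hamiltonian mechanics -/

/-- The Poisson bracket of two functions `f(x, p)`, `g(x, p)` on phase space. -/
def poisson (f g : Space → Space → ℂ) (x p : Space) : ℂ :=
  ∑ j, (pd j (fun y => f y p) x * pd j (fun q => g x q) p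
    - pd j (fun q => f x q) p * pd j (fun y => g y p) x)

/-- The Euclidean Hamiltonian `p₁² + p₂² + p₃² + V(x)`. -/
def hamiltonian (V : Space → ℂ) (x p : Space) : ℂ := ∑ i, p i ^ 2 + V x

/-- The quadratic function `∑ a^{ij}(x) p_i p_j + W(x)` on phase space. -/
def quadraticFunction (a : Space → Matrix (Fin 3) (Fin 3) ℂ) (W : Space → ℂ) (x p : Space) : ℂ :=
  ∑ i, ∑ j, a x i j * p i * p j + W x

/-- Near `x`, the function `∑ a^{ij} p_i p_j + W` is a constant of the motion for
`p₁² + p₂² + p₃² + V`. -/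
def IsConstantOfMotionAt (V : Space → ℂ) (a : Space → Matrix (Fin 3) (Fin 3) ℂ) (W : Space → ℂ)
    (x : Space) : Prop :=
  AnalyticAt ℂ W x ∧
    ∀ᶠ y in 𝓝 x, ∀ p, poisson (hamiltonian V) (quadraticFunction a W) y p = 0

/-- The functions `f_h` on phase space are functionally independent over the point `x`: their
differentials are linearly independent at `(x, p)` for some momentum `p`. (For functions that are
polynomial in the momenta this then holds for generic `p`.) -/
def FunctionallyIndependentAt {ι : Type} (f : ι → Space → Space → ℂ) (x : Space) : Prop :=
  ∃ p : Space,
    LinearIndependent ℂ (fun h => fderiv ℂ (fun z : Space × Space => f h z.1 z.2) (x, p))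

/-! ### The canonical equations for the potential -/

/-- The coefficients of the canonical equations: `K 0 i j`, `K 1 i j`, `K 2 i j` are the functions
`A^{ij}`, `B^{ij}`, `C^{ij}` (with superscripts starting from `0` instead of `1`). -/
abbrev Coefficients : Type := Fin 3 → Fin 3 → Fin 3 → Space → ℂ

/-- `V` is analytic at `x` and solves, near `x`, the canonical equations
`V_{ij} = δ_{ij} V_{11} + A^{ij} V_1 + B^{ij} V_2 + C^{ij} V_3`. -/
def SolvesAt (K : Coefficients) (V : Space → ℂ) (x : Space) : Prop :=
  AnalyticAt ℂ V x ∧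
    ∀ᶠ y in 𝓝 x, ∀ i j,
      pd j (pd i V) y = (if i = j then pd 0 (pd 0 V) y else 0) + ∑ s, K s i j y * pd s V y

/-- `V` has the value `c`, the first derivatives `v` and the derivative `V_{11} = w` at `x`. -/
def HasData (V : Space → ℂ) (x : Space) (c : ℂ) (v : Fin 3 → ℂ) (w : ℂ) : Prop :=
  V x = c ∧ (∀ i, pd i V x = v i) ∧ pd 0 (pd 0 V) x = w

/-- At every point of `U` the values of `V, V_1, V_2, V_3, V_{11}` can be prescribed arbitrarily,
and then there is exactly one (germ of a) solution of the canonical equations. -/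
def IsNondegenerateOn (K : Coefficients) (U : Set Space) : Prop :=
  ∀ x ∈ U, ∀ (c : ℂ) (v : Fin 3 → ℂ) (w : ℂ),
    (∃ V, SolvesAt K V x ∧ HasData V x c v w) ∧
    ∀ V V', SolvesAt K V x → HasData V x c v w → SolvesAt K V' x → HasData V' x c v w →
      V =ᶠ[𝓝 x] V'

/-- The five quadratic forms `a 0, …, a 4`, the first of them that of the Hamiltonian, give
second order constants of the motion for every potential solving the canonical equations. These
are functionally linearly independent, and functionally independent for a suitable (equivalently,
a generic) potential, over every point of `U`. -/
structure IsSymmetryFamilyOn (K : Coefficients) (U : Set Space)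
    (a : Fin 5 → Space → Matrix (Fin 3) (Fin 3) ℂ) : Prop where
  analytic : ∀ h i j, AnalyticOnNhd ℂ (fun x => a h x i j) U
  symm : ∀ h, ∀ x ∈ U, (a h x).IsSymm
  first : ∀ x ∈ U, a 0 x = 1
  constants : ∀ x ∈ U, ∀ V, SolvesAt K V x → ∀ h, ∃ W, IsConstantOfMotionAt V (a h) W x
  linearIndependent : ∀ x ∈ U, LinearIndependent ℂ (fun h => a h x)
  functionallyIndependent : ∀ x ∈ U, ∃ (V : Space → ℂ) (W : Fin 5 → Space → ℂ),
    SolvesAt K V x ∧ (∀ h, IsConstantOfMotionAt V (a h) (W h) x) ∧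
    FunctionallyIndependentAt (fun h => quadraticFunction (a h) (W h)) x

/-- A Euclidean second order superintegrable system with nondegenerate potential, all points of the
domain `U` being regular. It is given by the coefficients of the canonical equations, hence by the
vector space of its potentials. -/
structure IsSystemOn (K : Coefficients) (U : Set Space) : Prop where
  isOpen : IsOpen U
  isConnected : IsConnected U
  analytic : ∀ s i j, AnalyticOnNhd ℂ (K s i j) U
  symm : ∀ s i j, ∀ x ∈ U, K s i j x = K s j i x
  zero_zero : ∀ s, ∀ x ∈ U, K s 0 0 x = 0
  nondegenerate : IsNondegenerateOn K U
  superintegrable : ∃ a, IsSymmetryFamilyOn K U a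

/-! ### The ten basic functions and the six quadratic identities -/

/-- The labels of the ten basic functions. -/
inductive Label : Type
  | A12 | A13 | A22 | A23 | A33 | B12 | B22 | B23 | B33 | C33

/-- The values at `x` of the ten basic functions. -/
def basic (K : Coefficients) (x : Space) : Label → ℂ
  | .A12 => K 0 0 1 x
  | .A13 => K 0 0 2 x
  | .A22 => K 0 1 1 x
  | .A23 => K 0 1 2 x
  | .A33 => K 0 2 2 x
  | .B12 => K 1 0 1 x
  | .B22 => K 1 1 1 x
  | .B23 => K 1 1 2 x
  | .B33 => K 1 2 2 x
  | .C33 => K 2 2 2 x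

open MvPolynomial Label in
/-- The six quadratic polynomials `I^{(a)}, …, I^{(f)}`. -/
def quadric : Fin 6 → MvPolynomial Label ℂ :=
  ![-X A22 * X B23 + X B23 * X A33 + X B12 * X A13 + X A23 * X B22 - X A12 * X A23 - X A23 * X B33,
    X A33 ^ 2 + X B12 * X A33 - X A33 * X A22 - X A12 * X B33 - X A13 * X C33 + X A12 * X B22
      - X B12 * X A22 + X A13 * X B23 - X A12 ^ 2,
    X B23 * X C33 + X B12 * X A33 + X B12 ^ 2 + X B22 * X B33 - X B33 ^ 2 - X A12 * X B33
      - X B23 ^ 2,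
    -X B12 * X A23 - X A33 * X A23 + X A13 * X B33 + X A12 * X B23,
    -X B23 * X A23 + X C33 * X A23 + X A22 * X B33 - X A33 * X B33 + X B12 * X A12,
    X A13 * X C33 + 2 * X A13 * X B23 + X B22 * X B33 - X B33 ^ 2 + X A33 * X A22 - X A33 ^ 2
      + 2 * X A12 * X B22 + X A12 ^ 2 - 2 * X B12 * X A22 + X B12 ^ 2 + X B23 * X C33 - X B23 ^ 2
      - 3 * X A23 ^ 2]

/-- The ideal `Σ` generated by the six quadratic polynomials. -/
def idealSigma : Ideal (MvPolynomial Label ℂ) := Ideal.span (Set.range quadric)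

end Superintegrable

end

/-! Both halves compare a superintegrable system with a closed system of first order equations `∂_l
D_k = P_{l,k}(D)`, whose right-hand sides are the quadratic polynomials `derivPoly`.

Necessity. Nondegeneracy allows any gradient and any `V_{11}` at a point. Symmetry of the third
derivatives of a potential with zero gradient and `V_{11} = 1` gives linear relations that express
all coefficients by the ten basic functions (`IsSystemOn.eq_coef`). For gradient `e_s` and `V_{11} =
0` it gives equations that are linear in the first derivatives of `D` (`potentialRelations`). The
cubic part of the Poisson bracket is the Killing equation for `a`, the linear part says `dW = a dV`;
together they determine all derivatives of `a` (`IsSystemOn.pd_form`), and equality of mixed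
derivatives makes the linear forms `curv` vanish on the five given matrices. Symmetric matrices form
a six-dimensional space, so all these forms are multiples of a single one, which is trace-free
because the identity is among the five. With `ε` the deviation of the derivatives of `D` from
`derivPoly`, a case distinction on this rank-one condition (`defectVanishes`) forces `ε = 0`; the
first five quadrics vanish as a by-product. Uniqueness is then Gronwall's inequality followed by a
connectedness argument.

Existence. The ideal of the quadrics is invariant under the derivative relations
(`eval_derivation_quadric`), and these are integrable modulo the quadrics (`derivPoly_integrable`).
The same holds for a larger polynomial system whose unknowns are `D`, the jet `(V, V_i, V_{11})`, a
symmetric matrix `a` and `W` (`jointPoly_integrable`). A Frobenius theorem for polynomial systems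
(`exists_solvesSystemAt`) then yields the coefficients, all potentials, quadratic forms with any
initial matrix, and the functions `W`. It is proved by solving along rays, with analytic dependence
from the inverse function theorem on a space of paths, and by showing that a radial solution solves
all equations. Functional independence is arranged at one point by choosing the gradient of `V`, and
persists nearby.

The polynomial identities are checked with explicit multipliers of the quadrics. -/

open Filter Topology

noncomputable section

namespace Superintegrable

/-! ### Partial derivatives -/

section PartialDerivatives

variable {f g : Space → ℂ} {x : Space}

theorem pd_add (i : Fin 3) (hf : DifferentiableAt ℂ f x) (hg : DifferentiableAt ℂ g x) :
    pd i (fun y => f y + g y) x = pd i f x + pd i g x := by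
  simp only [pd]
  rw [fderiv_fun_add hf hg]; rfl

theorem pd_sub (i : Fin 3) (hf : DifferentiableAt ℂ f x) (hg : DifferentiableAt ℂ g x) :
    pd i (fun y => f y - g y) x = pd i f x - pd i g x := by
  simp only [pd]
  rw [fderiv_fun_sub hf hg]; rfl

theorem pd_mul (i : Fin 3) (hf : DifferentiableAt ℂ f x) (hg : DifferentiableAt ℂ g x) :
    pd i (fun y => f y * g y) x = pd i f x * g x + f x * pd i g x := by
  simp only [pd]
  rw [fderiv_fun_mul hf hg]
  simp [mul_comm, add_comm]

theorem pd_sum {ι : Type*} (s : Finset ι) {F : ι → Space → ℂ} (i : Fin 3)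
    (hF : ∀ k ∈ s, DifferentiableAt ℂ (F k) x) :
    pd i (fun y => ∑ k ∈ s, F k y) x = ∑ k ∈ s, pd i (F k) x := by
  simp only [pd]
  rw [fderiv_fun_sum hF]; simp

@[simp] theorem pd_const (i : Fin 3) (c : ℂ) : pd i (fun _ => c) x = 0 := by simp [pd]

theorem pd_congr (i : Fin 3) (h : f =ᶠ[𝓝 x] g) : pd i f x = pd i g x := by
  simp only [pd, h.fderiv_eq]

theorem analyticAt_pd (i : Fin 3) (hf : AnalyticAt ℂ f x) : AnalyticAt ℂ (pd i f) x := by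
  exact ((ContinuousLinearMap.apply ℂ ℂ (Pi.single i 1 : Space)).analyticAt _).comp hf.fderiv

theorem pd_comm (i j : Fin 3) (hf : AnalyticAt ℂ f x) : pd i (pd j f) x = pd j (pd i f) x := by
  have hs : IsSymmSndFDerivAt ℂ f x := by
    apply ContDiffAt.isSymmSndFDerivAt (n := 2) hf.contDiffAt
    simp
  have hd : DifferentiableAt ℂ (fderiv ℂ f) x := hf.fderiv.differentiableAt
  have key : ∀ i j : Fin 3, pd i (pd j f) x
      = fderiv ℂ (fderiv ℂ f) x (Pi.single i 1) (Pi.single j 1) := by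
    intro i j
    change fderiv ℂ (fun y => fderiv ℂ f y (Pi.single j 1)) x (Pi.single i 1) = _
    rw [fderiv_clm_apply hd (differentiableAt_const _)]
    simp
  rw [key, key, hs.eq]

theorem fderiv_apply_eq_sum_pd (f : Space → ℂ) (x v : Space) :
    fderiv ℂ f x v = ∑ l, v l * pd l f x := by
  conv_lhs => rw [pi_eq_sum_univ' v]
  simp [pd]

theorem pd_coord (i j : Fin 3) (c : ℂ) :
    pd i (fun y => y j - c) x = if i = j then 1 else 0 := by
  simp only [pd]
  rw [fderiv_sub_const]
  change (fderiv ℂ (ContinuousLinearMap.proj (R := ℂ) (φ := fun _ : Fin 3 => ℂ) j) x) _ = _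
  rw [ContinuousLinearMap.fderiv]
  simp [Pi.single_apply, eq_comm]

end PartialDerivatives

/-! ### A radial Gronwall inequality -/

/-- A function that vanishes at `x₀` and whose radial derivative is controlled by its size vanishes
near `x₀`. -/
theorem eventually_eq_zero_of_radial_bound {E F : Type*} [NormedAddCommGroup E] [NormedSpace ℂ E]
    [NormedAddCommGroup F] [NormedSpace ℂ F] {h : E → F} {x₀ : E} (C : ℝ)
    (hd : ∀ᶠ z in 𝓝 x₀, DifferentiableAt ℂ h z) (h0 : h x₀ = 0)
    (hb : ∀ᶠ z in 𝓝 x₀, ‖fderiv ℂ h z (z - x₀)‖ ≤ C * ‖z - x₀‖ * ‖h z‖) :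
    ∀ᶠ z in 𝓝 x₀, h z = 0 := by
  obtain ⟨ρ, hρ, hball⟩ := Metric.eventually_nhds_iff_ball.1 (hd.and hb)
  filter_upwards [Metric.ball_mem_nhds x₀ hρ] with z hz
  set w := z - x₀ with hw
  have hwρ : ‖w‖ < ρ := by simpa [hw, dist_eq_norm] using hz
  have hmem : ∀ t ∈ Set.Icc (0 : ℝ) 1, x₀ + (t : ℂ) • w ∈ Metric.ball x₀ ρ := by
    intro t ht
    rw [Metric.mem_ball, dist_eq_norm, add_sub_cancel_left, norm_smul, Complex.norm_real,
      Real.norm_of_nonneg ht.1]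
    nlinarith [norm_nonneg w, ht.2]
  let φ : ℝ → F := fun t => h (x₀ + (t : ℂ) • w)
  have hφ : ∀ t ∈ Set.Icc (0 : ℝ) 1, HasDerivAt φ (fderiv ℂ h (x₀ + (t : ℂ) • w) w) t := by
    intro t ht
    have h1 : HasDerivAt (fun s : ℝ => x₀ + (s : ℂ) • w) w t := by
      simpa using ((Complex.ofRealCLM.hasDerivAt (x := t)).smul_const w).const_add x₀
    exact ((hball _ (hmem t ht)).1.hasFDerivAt.restrictScalars ℝ).comp_hasDerivAt t h1
  have hbound : ∀ t ∈ Set.Ioc (0 : ℝ) 1,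
      ‖fderiv ℂ h (x₀ + (t : ℂ) • w) w‖ ≤ C * ‖w‖ * ‖φ t‖ := by
    intro t ht
    have := (hball _ (hmem t ⟨ht.1.le, ht.2⟩)).2
    rw [add_sub_cancel_left, map_smul, norm_smul, norm_smul, Complex.norm_real,
      Real.norm_of_nonneg ht.1.le] at this
    have h3 : t * ‖fderiv ℂ h (x₀ + (t : ℂ) • w) w‖ ≤ t * (C * ‖w‖ * ‖φ t‖) := by
      calc _ ≤ C * (t * ‖w‖) * ‖φ t‖ := this
        _ = _ := by ring
    exact le_of_mul_le_mul_left h3 ht.1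
  have hcont : ContinuousOn φ (Set.Icc 0 1) := fun t ht => (hφ t ht).continuousAt.continuousWithinAt
  -- Dividing the hypothesis by `t` loses the endpoint `t = 0`, so Gronwall starts at `ε > 0`; the
  -- limit `ε → 0` follows by continuity.
  have hgr : ∀ ε ∈ Set.Ioo (0 : ℝ) 1,
      ‖φ 1‖ ≤ ‖φ ε‖ * Real.exp (C * ‖w‖ * (1 - ε)) := by
    intro ε hε
    have := norm_le_gronwallBound_of_norm_deriv_right_le (f := φ) (δ := ‖φ ε‖) (K := C * ‖w‖)
      (ε := 0) (a := ε) (b := 1) (hcont.mono (Set.Icc_subset_Icc_left hε.1.le))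
      (fun t ht => (hφ t ⟨hε.1.le.trans ht.1, ht.2.le⟩).hasDerivWithinAt) le_rfl
      (fun t ht => by simpa using hbound t ⟨hε.1.trans_le ht.1, ht.2.le⟩) 1 ⟨hε.2.le, le_rfl⟩
    simpa [gronwallBound_ε0] using this
  have hlim : Tendsto (fun ε => ‖φ ε‖ * Real.exp (C * ‖w‖ * (1 - ε))) (𝓝[>] 0) (𝓝 0) := by
    have h1 : ContinuousAt φ 0 := (hφ 0 ⟨le_rfl, zero_le_one⟩).continuousAt
    have h2 : ContinuousAt (fun ε => ‖φ ε‖ * Real.exp (C * ‖w‖ * (1 - ε))) 0 := by fun_prop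
    have h3 : φ 0 = 0 := by simp [φ, h0]
    have := h2.tendsto
    simp only [h3, norm_zero, zero_mul] at this
    exact this.mono_left nhdsWithin_le_nhds
  have hle : ‖φ 1‖ ≤ 0 := by
    refine ge_of_tendsto hlim ?_
    filter_upwards [Ioo_mem_nhdsGT (zero_lt_one' ℝ)] with ε hε using hgr ε hε
  have : φ 1 = 0 := norm_le_zero_iff.1 hle
  simpa [φ, hw] using this

/-! ### Polynomial maps -/

section Polynomials

open MvPolynomial

variable {ι : Type*} [Fintype ι]

theorem mkDerivation_eq_sum_pderiv (Q : ι → MvPolynomial ι ℂ) (p : MvPolynomial ι ℂ) :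
    mkDerivation ℂ Q p = ∑ k, pderiv k p * Q k := by
  classical
  induction p using MvPolynomial.induction_on with
  | C a => simp
  | add p q h1 h2 => simp only [map_add, add_mul, Finset.sum_add_distrib, h1, h2]
  | mul_X p i h1 =>
    simp only [Derivation.leibniz, smul_eq_mul, add_mul, Finset.sum_add_distrib, h1,
      mkDerivation_X, Finset.mul_sum]
    congr 1
    · rw [Finset.sum_eq_single i]
      · simp
      · intro k _ hk
        simp [pderiv_X_of_ne hk.symm]
      · simp
    · exact Finset.sum_congr rfl fun k _ => by ring

theorem analyticAt_eval {E : Type*} [NormedAddCommGroup E] [NormedSpace ℂ E] {f : E → ι → ℂ} {x : E}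
    (hf : AnalyticAt ℂ f x) (p : MvPolynomial ι ℂ) : AnalyticAt ℂ (fun y => eval (f y) p) x := by
  have : ∀ i, AnalyticAt ℂ (fun y => f y i) x := analyticAt_pi_iff.1 hf
  simpa [MvPolynomial.coe_aeval_eq_eval] using
    AnalyticAt.aeval_mvPolynomial (A := ℂ) (B := ℂ) this p

theorem pd_eval {f : Space → ι → ℂ} {x : Space} (hf : DifferentiableAt ℂ f x) (l : Fin 3)
    (p : MvPolynomial ι ℂ) :
    pd l (fun y => eval (f y) p) x
      = ∑ k, eval (f x) (pderiv k p) * pd l (fun y => f y k) x := by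
  classical
  have hk : ∀ k, DifferentiableAt ℂ (fun y => f y k) x := differentiableAt_pi.1 hf
  have hp : ∀ p : MvPolynomial ι ℂ, DifferentiableAt ℂ (fun y => eval (f y) p) x := by
    intro p
    have h1 : AnalyticAt ℂ (fun z : ι → ℂ => eval z p) (f x) := analyticAt_eval analyticAt_id p
    exact h1.differentiableAt.comp x hf
  induction p using MvPolynomial.induction_on with
  | C a => simp
  | add p q h1 h2 =>
    simp only [map_add, add_mul, Finset.sum_add_distrib]
    rw [pd_add l (hp p) (hp q), h1, h2]
  | mul_X p i h1 =>
    simp only [map_mul, eval_X, Derivation.leibniz, smul_eq_mul, map_add, add_mul,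
      Finset.sum_add_distrib]
    rw [pd_mul l (hp p) (hk i), h1, Finset.sum_mul]
    rw [add_comm]
    congr 1
    · rw [Finset.sum_eq_single i]
      · simp
      · intro k _ hk
        simp [pderiv_X_of_ne hk.symm]
      · simp
    · refine Finset.sum_congr rfl fun k _ => by ring

end Polynomials

/-! ### Polynomial systems of total differential equations -/

section Pfaffian

open MvPolynomial

theorem exists_eventually_norm_le {E α : Type*} [TopologicalSpace E] [Fintype α]
    {F : α → E → ℂ} {x₀ : E} (hF : ∀ i, ContinuousAt (F i) x₀) :
    ∃ M : ℝ, 0 ≤ M ∧ ∀ᶠ z in 𝓝 x₀, ∀ i, ‖F i z‖ ≤ M := by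
  have hc : ContinuousAt (fun z => fun i => F i z) x₀ := continuousAt_pi.2 hF
  refine ⟨‖fun i => F i x₀‖ + 1, by positivity, ?_⟩
  filter_upwards [hc.norm.eventually_lt continuousAt_const (lt_add_one _)] with z hz i
  exact (norm_le_pi_norm (fun i => F i z) i).trans hz.le

/-- The radial Gronwall inequality for a family of functions whose radial derivatives are linear
combinations of the family, with bounded coefficients. -/
theorem eventually_eq_zero_of_radial_linear {α : Type*} [Fintype α] {h : α → Space → ℂ}
    {x₀ : Space} (hd : ∀ i, AnalyticAt ℂ (h i) x₀) (h0 : ∀ i, h i x₀ = 0)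
    {A : Fin 3 → α → α → Space → ℂ} (hA : ∀ l i j, ContinuousAt (A l i j) x₀)
    (hb : ∀ᶠ z in 𝓝 x₀, ∀ i, ∑ l, (z l - x₀ l) * pd l (h i) z
      = ∑ l, (z l - x₀ l) * ∑ j, A l i j z * h j z) :
    ∀ᶠ z in 𝓝 x₀, ∀ i, h i z = 0 := by
  obtain ⟨M, hM0, hM⟩ := exists_eventually_norm_le (α := Fin 3 × α × α)
    (F := fun t => A t.1 t.2.1 t.2.2) (fun t => hA _ _ _)
  have hda : ∀ᶠ z in 𝓝 x₀, ∀ i, AnalyticAt ℂ (h i) z :=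
    eventually_all.2 fun i => (hd i).eventually_analyticAt
  have := eventually_eq_zero_of_radial_bound (h := fun z => fun i => h i z) (x₀ := x₀)
    (3 * (Fintype.card α * M))
    (hda.mono fun z hz => differentiableAt_pi.2 fun i => (hz i).differentiableAt)
    (funext h0) ?_
  · filter_upwards [this] with z hz i using congrFun hz i
  filter_upwards [hda, hb, hM] with z hz hbz hMz
  rw [pi_norm_le_iff_of_nonneg (by positivity)]
  intro i
  have e1 : fderiv ℂ (fun z => fun i => h i z) z (z - x₀) i = fderiv ℂ (h i) z (z - x₀) := by
    rw [fderiv_pi fun i => (hz i).differentiableAt]; rfl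
  rw [e1, fderiv_apply_eq_sum_pd]
  simp only [Pi.sub_apply]
  rw [hbz i]
  calc ‖∑ l, (z l - x₀ l) * ∑ j, A l i j z * h j z‖
      ≤ ∑ l : Fin 3, ‖z - x₀‖ * ∑ j : α, M * ‖fun i => h i z‖ := by
        refine (norm_sum_le _ _).trans (Finset.sum_le_sum fun l _ => ?_)
        rw [norm_mul]
        refine mul_le_mul (norm_le_pi_norm (z - x₀) l) ?_ (norm_nonneg _) (norm_nonneg _)
        refine (norm_sum_le _ _).trans (Finset.sum_le_sum fun j _ => ?_)
        rw [norm_mul]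
        exact mul_le_mul (hMz (l, i, j)) (norm_le_pi_norm (fun i => h i z) j) (norm_nonneg _) hM0
    _ = 3 * (Fintype.card α * M) * ‖z - x₀‖ * ‖fun i => h i z‖ := by
        simp; ring

variable {ι : Type*} [Fintype ι]

/-- Near `x`, the function `f` solves the equations `∂_l f_k = P_{l,k}(f)` for all `k ∈ S`. -/
def SolvesSystemAt (P : Fin 3 → ι → MvPolynomial ι ℂ) (S : Set ι) (f : Space → ι → ℂ)
    (x : Space) : Prop :=
  AnalyticAt ℂ f x ∧
    ∀ᶠ z in 𝓝 x, ∀ l, ∀ k ∈ S, pd l (fun y => f y k) z = eval (f z) (P l k)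

theorem SolvesSystemAt.eventually {P : Fin 3 → ι → MvPolynomial ι ℂ} {S : Set ι}
    {f : Space → ι → ℂ} {x : Space} (h : SolvesSystemAt P S f x) :
    ∀ᶠ z in 𝓝 x, SolvesSystemAt P S f z := by
  filter_upwards [h.1.eventually_analyticAt, h.2.eventually_nhds] with z h1 h2 using ⟨h1, h2⟩

/-- Solutions of a polynomial system are determined by their value at a point. -/
theorem SolvesSystemAt.unique {P : Fin 3 → ι → MvPolynomial ι ℂ} {S : Set ι}
    (hS : ∀ k ∈ S, ∀ l z z', (∀ j ∈ S, z j = z' j) → eval z (P l k) = eval z' (P l k))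
    {f f' : Space → ι → ℂ} {x₀ : Space} (hf : SolvesSystemAt P S f x₀)
    (hf' : SolvesSystemAt P S f' x₀) (h0 : ∀ k ∈ S, f x₀ k = f' x₀ k) :
    ∀ᶠ z in 𝓝 x₀, ∀ k ∈ S, f z k = f' z k := by
  classical
  let h : Space → ι → ℂ := fun z k => if k ∈ S then f z k - f' z k else 0
  -- `w` follows `f'` on `S` and `f` elsewhere. Then `f - w` is exactly `h`, so a Lipschitz bound
  -- for the right-hand sides at `f` and `w` is a bound by `‖h‖`, although nothing is known about
  -- the components outside `S`.
  let w : Space → ι → ℂ := fun z k => if k ∈ S then f' z k else f z k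
  have hfi : ∀ z, AnalyticAt ℂ f z → ∀ k, DifferentiableAt ℂ (fun y => f y k) z :=
    fun z hz => differentiableAt_pi.1 hz.differentiableAt
  have hfi' : ∀ z, AnalyticAt ℂ f' z → ∀ k, DifferentiableAt ℂ (fun y => f' y k) z :=
    fun z hz => differentiableAt_pi.1 hz.differentiableAt
  have hfw : ∀ z, f z - w z = h z := by
    intro z; funext k
    by_cases hk : k ∈ S <;> simp [h, w, hk]
  have hw0 : w x₀ = f x₀ := by
    funext k
    by_cases hk : k ∈ S <;> simp [w, hk, h0]
  have hwc : ContinuousAt w x₀ := by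
    refine continuousAt_pi.2 fun k => ?_
    by_cases hk : k ∈ S
    · simpa [w, hk] using (hfi' _ hf'.1 k).continuousAt
    · simpa [w, hk] using (hfi _ hf.1 k).continuousAt
  let G : (ι → ℂ) → Fin 3 → ι → ℂ := fun z l k => eval z (P l k)
  have hG : ContDiffAt ℂ 1 G (f x₀) := by
    refine contDiffAt_pi.2 fun l => contDiffAt_pi.2 fun k => ?_
    exact (analyticAt_eval analyticAt_id (P l k)).contDiffAt
  obtain ⟨C, t, ht, hL⟩ := hG.exists_lipschitzOnWith
  have hft := hf.1.continuousAt.eventually ht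
  have hwt := hwc.eventually (by rw [hw0]; exact ht)
  have hdh : ∀ z, AnalyticAt ℂ f z → AnalyticAt ℂ f' z → ∀ k,
      DifferentiableAt ℂ (fun y => h y k) z := by
    intro z h1 h2 k
    by_cases hk : k ∈ S
    · simp only [h, hk, if_true]
      exact (hfi z h1 k).fun_sub (hfi' z h2 k)
    · simp [h, hk]
  have hz : ∀ᶠ z in 𝓝 x₀, h z = 0 := by
    apply eventually_eq_zero_of_radial_bound (3 * C)
    · filter_upwards [hf.1.eventually_analyticAt, hf'.1.eventually_analyticAt] with z h1 h2
      exact differentiableAt_pi.2 (hdh z h1 h2)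
    · funext k
      by_cases hk : k ∈ S <;> simp [h, hk, h0]
    · filter_upwards [hf.1.eventually_analyticAt, hf'.1.eventually_analyticAt, hf.2, hf'.2, hft,
        hwt] with z h1 h2 h3 h4 h5 h6
      rw [pi_norm_le_iff_of_nonneg (by positivity)]
      intro k
      have e1 : fderiv ℂ h z (z - x₀) k = fderiv ℂ (fun y => h y k) z (z - x₀) := by
        conv_lhs => rw [show h = fun y k => h y k from rfl, fderiv_pi (hdh z h1 h2)]
        rfl
      rw [e1, fderiv_apply_eq_sum_pd]
      have hLz : ‖G (f z) - G (w z)‖ ≤ C * ‖h z‖ := by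
        simpa [dist_eq_norm, hfw] using hL.dist_le_mul _ h5 _ h6
      have e2 : ∀ l, ‖pd l (fun y => h y k) z‖ ≤ C * ‖h z‖ := by
        intro l
        by_cases hk : k ∈ S
        · have e3 : pd l (fun y => h y k) z = (G (f z) - G (w z)) l k := by
            simp only [h, hk, if_true]
            rw [pd_sub l (hfi z h1 k) (hfi' z h2 k), h3 l k hk, h4 l k hk]
            simp only [G, Pi.sub_apply]
            rw [hS k hk l (f' z) (w z) (fun j hj => by simp [w, hj])]
          rw [e3]
          exact ((norm_le_pi_norm ((G (f z) - G (w z)) l) k).trans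
            (norm_le_pi_norm (G (f z) - G (w z)) l)).trans hLz
        · simp only [h, hk, if_false, pd_const, norm_zero]
          positivity
      calc ‖∑ l, (z - x₀) l * pd l (fun y => h y k) z‖
          ≤ ∑ l : Fin 3, ‖z - x₀‖ * (C * ‖h z‖) := by
            refine (norm_sum_le _ _).trans (Finset.sum_le_sum fun l _ => ?_)
            rw [norm_mul]
            exact mul_le_mul (norm_le_pi_norm _ l) (e2 l) (norm_nonneg _) (norm_nonneg _)
        _ = 3 * C * ‖z - x₀‖ * ‖h z‖ := by simp; ring
  filter_upwards [hz] with z hz k hk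
  have := congrFun hz k
  simpa [h, hk, sub_eq_zero] using this

/-- The quantities `q_m` that generate an ideal invariant under the system vanish along a radial
solution if they vanish at the centre. -/
theorem eventually_eval_eq_zero_of_radial {P : Fin 3 → ι → MvPolynomial ι ℂ} {κ : Type*}
    [Fintype κ] {q : κ → MvPolynomial ι ℂ} {c : Fin 3 → κ → κ → MvPolynomial ι ℂ}
    (hq : ∀ l m z, eval z (mkDerivation ℂ (P l) (q m)) = ∑ j, eval z (c l m j) * eval z (q j))
    {g : Space → ι → ℂ} {x₀ : Space} (hg : AnalyticAt ℂ g x₀)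
    (hr : ∀ᶠ z in 𝓝 x₀, ∀ k, ∑ l, (z l - x₀ l) * pd l (fun y => g y k) z
      = ∑ l, (z l - x₀ l) * eval (g z) (P l k))
    (h0 : ∀ m, eval (g x₀) (q m) = 0) :
    ∀ᶠ z in 𝓝 x₀, ∀ m, eval (g z) (q m) = 0 := by
  apply eventually_eq_zero_of_radial_linear (fun m => analyticAt_eval hg (q m)) h0
    (A := fun l m j z => eval (g z) (c l m j))
    (fun l m j => (analyticAt_eval hg (c l m j)).continuousAt)
  filter_upwards [hg.eventually_analyticAt, hr] with z h1 h2 m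
  simp only [← hq, mkDerivation_eq_sum_pderiv, pd_eval h1.differentiableAt, map_sum, map_mul,
    Finset.mul_sum]
  -- By the chain rule the derivatives of `g` enter only through their radial combination, which the
  -- hypothesis replaces by the right-hand sides.
  rw [Finset.sum_comm]
  conv_rhs => rw [Finset.sum_comm]
  refine Finset.sum_congr rfl fun k _ => ?_
  have := congrArg (fun t => eval (g z) (pderiv k (q m)) * t) (h2 k)
  simp only [Finset.mul_sum] at this
  calc _ = _ := Finset.sum_congr rfl fun l _ => by ring
    _ = _ := this
    _ = _ := Finset.sum_congr rfl fun l _ => by ring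

/-- A radial solution of a system which is integrable along the zero set of invariant quantities
`q_m` is a solution. -/
theorem solvesSystemAt_of_radial {P : Fin 3 → ι → MvPolynomial ι ℂ} {κ : Type*}
    [Fintype κ] {q : κ → MvPolynomial ι ℂ} {c : Fin 3 → κ → κ → MvPolynomial ι ℂ}
    (hq : ∀ l m z, eval z (mkDerivation ℂ (P l) (q m)) = ∑ j, eval z (c l m j) * eval z (q j))
    (hcomm : ∀ z, (∀ m, eval z (q m) = 0) → ∀ l m k,
      eval z (mkDerivation ℂ (P l) (P m k)) = eval z (mkDerivation ℂ (P m) (P l k)))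
    {g : Space → ι → ℂ} {x₀ : Space} (hg : AnalyticAt ℂ g x₀)
    (hr : ∀ᶠ z in 𝓝 x₀, ∀ k, ∑ l, (z l - x₀ l) * pd l (fun y => g y k) z
      = ∑ l, (z l - x₀ l) * eval (g z) (P l k))
    (h0 : ∀ m, eval (g x₀) (q m) = 0) :
    SolvesSystemAt P Set.univ g x₀ := by
  have hq0 := eventually_eval_eq_zero_of_radial hq hg hr h0
  -- `E` measures the failure of the single equations; so far only its radial combination is known
  -- to vanish.
  let E : Fin 3 → ι → Space → ℂ := fun m k z => pd m (fun y => g y k) z - eval (g z) (P m k)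
  have hgk : ∀ z, AnalyticAt ℂ g z → ∀ k, AnalyticAt ℂ (fun y => g y k) z :=
    fun z hz => analyticAt_pi_iff.1 hz
  have hE : ∀ z, AnalyticAt ℂ g z → ∀ m k, AnalyticAt ℂ (E m k) z := fun z hz m k =>
    (analyticAt_pd m (hgk z hz k)).sub (analyticAt_eval hz _)
  have hcoord : ∀ j z, AnalyticAt ℂ (fun y : Space => y j - x₀ j) z := fun j z =>
    ((ContinuousLinearMap.proj (R := ℂ) (φ := fun _ : Fin 3 => ℂ) j).analyticAt z).sub
      analyticAt_const
  -- Differentiate the radial equation in direction `m`. The derivative of the factor `z m - x₀ m`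
  -- produces the isolated term `E m k`, and integrability on the zero set of the `q_m` turns the
  -- remaining terms into a linear expression in `E`.
  have hrad : ∀ᶠ z in 𝓝 x₀, ∀ m k, E m k z + ∑ l, (z l - x₀ l) * pd l (E m k) z
      = ∑ l, (z l - x₀ l) * ∑ j, eval (g z) (pderiv j (P l k)) * E m j z := by
    filter_upwards [hg.eventually_analyticAt, hr.eventually_nhds, hq0] with z h1 h2 h3 m k
    have h2z := h2.self_of_nhds
    have hmix := fun l => pd_comm m l (hgk z h1 k)
    have hdp := fun l k => pd_eval h1.differentiableAt m (P l k)
    have key : pd m (fun z => ∑ l, (z l - x₀ l) * pd l (fun y => g y k) z) z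
        = pd m (fun z => ∑ l, (z l - x₀ l) * eval (g z) (P l k)) z :=
      pd_congr m (h2.mono fun y hy => hy k)
    rw [pd_sum _ _ fun l _ => ((hcoord l z).fun_mul (analyticAt_pd l (hgk z h1 k))).differentiableAt,
      pd_sum _ _ fun l _ => ((hcoord l z).fun_mul (analyticAt_eval h1 _)).differentiableAt] at key
    simp_rw [pd_mul m (hcoord _ z).differentiableAt
        (analyticAt_pd _ (hgk z h1 k)).differentiableAt,
      pd_mul m (hcoord _ z).differentiableAt (analyticAt_eval h1 _).differentiableAt,
      pd_coord, Finset.sum_add_distrib, ite_mul, one_mul, zero_mul, Finset.sum_ite_eq,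
      Finset.mem_univ, if_true, hmix, hdp] at key
    have hEd : ∀ l, pd l (E m k) z = pd l (pd m (fun y => g y k)) z
        - ∑ j, eval (g z) (pderiv j (P m k)) * pd l (fun y => g y j) z := by
      intro l
      rw [← pd_eval h1.differentiableAt]
      exact pd_sub l (analyticAt_pd m (hgk z h1 k)).differentiableAt
        (analyticAt_eval h1 _).differentiableAt
    have e1 : ∑ l, (z l - x₀ l) * ∑ j, eval (g z) (pderiv j (P m k)) * pd l (fun y => g y j) z
        = ∑ l, (z l - x₀ l) * eval (g z) (mkDerivation ℂ (P l) (P m k)) := by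
      simp only [mkDerivation_eq_sum_pderiv, map_sum, map_mul, Finset.mul_sum]
      rw [Finset.sum_comm]
      conv_rhs => rw [Finset.sum_comm]
      refine Finset.sum_congr rfl fun j _ => ?_
      have := congrArg (fun t => eval (g z) (pderiv j (P m k)) * t) (h2z j)
      simp only [Finset.mul_sum] at this
      calc _ = _ := Finset.sum_congr rfl fun l _ => by ring
        _ = _ := this
        _ = _ := Finset.sum_congr rfl fun l _ => by ring
    have e2 : ∀ l, ∑ j, eval (g z) (pderiv j (P l k)) * E m j z
        = ∑ j, eval (g z) (pderiv j (P l k)) * pd m (fun y => g y j) z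
          - eval (g z) (mkDerivation ℂ (P l) (P m k)) := by
      intro l
      rw [hcomm (g z) h3 l m k]
      simp only [mkDerivation_eq_sum_pderiv, map_sum, map_mul, E, mul_sub,
        Finset.sum_sub_distrib]
    simp only [hEd, e2, mul_sub, Finset.sum_sub_distrib, e1]
    simp only [E]
    linear_combination key
  -- The isolated term makes the equation for `E` singular at the centre. The products `(z j - x₀ j)
  -- * E m k` absorb it, since the radial operator reproduces the linear factor; they satisfy a
  -- regular linear radial equation and vanish at `x₀`.
  have hz := eventually_eq_zero_of_radial_linear (α := Fin 3 × Fin 3 × ι)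
    (h := fun t z => (z t.1 - x₀ t.1) * E t.2.1 t.2.2 z) (x₀ := x₀)
    (fun t => (hcoord t.1 x₀).mul (hE x₀ hg _ _)) (fun t => by simp)
    (A := fun l t t' z => if t.1 = t'.1 ∧ t.2.1 = t'.2.1 then
      eval (g z) (pderiv t'.2.2 (P l t.2.2)) else 0) ?_ ?_
  · refine ⟨hg, ?_⟩
    filter_upwards [hz, hrad] with z h1 h2 l k _
    rw [← sub_eq_zero]
    change E l k z = 0
    -- Off the centre a coordinate factor can be cancelled; at the centre the equation `hrad` itself
    -- reads `E = 0`.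
    by_cases hzx : ∃ j, z j - x₀ j ≠ 0
    · obtain ⟨j, hj⟩ := hzx
      exact (mul_eq_zero.1 (h1 (j, l, k))).resolve_left hj
    · push Not at hzx
      simpa [hzx] using h2 l k
  · rintro l ⟨t1, t2, t3⟩ ⟨s1, s2, s3⟩
    by_cases h : t1 = s1 ∧ t2 = s2
    · simpa [h] using (analyticAt_eval hg _).continuousAt
    · simpa [h] using continuousAt_const
  · filter_upwards [hg.eventually_analyticAt, hrad] with z h1 h2
    rintro ⟨j, m, k⟩
    have e3 : ∀ l, pd l (fun z => (z j - x₀ j) * E m k z) z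
        = (if l = j then 1 else 0) * E m k z + (z j - x₀ j) * pd l (E m k) z := by
      intro l
      rw [pd_mul l (hcoord j z).differentiableAt (hE z h1 m k).differentiableAt, pd_coord]
    have e4 : ∀ l, (∑ t : Fin 3 × Fin 3 × ι, (if j = t.1 ∧ m = t.2.1 then
          eval (g z) (pderiv t.2.2 (P l k)) else 0) * ((z t.1 - x₀ t.1) * E t.2.1 t.2.2 z))
        = (z j - x₀ j) * ∑ i, eval (g z) (pderiv i (P l k)) * E m i z := by
      intro l
      rw [Fintype.sum_prod_type, Finset.sum_eq_single j, Fintype.sum_prod_type,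
        Finset.sum_eq_single m, Finset.mul_sum]
      · refine Finset.sum_congr rfl fun i _ => ?_
        simp; ring
      · intro b _ hb
        simp [hb.symm]
      · simp
      · intro b _ hb
        simp [hb.symm]
      · simp
    simp only [e3, e4]
    have e5 : ∑ l, (z l - x₀ l) * ((if l = j then 1 else 0) * E m k z
        + (z j - x₀ j) * pd l (E m k) z)
        = (z j - x₀ j) * (E m k z + ∑ l, (z l - x₀ l) * pd l (E m k) z) := by
      simp only [mul_add, Finset.sum_add_distrib, Finset.mul_sum]
      congr 1
      · simp
      · exact Finset.sum_congr rfl fun l _ => by ring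
    rw [e5, h2 m k, Finset.mul_sum]
    exact Finset.sum_congr rfl fun l _ => by ring

end Pfaffian

/-! ### Radial solutions of polynomial systems -/

section Radial

open MvPolynomial unitInterval

/-- The operator `f ↦ (t ↦ ∫₀ᵗ f)` on continuous functions on the unit interval. -/
def primitive : C(I, ℂ) →L[ℂ] C(I, ℂ) :=
  have hintegrable : ∀ (f : C(I, ℂ)) (a b : ℝ),
      IntervalIntegrable (Set.IccExtend zero_le_one f) MeasureTheory.volume a b :=
    fun f a b => (f.continuous.Icc_extend' (h := zero_le_one)).intervalIntegrable a b
  LinearMap.mkContinuous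
    { toFun := fun f => ⟨fun t => ∫ s in (0 : ℝ)..t, Set.IccExtend zero_le_one f s,
        (intervalIntegral.continuous_primitive (hintegrable f) 0).comp continuous_subtype_val⟩
      map_add' := fun f g => by
        ext t
        exact intervalIntegral.integral_add (hintegrable f 0 t) (hintegrable g 0 t)
      map_smul' := fun c f => by
        ext t
        exact intervalIntegral.integral_smul c _ } 1 (fun f => by
    rw [ContinuousMap.norm_le _ (by positivity)]
    intro t
    have := intervalIntegral.norm_integral_le_of_norm_le_const (a := 0) (b := (t : ℝ)) (C := ‖f‖)
      (f := Set.IccExtend zero_le_one f) (fun s _ => f.norm_coe_le_norm _)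
    refine this.trans ?_
    rw [sub_zero, abs_of_nonneg t.2.1]
    nlinarith [t.2.2, norm_nonneg f])

theorem primitive_apply (f : C(I, ℂ)) (t : I) :
    primitive f t = ∫ s in (0 : ℝ)..t, Set.IccExtend zero_le_one f s := rfl

/-- The rescaling `f ↦ (t ↦ f (r t))`. -/
def rescale (r : I) : C(I, ℂ) →ₐ[ℂ] C(I, ℂ) :=
  ContinuousMap.compRightAlgHom ℂ ℂ ⟨fun t => r * t, by fun_prop⟩

theorem rescale_apply (r : I) (f : C(I, ℂ)) (t : I) : rescale r f t = f (r * t) := rfl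

theorem rescale_primitive (r : I) (f : C(I, ℂ)) :
    rescale r (primitive f) = ((r : ℝ) : ℂ) • primitive (rescale r f) := by
  ext t
  rw [rescale_apply, primitive_apply, ContinuousMap.smul_apply, primitive_apply]
  have h1 : ∫ s in (0 : ℝ)..t, Set.IccExtend zero_le_one (rescale r f) s
      = ∫ s in (0 : ℝ)..t, Set.IccExtend zero_le_one f ((r : ℝ) * s) := by
    refine intervalIntegral.integral_congr fun s hs => ?_
    rw [Set.uIcc_of_le t.2.1] at hs
    have hs1 : s ∈ Set.Icc (0 : ℝ) 1 := ⟨hs.1, hs.2.trans t.2.2⟩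
    have hs2 : (r : ℝ) * s ∈ Set.Icc (0 : ℝ) 1 := (r * ⟨s, hs1⟩ : I).2
    change Set.IccExtend zero_le_one (rescale r f) s = Set.IccExtend zero_le_one f ((r : ℝ) * s)
    rw [Set.IccExtend_of_mem _ _ hs1, Set.IccExtend_of_mem _ _ hs2]
    rfl
  rw [h1]
  have h2 := intervalIntegral.smul_integral_comp_mul_left (a := 0) (b := (t : ℝ))
    (Set.IccExtend zero_le_one f) (r : ℝ)
  rw [mul_zero] at h2
  rw [show ((r * t : I) : ℝ) = r * t from rfl, ← h2, smul_eq_mul, Complex.real_smul]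

theorem norm_rescale_le (r : I) (f : C(I, ℂ)) : ‖rescale r f‖ ≤ ‖f‖ := by
  rw [ContinuousMap.norm_le _ (norm_nonneg _)]
  exact fun t => f.norm_coe_le_norm _

variable {ι : Type*}

theorem aeval_path_apply (Z : ι → C(I, ℂ)) (p : MvPolynomial ι ℂ) (t : I) :
    aeval Z p t = eval (fun k => Z k t) p := by
  induction p using MvPolynomial.induction_on with
  | C a => simp
  | add p q h1 h2 => simp [h1, h2]
  | mul_X p i h1 => simp [h1]

/-- The map whose zeros are the solution paths of the system along rays. -/
def radialMap (P : Fin 3 → ι → MvPolynomial ι ℂ) (y : Space) (Z : ι → C(I, ℂ)) : ι → C(I, ℂ) :=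
  fun k => primitive (∑ l, y l • aeval Z (P l k))

/-- Shortening the direction by `r` amounts to running the path at speed `r`. Combined with local
injectivity, this identifies the endpoint of the path in direction `r y` with the point at time `r`
of the path in direction `y`. -/
theorem radialMap_rescale (P : Fin 3 → ι → MvPolynomial ι ℂ) (r : I) (y : Space)
    (Z : ι → C(I, ℂ)) (k : ι) :
    radialMap P (((r : ℝ) : ℂ) • y) (fun k => rescale r (Z k)) k
      = rescale r (radialMap P y Z k) := by
  have h : ∀ p : MvPolynomial ι ℂ, aeval (fun k => rescale r (Z k)) p = rescale r (aeval Z p) :=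
    fun p => (MvPolynomial.comp_aeval_apply Z (rescale r) p).symm
  simp only [radialMap, rescale_primitive, h, map_sum, map_smul, Pi.smul_apply, smul_eq_mul,
    mul_smul]
  exact Finset.sum_congr rfl fun l _ => smul_comm _ _ _

variable [Fintype ι]

theorem analyticAt_radialMap (P : Fin 3 → ι → MvPolynomial ι ℂ) (w : Space × (ι → C(I, ℂ))) :
    AnalyticAt ℂ (fun w : Space × (ι → C(I, ℂ)) => radialMap P w.1 w.2) w := by
  refine analyticAt_pi_iff.2 fun k => ?_
  refine (primitive.analyticAt _).comp ?_
  refine Finset.analyticAt_fun_sum _ fun l _ => AnalyticAt.fun_smul ?_ ?_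
  · exact ((ContinuousLinearMap.proj (R := ℂ) (φ := fun _ : Fin 3 => ℂ) l).analyticAt _).comp
      analyticAt_fst
  · refine AnalyticAt.aeval_mvPolynomial (fun k => ?_) (P l k)
    exact ((ContinuousLinearMap.proj (R := ℂ) (φ := fun _ : ι => C(I, ℂ)) k).analyticAt _).comp
      analyticAt_snd

/-- The map is linear in `y`, hence zero for every path when `y = 0`, so its derivative there has no
component along the path variable. This makes the derivative of `Φ` in `exists_radial_solution`
triangular with identities on the diagonal. -/
theorem hasFDerivAt_radialMap (P : Fin 3 → ι → MvPolynomial ι ℂ) (Z : ι → C(I, ℂ)) :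
    ∃ B : Space →L[ℂ] (ι → C(I, ℂ)),
      HasFDerivAt (fun w : Space × (ι → C(I, ℂ)) => radialMap P w.1 w.2)
        (B ∘L ContinuousLinearMap.fst ℂ _ _) (0, Z) := by
  let π : Fin 3 → Space →L[ℂ] ℂ := fun l => ContinuousLinearMap.proj (φ := fun _ : Fin 3 => ℂ) l
  refine ⟨ContinuousLinearMap.pi fun k => primitive ∘L
    (∑ l, (π l).smulRight (aeval Z (P l k))), ?_⟩
  refine hasFDerivAt_pi'' fun k => ?_
  have h1 : HasFDerivAt (fun w : Space × (ι → C(I, ℂ)) => ∑ l, w.1 l • aeval w.2 (P l k))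
      ((∑ l, (π l).smulRight (aeval Z (P l k))) ∘L ContinuousLinearMap.fst ℂ Space (ι → C(I, ℂ)))
      (0, Z) := by
    have h2 : ∀ l, HasFDerivAt (fun w : Space × (ι → C(I, ℂ)) => w.1 l • aeval w.2 (P l k))
        (((π l).smulRight (aeval Z (P l k))) ∘L ContinuousLinearMap.fst ℂ Space (ι → C(I, ℂ)))
        (0, Z) := by
      intro l
      have h3 : HasFDerivAt (fun w : Space × (ι → C(I, ℂ)) => w.1 l)
          ((π l) ∘L ContinuousLinearMap.fst ℂ Space (ι → C(I, ℂ))) (0, Z) :=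
        ((π l) ∘L ContinuousLinearMap.fst ℂ Space (ι → C(I, ℂ))).hasFDerivAt
      have h4 : DifferentiableAt ℂ (fun w : Space × (ι → C(I, ℂ)) => aeval w.2 (P l k))
          (0, Z) := by
        refine (AnalyticAt.aeval_mvPolynomial (fun k => ?_) (P l k)).differentiableAt
        exact ((ContinuousLinearMap.proj (R := ℂ) (φ := fun _ : ι => C(I, ℂ)) k).analyticAt
          _).comp analyticAt_snd
      exact (h3.fun_smul h4.hasFDerivAt).congr_fderiv (ContinuousLinearMap.ext fun w => by simp)
    exact (HasFDerivAt.fun_sum (u := Finset.univ) (fun l _ => h2 l)).congr_fderiv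
      (ContinuousLinearMap.ext fun w => by simp)
  exact primitive.hasFDerivAt.comp (0, Z) h1

/-- For every polynomial system there is an analytic function with a prescribed value at a point
which solves the system in the radial direction. -/
theorem exists_radial_solution (P : Fin 3 → ι → MvPolynomial ι ℂ) (x₀ : Space) (d : ι → ℂ) :
    ∃ g : Space → ι → ℂ, AnalyticAt ℂ g x₀ ∧ g x₀ = d ∧
      ∀ᶠ z in 𝓝 x₀, ∀ k, ∑ l, (z l - x₀ l) * pd l (fun y => g y k) z
        = ∑ l, (z l - x₀ l) * eval (g z) (P l k) := by
  let Z₀ : ι → C(I, ℂ) := fun k => algebraMap ℂ _ (d k)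
  -- The preimage of `(y, 0)` under `Φ` is the solution path in direction `y` that starts at `d`;
  -- the inverse function theorem makes it analytic in `y`.
  let Φ : Space × (ι → C(I, ℂ)) → Space × (ι → C(I, ℂ)) :=
    fun w => (w.1, w.2 - Z₀ - radialMap P w.1 w.2)
  have hΦa : ∀ w, AnalyticAt ℂ Φ w := fun w =>
    analyticAt_fst.prod ((analyticAt_snd.fun_sub analyticAt_const).fun_sub
      (analyticAt_radialMap P w))
  obtain ⟨B, hB⟩ := hasFDerivAt_radialMap P Z₀
  let e := ContinuousLinearEquiv.skewProd (ContinuousLinearEquiv.refl ℂ Space)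
    (ContinuousLinearEquiv.refl ℂ (ι → C(I, ℂ))) (-B)
  have hΦd : HasFDerivAt Φ (e : (Space × (ι → C(I, ℂ))) →L[ℂ] _) (0, Z₀) := by
    have h1 := (hasFDerivAt_fst (𝕜 := ℂ) (p := ((0 : Space), Z₀))).prodMk
      (((hasFDerivAt_snd (𝕜 := ℂ) (p := ((0 : Space), Z₀))).sub_const Z₀).fun_sub hB)
    refine h1.congr_fderiv (ContinuousLinearMap.ext fun w => ?_)
    refine Prod.ext ?_ ?_ <;> simp [e, sub_eq_add_neg]
  have hΦs : HasStrictFDerivAt Φ (e : (Space × (ι → C(I, ℂ))) →L[ℂ] _) (0, Z₀) := by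
    have := (hΦa (0, Z₀)).hasStrictFDerivAt
    rwa [hΦd.fderiv] at this
  let ψ := hΦs.toOpenPartialHomeomorph Φ
  have hψ : ∀ w, ψ w = Φ w := fun w => rfl
  have hsrc : ((0 : Space), Z₀) ∈ ψ.source := hΦs.mem_toOpenPartialHomeomorph_source
  have hΦ0 : Φ (0, Z₀) = 0 := by
    have : radialMap P 0 Z₀ = 0 := by
      funext k
      change primitive (∑ l, (0 : ℂ) • aeval Z₀ (P l k)) = 0
      rw [Finset.sum_eq_zero fun l _ => zero_smul ℂ (aeval Z₀ (P l k)), map_zero]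
    simp [Φ, this]
  have hsymm0 : ψ.symm 0 = (0, Z₀) := by
    rw [← hΦ0, ← hψ]
    exact ψ.left_inv hsrc
  have han : AnalyticAt ℂ ψ.symm 0 := by
    have := ψ.analyticAt_symm' hsrc (hΦa _) hΦd.fderiv
    rwa [hψ, hΦ0] at this
  let j : Space → Space × (ι → C(I, ℂ)) := fun y => (y, 0)
  have hj : ∀ y, AnalyticAt ℂ j y := fun y => analyticAt_id.prod analyticAt_const
  have hj0 : j 0 = 0 := rfl
  let G : Space → ι → C(I, ℂ) := fun y => (ψ.symm (j y)).2
  have hGa : AnalyticAt ℂ G 0 := by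
    have : AnalyticAt ℂ (fun y => ψ.symm (j y)) 0 :=
      AnalyticAt.comp (g := ψ.symm) (f := j) (x := 0) (by rw [hj0]; exact han) (hj 0)
    exact analyticAt_snd.comp this
  let ev : (ι → C(I, ℂ)) →L[ℂ] (ι → ℂ) := ContinuousLinearMap.pi fun k =>
    (ContinuousMap.evalCLM ℂ (1 : I)) ∘L ContinuousLinearMap.proj (R := ℂ) k
  let g₀ : Space → ι → ℂ := fun y => ev (G y)
  have hg₀a : AnalyticAt ℂ g₀ 0 := (ev.analyticAt _).comp hGa
  have hg₀k : ∀ y k, g₀ y k = G y k 1 := fun y k => rfl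
  have hg₀0 : g₀ 0 = d := by
    funext k
    simp [hg₀k, G, hj0, hsymm0, Z₀]
  obtain ⟨ρ, hρ, hball⟩ := Metric.isOpen_iff.1 ψ.open_source _ hsrc
  have hcont : ContinuousAt (fun y => ψ.symm (j y)) 0 := by
    refine ContinuousAt.comp (g := ψ.symm) ?_ (hj 0).continuousAt
    rw [hj0]; exact han.continuousAt
  have hnear : ∀ᶠ y in 𝓝 (0 : Space),
      j y ∈ ψ.target ∧ ψ.symm (j y) ∈ Metric.ball ((0 : Space), Z₀) ρ := by
    refine ((hj 0).continuousAt.eventually ?_).and (hcont.eventually ?_)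
    · rw [hj0, ← hΦ0, ← hψ]
      exact ψ.open_target.mem_nhds (ψ.map_source hsrc)
    · change Metric.ball _ ρ ∈ 𝓝 (ψ.symm (j 0))
      rw [hj0, hsymm0]
      exact Metric.ball_mem_nhds _ hρ
  have hpath : ∀ᶠ y in 𝓝 (0 : Space), (∀ k, G y k = Z₀ k + radialMap P y (G y) k) ∧
      ∀ r : I, ∀ k, g₀ (((r : ℝ) : ℂ) • y) k = G y k r := by
    filter_upwards [hnear] with y hy
    have h1 : Φ (ψ.symm (j y)) = j y := ψ.right_inv hy.1
    have h2 : (ψ.symm (j y)).1 = y := congrArg Prod.fst h1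
    have h3 : G y - Z₀ - radialMap P y (G y) = 0 := by
      have := congrArg Prod.snd h1
      simp only [Φ, h2] at this
      exact this
    have h4 : ∀ k, G y k = Z₀ k + radialMap P y (G y) k := by
      intro k
      have := congrFun h3 k
      simp only [Pi.sub_apply, Pi.zero_apply] at this
      linear_combination (exp := 1) this
    refine ⟨h4, fun r k => ?_⟩
    let Z : ι → C(I, ℂ) := fun k => rescale r (G y k)
    have hZ₀ : ∀ k, rescale r (Z₀ k) = Z₀ k := fun k => by
      ext t; simp [Z₀]
    have h5 : Φ (((r : ℝ) : ℂ) • y, Z) = j (((r : ℝ) : ℂ) • y) := by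
      refine Prod.ext rfl ?_
      funext k
      have := radialMap_rescale P r y (G y) k
      simp only [Φ, Z, Pi.sub_apply, this, j, Pi.zero_apply]
      conv_lhs => rw [h4 k]
      simp [hZ₀]
    -- Rescaling fixes the constant path `Z₀` and does not increase norms, so the rescaled path
    -- stays in the ball on which `Φ` is injective.
    have h6 : ((((r : ℝ) : ℂ) • y, Z) : Space × (ι → C(I, ℂ))) ∈ ψ.source := by
      apply hball
      have h7 := hy.2
      rw [Metric.mem_ball, Prod.dist_eq, max_lt_iff] at h7 ⊢
      constructor
      · refine lt_of_le_of_lt ?_ h7.1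
        rw [h2, dist_zero_right, dist_zero_right, norm_smul, Complex.norm_real,
          Real.norm_of_nonneg r.2.1]
        exact mul_le_of_le_one_left (norm_nonneg _) r.2.2
      · refine lt_of_le_of_lt ?_ h7.2
        rw [dist_pi_le_iff dist_nonneg]
        intro k
        refine le_trans ?_ (dist_le_pi_dist (G y) Z₀ k)
        rw [dist_eq_norm, dist_eq_norm]
        simp only [Z]
        rw [← hZ₀ k, ← map_sub]
        simpa [hZ₀ k] using norm_rescale_le r (G y k - Z₀ k)
    have h8 : ψ.symm (j (((r : ℝ) : ℂ) • y)) = (((r : ℝ) : ℂ) • y, Z) := by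
      rw [← h5, ← hψ]
      exact ψ.left_inv h6
    rw [hg₀k]
    change (ψ.symm (j (((r : ℝ) : ℂ) • y))).2 k 1 = _
    rw [h8]
    change G y k (r * 1) = _
    rw [mul_one]
  have hgd : ∀ᶠ y in 𝓝 (0 : Space), AnalyticAt ℂ g₀ y := hg₀a.eventually_analyticAt
  have hrad : ∀ᶠ y in 𝓝 (0 : Space), ∀ k, ∑ l, y l * pd l (fun y => g₀ y k) y
        = ∑ l, y l * eval (g₀ y) (P l k) := by
    -- The ray is taken through `2 y`, so that `y` lies at the interior time `1/2` and the integral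
    -- has a two-sided derivative there.
    have hdouble : Tendsto (fun y : Space => (2 : ℂ) • y) (𝓝 0) (𝓝 0) := by
      have : Continuous (fun y : Space => (2 : ℂ) • y) := by fun_prop
      simpa using this.tendsto 0
    filter_upwards [hgd, hdouble.eventually hpath] with y h1 h2 k
    obtain ⟨h3, h4⟩ := h2
    have hgk : DifferentiableAt ℂ (fun y => g₀ y k) y :=
      differentiableAt_pi.1 h1.differentiableAt k
    have hhalf : (((1 / 2 : ℝ) : ℂ) • (2 : ℂ) • y) = y := by
      rw [smul_smul]; norm_num
    let half : I := ⟨1 / 2, by norm_num, by norm_num⟩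
    have hline : HasDerivAt (fun s : ℝ => g₀ ((s : ℂ) • (2 : ℂ) • y) k)
        (fderiv ℂ (fun y => g₀ y k) y ((2 : ℂ) • y)) (1 / 2 : ℝ) := by
      have h5 : HasDerivAt (fun s : ℝ => (s : ℂ) • (2 : ℂ) • y) ((2 : ℂ) • y) (1 / 2 : ℝ) := by
        simpa using (Complex.ofRealCLM.hasDerivAt (x := (1 / 2 : ℝ))).smul_const ((2 : ℂ) • y)
      have h6 := hgk.hasFDerivAt.restrictScalars ℝ
      rw [← hhalf] at h6
      have h7 := h6.comp_hasDerivAt (1 / 2 : ℝ) h5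
      rw [hhalf] at h7
      exact h7
    let F : C(I, ℂ) := ∑ l, ((2 : ℂ) • y) l • aeval (G ((2 : ℂ) • y)) (P l k)
    have hprim : HasDerivAt (fun s : ℝ => d k + ∫ u in (0 : ℝ)..s, Set.IccExtend zero_le_one F u)
        (Set.IccExtend zero_le_one F (1 / 2 : ℝ)) (1 / 2 : ℝ) := by
      have hc : Continuous (Set.IccExtend (zero_le_one (α := ℝ)) F) := F.continuous.Icc_extend'
      exact (intervalIntegral.integral_hasDerivAt_right (hc.intervalIntegrable _ _)
        (hc.stronglyMeasurableAtFilter _ _) hc.continuousAt).const_add (d k)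
    have hEq : (fun s : ℝ => g₀ ((s : ℂ) • (2 : ℂ) • y) k) =ᶠ[𝓝 (1 / 2 : ℝ)]
        fun s : ℝ => d k + ∫ u in (0 : ℝ)..s, Set.IccExtend zero_le_one F u := by
      filter_upwards [Icc_mem_nhds (show (0 : ℝ) < 1 / 2 by norm_num)
        (show (1 / 2 : ℝ) < 1 by norm_num)] with s hs
      have := h4 ⟨s, hs⟩ k
      simp only at this
      rw [this, h3 k]
      rfl
    have hval := hline.unique (hprim.congr_of_eventuallyEq hEq)
    have hFv : Set.IccExtend zero_le_one F (1 / 2 : ℝ) = ∑ l, (2 * y l) * eval (g₀ y) (P l k) := by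
      rw [Set.IccExtend_of_mem _ _ half.2]
      have h9 : (fun k => G ((2 : ℂ) • y) k half) = g₀ y := by
        funext k
        rw [← h4 half k]
        simp only [half, hhalf]
      change F half = _
      simp only [F, ContinuousMap.coe_sum, Finset.sum_apply, ContinuousMap.smul_apply,
        aeval_path_apply, h9, Pi.smul_apply, smul_eq_mul]
    rw [hFv, map_smul, fderiv_apply_eq_sum_pd] at hval
    simp only [mul_assoc, ← Finset.mul_sum, smul_eq_mul] at hval
    exact mul_left_cancel₀ two_ne_zero hval
  refine ⟨fun z => g₀ (z - x₀), ?_, by simp [hg₀0], ?_⟩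
  · have h1 : AnalyticAt ℂ (fun z : Space => z - x₀) x₀ := analyticAt_id.fun_sub analyticAt_const
    exact AnalyticAt.comp (g := g₀) (f := fun z => z - x₀) (by simpa using hg₀a) h1
  · have ht : Tendsto (fun z : Space => z - x₀) (𝓝 x₀) (𝓝 0) := by
      have : Continuous (fun z : Space => z - x₀) := by fun_prop
      simpa using this.tendsto x₀
    filter_upwards [ht.eventually hrad] with z hz k
    have h1 : ∀ l, pd l (fun y => g₀ (y - x₀) k) z = pd l (fun y => g₀ y k) (z - x₀) := by
      intro l
      simp only [pd]
      rw [fderiv_comp_sub (f := fun y => g₀ y k)]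
    simpa [h1] using hz k

/-- A polynomial system that is integrable along the zero set of invariant quantities `q_m` has a
solution through every point of this zero set. -/
theorem exists_solvesSystemAt {P : Fin 3 → ι → MvPolynomial ι ℂ} {κ : Type*}
    [Fintype κ] {q : κ → MvPolynomial ι ℂ} {c : Fin 3 → κ → κ → MvPolynomial ι ℂ}
    (hq : ∀ l m z, eval z (mkDerivation ℂ (P l) (q m)) = ∑ j, eval z (c l m j) * eval z (q j))
    (hcomm : ∀ z, (∀ m, eval z (q m) = 0) → ∀ l m k,
      eval z (mkDerivation ℂ (P l) (P m k)) = eval z (mkDerivation ℂ (P m) (P l k)))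
    (x₀ : Space) (d : ι → ℂ) (hd : ∀ m, eval d (q m) = 0) :
    ∃ g : Space → ι → ℂ, g x₀ = d ∧ SolvesSystemAt P Set.univ g x₀ ∧
      ∀ᶠ z in 𝓝 x₀, ∀ m, eval (g z) (q m) = 0 := by
  obtain ⟨g, hg, hg0, hr⟩ := exists_radial_solution P x₀ d
  have h0 : ∀ m, eval (g x₀) (q m) = 0 := by rw [hg0]; exact hd
  exact ⟨g, hg0, solvesSystemAt_of_radial hq hcomm hg hr h0,
    eventually_eval_eq_zero_of_radial hq hg hr h0⟩

end Radial

/-! ### The derivative relations for the ten basic functions -/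

section DerivativeRelations

open MvPolynomial Label

theorem fin_three (i : Fin 3) : i = 0 ∨ i = 1 ∨ i = 2 := by
  fin_cases i <;> simp

theorem fin_three_lt {i j : Fin 3} (h : i < j) :
    (i = 0 ∧ j = 1) ∨ (i = 0 ∧ j = 2) ∨ (i = 1 ∧ j = 2) := by
  fin_cases i <;> fin_cases j <;> simp at h ⊢

theorem fin_three_le {i j : Fin 3} (h : i ≤ j) :
    (i = 0 ∧ j = 0) ∨ (i = 0 ∧ j = 1) ∨ (i = 0 ∧ j = 2) ∨ (i = 1 ∧ j = 1) ∨ (i = 1 ∧ j = 2) ∨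
      (i = 2 ∧ j = 2) := by
  fin_cases i <;> fin_cases j <;> simp at h ⊢

theorem fin_six (i : Fin 6) : i = 0 ∨ i = 1 ∨ i = 2 ∨ i = 3 ∨ i = 4 ∨ i = 5 := by
  fin_cases i <;> simp

instance : DecidableEq Label := Classical.decEq _

instance : Fintype Label where
  elems := {A12, A13, A22, A23, A33, B12, B22, B23, B33, C33}
  complete x := by cases x <;> simp

/-- The quadratic right hand sides of the derivative relations; `c` stands for the scalar `1/6`. -/
def derivForm {R : Type*} [CommRing R] (c : R) (d : Label → R) : Fin 3 → Label → R
  | 0, A12 => c * (4 * d A12 * d B12 + 2 * d A13 * d A23 - 2 * d A12 * d A22)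
  | 0, A13 => c * (2 * d A12 * d A23 + 2 * d A13 * d A33 + 4 * d A13 * d B12 - 4 * d A13 * d A22)
  | 0, A22 => c * (4 * d A12 * d B22 + 4 * d A13 * d B23 - 2 * d A13 * d A13 - 2 * d A22 * d
        A22 - 2 * d A23 * d A23)
  | 0, A23 => c * (2 * d A12 * d A13 + 2 * d A23 * d A33 + 4 * d A23 * d B12 - 2 * d A22 * d A23)
  | 0, A33 => c * (2 * d A12 * d A12 + 4 * d A12 * d B33 + 4 * d A13 * d C33 - 2 * d A23 * d
        A23 - 2 * d A33 * d A33)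
  | 0, B12 => c * (2 * d A12 * d A12 + d A22 * d B12 + 3 * d A23 * d A23 + 2 * d B12 * d B12 -
        d A12 * d B22 - d A13 * d B23)
  | 0, B22 => c * (2 * d A12 * d A22 + 2 * d A23 * d B23 + 2 * d B12 * d B22 - 2 * d A13 * d A23)
  | 0, B23 => c * (4 * d A12 * d A23 + 2 * d A23 * d B33 + 2 * d B12 * d B23)
  | 0, B33 => c * (2 * d A12 * d A33 + 2 * d A23 * d C33 + 2 * d B12 * d B33)
  | 0, C33 => c * (2 * d A13 * d A33 + 2 * d A23 * d B33 + 2 * d A33 * d C33 + 2 * d B12 * d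
        C33 - 2 * d A22 * d C33)
  | 1, A12 => c * (2 * d A12 * d A12 + d A22 * d B12 + 3 * d A23 * d A23 + 2 * d B12 * d B12 -
        d A12 * d B22 - d A13 * d B23)
  | 1, A13 => c * (2 * d A12 * d A13 + 2 * d A23 * d A33 + 4 * d A23 * d B12 - 2 * d A22 * d A23)
  | 1, A22 => c * (2 * d A12 * d A22 + 2 * d A23 * d B23 + 2 * d B12 * d B22 - 2 * d A13 * d A23)
  | 1, A23 => c * (4 * d A12 * d A23 + 2 * d A23 * d B33 + 2 * d B12 * d B23)
  | 1, A33 => c * (2 * d A12 * d A33 + 2 * d A23 * d C33 + 2 * d B12 * d B33)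
  | 1, B12 => c * (4 * d A12 * d B12 + 2 * d A23 * d B23 + 2 * d B12 * d B22)
  | 1, B22 => c * (4 * d A22 * d B12 + 2 * d A23 * d A23 + 2 * d B22 * d B22 + 2 * d B23 * d
        B23 - 4 * d A13 * d B23)
  | 1, B23 => c * (4 * d A12 * d B23 + 2 * d A23 * d B12 + 2 * d B22 * d B23 + 2 * d B23 * d B33)
  | 1, B33 => c * (2 * d A12 * d B33 + 2 * d A33 * d B12 + 2 * d B22 * d B33 + 2 * d B23 * d C33)
  | 1, C33 => c * (2 * d A12 * d C33 + 2 * d A23 * d A33 + 2 * d B23 * d B33 + 2 * d B33 * d C33)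
  | 2, A12 => c * (2 * d A12 * d A13 + 2 * d A23 * d A33 + 4 * d A23 * d B12 - 2 * d A22 * d A23)
  | 2, A13 => c * (2 * d A13 * d A13 + 2 * d A22 * d A22 + 3 * d A23 * d A23 + 2 * d A33 * d
        A33 + 4 * d A33 * d B12 + 2 * d B12 * d B12 - d A12 * d B22 - d A13 * d B23 - 4 * d A22 *
        d A33 - 3 * d A22 * d B12)
  | 2, A22 => c * (2 * d A12 * d A23 + 4 * d A13 * d A22 + 2 * d A23 * d B33 + 2 * d B12 * d
        B23 - 2 * d A13 * d A33 - 4 * d A13 * d B12)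
  | 2, A23 => c * (2 * d A12 * d A33 + 4 * d A12 * d B12 + 2 * d A13 * d A23 + 2 * d A23 * d
        C33 + 2 * d B12 * d B33 - 2 * d A12 * d A22)
  | 2, A33 => c * (2 * d A13 * d A33 + 2 * d A23 * d B33 + 2 * d A33 * d C33 + 2 * d B12 * d
        C33 - 2 * d A22 * d C33)
  | 2, B12 => c * (4 * d A12 * d A23 + 2 * d A23 * d B33 + 2 * d B12 * d B23)
  | 2, B22 => c * (2 * d A12 * d B23 + 2 * d A22 * d A23 + 2 * d B22 * d B23 + 2 * d B23 * d
        B33 - 2 * d A12 * d A13 - 2 * d A13 * d B33)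
  | 2, B23 => c * (2 * d A12 * d A12 + 4 * d A12 * d B33 + d A22 * d B12 + 3 * d A23 * d A23 +
        2 * d B23 * d B23 + 2 * d B33 * d B33 - d A12 * d B22 - d A13 * d B23)
  | 2, B33 => c * (2 * d A12 * d C33 + 2 * d A23 * d A33 + 2 * d B23 * d B33 + 2 * d B33 * d C33)
  | 2, C33 => c * (2 * d A23 * d A23 + 4 * d A33 * d A33 + 4 * d A33 * d B12 + 2 * d B33 * d
        B33 + 2 * d C33 * d C33 - 2 * d A12 * d A12 - 4 * d A22 * d A33)

theorem map_derivForm {R S : Type*} [CommRing R] [CommRing S] (f : R →+* S) (c : R) (d : Label → R)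
    (l : Fin 3) (k : Label) :
    f (derivForm c d l k) = derivForm (f c) (fun k => f (d k)) l k := by
  fin_cases l <;> cases k <;> simp [derivForm, map_ofNat]

/-- The quadratic polynomials of the derivative relations. -/
def derivPoly (l : Fin 3) (k : Label) : MvPolynomial Label ℂ := derivForm (C (1 / 6)) X l k

theorem eval_derivPoly (d : Label → ℂ) (l : Fin 3) (k : Label) :
    eval d (derivPoly l k) = derivForm (1 / 6) d l k := by
  simp [derivPoly, map_derivForm]

/-- Uses only that each of the thirty formulas is a combination of products of two variables; the
submodule of interest is that of homogeneous polynomials of degree two. -/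
theorem derivForm_mem {A : Type*} [CommRing A] [Algebra ℂ A] (S : Submodule ℂ A) {d : Label → A}
    (hd : ∀ i j, d i * d j ∈ S) (a : ℂ) (l : Fin 3) (k : Label) :
    derivForm (algebraMap ℂ A a) d l k ∈ S := by
  have hc : ∀ {p : A}, p ∈ S → algebraMap ℂ A a * p ∈ S := fun {p} hp => by
    rw [← Algebra.smul_def]
    exact S.smul_mem a hp
  have hn : ∀ (n : ℕ) [n.AtLeastTwo] (i j : Label), (OfNat.ofNat n : A) * d i * d j ∈ S :=
    fun n _ i j => by
      rw [mul_assoc, show (OfNat.ofNat n : A) = ((n : ℕ) : A) from rfl, ← nsmul_eq_mul]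
      exact S.nsmul_mem (hd i j) n
  fin_cases l <;> cases k <;> refine hc ?_ <;>
    repeat' first
      | exact hd _ _
      | exact hn _ _ _
      | refine S.add_mem ?_ ?_
      | refine S.sub_mem ?_ ?_

theorem isHomogeneous_derivPoly (l : Fin 3) (k : Label) : (derivPoly l k).IsHomogeneous 2 :=
  derivForm_mem (homogeneousSubmodule Label ℂ 2)
    (fun i j => (isHomogeneous_X ℂ i).mul (isHomogeneous_X ℂ j)) (1 / 6) l k

theorem mkDerivation_ofNat {ι : Type*} (Q : ι → MvPolynomial ι ℂ) (n : ℕ) [n.AtLeastTwo] :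
    mkDerivation ℂ Q ofNat(n) = 0 :=
  (mkDerivation ℂ Q).map_natCast n

/-- The coefficients that express the derivatives of the six quadrics by these quadrics; `c` stands
for the scalar `1/18`. -/
def cofactor {R : Type*} [CommRing R] (c : R) (d : Label → R) : Fin 3 → Fin 6 → Fin 6 → R
  | 0, 0 => ![c * (-6 * d A22 + 6 * d A33 + 18 * d B12), c * (d A13 - 12 * d B23), c * (-d A13), c
    * (-6 * d A12), c * (-6 * d A23), c * d A13]
  | 0, 1 => ![c * 6 * d A13, c * (-5 * d A22 - 13 * d A33 + 6 * d B12), c * (-d A22 + d A33), 0, c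
    * (-12 * d A12), c * (d A22 - d A33)]
  | 0, 2 => ![c * 6 * d C33, c * (d A33 - 6 * d B12), c * (-d A33 + 12 * d B12), c * (-12 * d
    A23), c * 12 * d A12, c * d A33]
  | 0, 3 => ![c * (-6 * d A12), c * 7 * d A23, c * (-d A23), c * (-12 * d A22 + 6 * d A33 + 18 * d
    B12), 0, c * d A23]
  | 0, 4 => ![0, c * (-5 * d A12 - 6 * d B33), c * 17 * d A12, c * (-6 * d A13 + 18 * d B23 - 18 *
    d C33), c * (-6 * d A22 - 12 * d A33), c * d A12]
  | 0, 5 => ![c * (12 * d A13 + 6 * d C33), c * (2 * d A22 + 14 * d A33 - 6 * d B12), c * (4 * d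
    A22 - 2 * d A33 + 6 * d B12), c * 24 * d A23, c * 24 * d A12, c * (-4 * d A22 + 2 * d A33 + 6
    * d B12)]
  | 1, 0 => ![c * (18 * d A12 + 6 * d B22 + 6 * d B33), c * d A23, c * (-d A23), c * (-6 * d B12),
    0, c * d A23]
  | 1, 1 => ![c * 12 * d A23, c * (12 * d A12 + d B22 + 11 * d B33), c * (-12 * d A12 - d B22 + d
    B33), c * (-6 * d B23 + 6 * d C33), c * 12 * d A33, c * (d B22 - d B33)]
  | 1, 2 => ![0, c * (-11 * d B33), c * (24 * d A12 + 12 * d B22 - d B33), c * (-12 * d C33), c *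
    (-12 * d A33), c * d B33]
  | 1, 3 => ![c * 6 * d A33, c * (-5 * d B23), c * (-d B23), c * (12 * d A12 + 6 * d B22), c * (-6
    * d A23), c * d B23]
  | 1, 4 => ![c * (-6 * d C33), c * (-5 * d B12), c * 5 * d B12, c * (-6 * d A23), c * (12 * d A12
    + 6 * d B22), c * d B12]
  | 1, 5 => ![c * 24 * d A23, c * (-6 * d A12 + 2 * d B22 - 22 * d B33), c * (30 * d A12 + 10 * d
    B22 - 2 * d B33), c * (24 * d B23 - 18 * d C33), c * (-24 * d A33), c * (6 * d A12 + 2 * d B22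
    + 2 * d B33)]
  | 2, 0 => ![c * (6 * d A13 + 12 * d C33), c * (-d A22 + d A33 + 13 * d B12), c * (7 * d A22 - 7
    * d A33 + 5 * d B12), 0, c * (-6 * d B22), c * (-d A22 + d A33 + d B12)]
  | 2, 1 => ![c * (-6 * d A22 + 6 * d A33 + 12 * d B12), c * (5 * d A13 + d B23 + 5 * d C33), c *
    (d A13 - d B23 + d C33), c * 6 * d A12, c * (-12 * d A23), c * (-d A13 + d B23 - d C33)]
  | 2, 2 => ![c * (-6 * d B12), c * (12 * d B23 + d C33), c * (6 * d A13 + 12 * d B23 + 5 * d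
    C33), c * (-6 * d A12 - 6 * d B22), c * 12 * d A23, c * d C33]
  | 2, 3 => ![0, c * (-5 * d A12 + 7 * d B33), c * (-13 * d A12 - d B33), c * (6 * d A13 - 6 * d
    B23 + 12 * d C33), c * 6 * d A22, c * (d A12 + d B33)]
  | 2, 4 => ![c * (6 * d A12 - 6 * d B33), c * (-5 * d A23), c * 5 * d A23, c * (12 * d A22 - 12 *
    d A33 - 6 * d B12), c * 12 * d C33, c * d A23]
  | 2, 5 => ![c * (-12 * d A22 + 30 * d A33 + 36 * d B12), c * (-2 * d A13 - 4 * d B23 - 4 * d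
    C33), c * (-16 * d A13 + 10 * d B23 + 4 * d C33), c * (-12 * d A12 + 12 * d B22), c * (-12 * d
    A23), c * (4 * d A13 + 2 * d B23 + 2 * d C33)]

theorem map_cofactor {R S : Type*} [CommRing R] [CommRing S] (f : R →+* S) (c : R) (d : Label → R)
    (l : Fin 3) (m j : Fin 6) :
    f (cofactor c d l m j) = cofactor (f c) (fun k => f (d k)) l m j := by
  fin_cases l <;> fin_cases m <;> fin_cases j <;> simp [cofactor, map_ofNat]

set_option maxHeartbeats 1000000 in
/-- The ideal of the six quadrics is invariant under the derivative relations. -/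
theorem eval_derivation_quadric (l : Fin 3) (m : Fin 6) (d : Label → ℂ) :
    eval d (mkDerivation ℂ (derivPoly l) (quadric m))
      = ∑ j, cofactor (1 / 18) d l m j * eval d (quadric j) := by
  rw [Fin.sum_univ_six]
  rcases fin_three l with rfl | rfl | rfl <;>
    rcases fin_six m with rfl | rfl | rfl | rfl | rfl | rfl <;>
    dsimp [quadric, cofactor] <;>
    simp only [Derivation.leibniz, Derivation.leibniz_pow, mkDerivation_X,
      mkDerivation_ofNat, map_add, map_sub, map_neg, map_mul, map_pow, smul_eq_mul, eval_X,
      map_ofNat, mul_zero, add_zero, eval_derivPoly, nsmul_eq_mul, map_natCast] <;>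
    dsimp only [derivForm] <;> push_cast <;> ring


set_option maxHeartbeats 1000000 in
/-- The derivative relations are integrable along the common zeros of the six quadrics. -/
theorem derivPoly_integrable {d : Label → ℂ} (hd : ∀ m, eval d (quadric m) = 0) (l m : Fin 3)
    (k : Label) : eval d (mkDerivation ℂ (derivPoly l) (derivPoly m k))
      = eval d (mkDerivation ℂ (derivPoly m) (derivPoly l k)) := by
  have h0 := hd 0
  have h1 := hd 1
  have h2 := hd 2
  have h3 := hd 3
  have h4 := hd 4
  have h5 := hd 5
  simp [quadric] at h0 h1 h2 h3 h4 h5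
  -- The commutators are cubic, so the multipliers of the quadrics are linear forms. The sixth
  -- quadric is used here, whereas `hess_integrable` and `curv_eq_zero` use only the first five.
  have h01 : eval d (mkDerivation ℂ (derivPoly 0) (derivPoly 1 k))
      = eval d (mkDerivation ℂ (derivPoly 1) (derivPoly 0 k)) := by
    cases k <;> dsimp only [derivPoly, derivForm] <;>
      simp only [Derivation.leibniz, derivation_C, mkDerivation_X, mkDerivation_ofNat, map_add, map_sub,
      map_mul, smul_eq_mul, eval_X, eval_C, map_ofNat, mul_zero, add_zero,
        eval_derivPoly] <;>
      dsimp only [derivForm]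
    · linear_combination (-1/18 * d A13) * h0 + (-1/108 * d A22 - 1/18 * d B12) * h1 + (1/108 *
        d A22 + 1/18 * d B12) * h2 + (-2/9 * d A23) * h3 + (-1/108 * d A22 - 1/18 * d B12) * h5
    · linear_combination (-1/6 * d A23) * h1 + 1/18 * d A23 * h2 + (-1/9 * d B12) * h3 + (-1/18
        * d A23) * h5
    · linear_combination (-1/3 * d A23) * h0 + (1/27 * d A12 - 1/18 * d B22) * h1 + (-1/27 * d
        A12 + 1/18 * d B22) * h2 + (-2/9 * d B23) * h3 + (1/27 * d A12 - 1/18 * d B22) * h5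
    · linear_combination (-1/9 * d B12) * h0 + (1/54 * d A13 - 1/54 * d B23) * h1 + (-1/54 * d
        A13 + 1/54 * d B23) * h2 + 1/9 * d A12 * h3 + (1/54 * d A13 - 1/54 * d B23) * h5
    · linear_combination (1/9 * d A12 + 1/6 * d B33) * h1 + (-2/9 * d A12 + 1/18 * d B33) * h2 +
        (-2/9 * d B23) * h3 + 2/9 * d A33 * h4 + (-1/18 * d B33) * h5
    · linear_combination 2/9 * d A23 * h0 + (1/18 * d A12 - 1/108 * d B22) * h1 + (-1/18 * d A12
        + 1/108 * d B22) * h2 + 1/18 * d B23 * h3 + (1/18 * d A12 - 1/108 * d B22) * h5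
    · linear_combination (-2/9 * d A13) * h0 + (1/18 * d A22 + 1/27 * d B12) * h1 + (-1/18 * d
        A22 - 1/27 * d B12) * h2 + (-1/3 * d A23) * h3 + (1/18 * d A22 + 1/27 * d B12) * h5
    · linear_combination 1/9 * d A12 * h0 + 1/18 * d A23 * h1 + (-1/18 * d A23) * h2 + 1/18 * d
        A23 * h5
    · linear_combination 1/9 * d C33 * h0 + (1/27 * d A33 - 2/27 * d B12) * h1 + (-1/27 * d A33
        - 1/27 * d B12) * h2 + (1/27 * d A33 + 1/27 * d B12) * h5
    · linear_combination (-1/9 * d B33) * h0 + (-2/27 * d A23) * h1 + (-1/27 * d A23) * h2 + 1/9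
        * d A33 * h3 + 1/27 * d A23 * h5
  have h02 : eval d (mkDerivation ℂ (derivPoly 0) (derivPoly 2 k))
      = eval d (mkDerivation ℂ (derivPoly 2) (derivPoly 0 k)) := by
    cases k <;> dsimp only [derivPoly, derivForm] <;>
      simp only [Derivation.leibniz, derivation_C, mkDerivation_X, mkDerivation_ofNat, map_add, map_sub,
      map_mul, smul_eq_mul, eval_X, eval_C, map_ofNat, mul_zero, add_zero,
        eval_derivPoly] <;>
      dsimp only [derivForm]
    · linear_combination (-1/6 * d A23) * h1 + 1/18 * d A23 * h2 + (-1/9 * d B12) * h3 + (-1/18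
        * d A23) * h5
    · linear_combination (-1/18 * d A13) * h0 + (41/108 * d A22 - 7/18 * d A33 - 7/18 * d B12) *
        h1 + (-5/108 * d A22 + 1/18 * d A33 + 1/18 * d B12) * h2 + (-2/9 * d A23) * h3 + (-1/9 * d
        A12) * h4 + (5/108 * d A22 - 1/18 * d A33 - 1/18 * d B12) * h5
    · linear_combination (2/9 * d A22 - 4/9 * d A33 - 2/3 * d B12) * h0 + (7/27 * d A13 + 1/6 *
        d B23) * h1 + (5/27 * d A13 + 1/18 * d B23) * h2 + (1/9 * d A12 - 2/9 * d B22) * h3 + 1/3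
        * d A23 * h4 + (1/27 * d A13 - 1/18 * d B23) * h5
    · linear_combination (-17/54 * d A12 - 7/54 * d B33) * h1 + (5/54 * d A12 + 1/54 * d B33) *
        h2 + (1/9 * d B23 - 1/9 * d C33) * h3 + (-1/9 * d A33) * h4 + (1/54 * d A12 - 1/54 * d
        B33) * h5
    · linear_combination (-2/9 * d A33 - 2/9 * d B12) * h0 + (-2/27 * d A13 + 2/9 * d B23 - 1/18
        * d C33) * h1 + (5/27 * d A13 + 1/18 * d C33) * h2 + (2/9 * d A12 - 2/9 * d B22) * h3 +
        (1/27 * d A13 - 1/18 * d C33) * h5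
    · linear_combination (-1/18 * d A22 + 1/9 * d A33 + 1/6 * d B12) * h0 + (1/108 * d A13 -
        7/108 * d B23) * h1 + (-7/108 * d A13 + 1/108 * d B23) * h2 + (1/9 * d A12 + 1/18 * d B22)
        * h3 + (-2/9 * d A23) * h4 + (1/108 * d A13 - 1/108 * d B23) * h5
    · linear_combination 1/9 * d A12 * h0 + 1/27 * d A23 * h1 + (-1/27 * d A23) * h2 + (2/9 * d
        A22 - 1/9 * d A33 - 1/9 * d B12) * h3 + 1/27 * d A23 * h5
    · linear_combination (-1/18 * d A13) * h0 + 1/108 * d A22 * h1 + (-1/108 * d A22) * h2 +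
        (-1/9 * d A12) * h4 + 1/108 * d A22 * h5
    · linear_combination (-4/27 * d A23) * h1 + (-2/27 * d A23) * h2 + 1/9 * d A33 * h3 + (-1/9
        * d C33) * h4 + 2/27 * d A23 * h5
    · linear_combination (1/9 * d B23 - 1/9 * d C33) * h0 + (2/27 * d A22 - 37/54 * d A33 - 5/27
        * d B12) * h1 + (-2/27 * d A22 + 1/54 * d A33 - 1/27 * d B12) * h2 + (-2/9 * d A23) * h3 +
        (-1/3 * d A12 + 1/9 * d B22) * h4 + (-1/27 * d A22 + 5/54 * d A33 + 1/27 * d B12) * h5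
  have h12 : eval d (mkDerivation ℂ (derivPoly 1) (derivPoly 2 k))
      = eval d (mkDerivation ℂ (derivPoly 2) (derivPoly 1 k)) := by
    cases k <;> dsimp only [derivPoly, derivForm] <;>
      simp only [Derivation.leibniz, derivation_C, mkDerivation_X, mkDerivation_ofNat, map_add, map_sub,
      map_mul, smul_eq_mul, eval_X, eval_C, map_ofNat, mul_zero, add_zero,
        eval_derivPoly] <;>
      dsimp only [derivForm]
    · linear_combination (-1/18 * d A22 + 1/9 * d A33 + 5/18 * d B12) * h0 + (-1/108 * d A13 -
        5/108 * d B23) * h1 + (-5/108 * d A13 - 1/108 * d B23) * h2 + 1/18 * d B22 * h3 + (-2/9 *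
        d A23) * h4 + (-1/108 * d A13 + 1/108 * d B23) * h5
    · linear_combination (-1/9 * d A23) * h0 + (-1/108 * d B22 + 1/9 * d B33) * h1 + (-1/9 * d
        A12 + 1/108 * d B22) * h2 + (-1/6 * d B23 + 1/9 * d C33) * h3 + 1/9 * d A33 * h4 + (-1/108
        * d B22) * h5
    · linear_combination (-1/9 * d A12) * h0 + (-1/18 * d A23) * h1 + 1/18 * d A23 * h2 + 1/9 *
        d B12 * h3 + (-1/18 * d A23) * h5
    · linear_combination (1/54 * d A22 - 1/54 * d A33 + 1/54 * d B12) * h1 + (-1/54 * d A22 +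
        1/54 * d A33 + 11/54 * d B12) * h2 + 1/9 * d A12 * h4 + (1/54 * d A22 - 1/54 * d A33 +
        1/54 * d B12) * h5
    · linear_combination 1/9 * d B33 * h0 + (-2/27 * d A23) * h1 + (-1/27 * d A23) * h2 + (-1/9
        * d C33) * h4 + 1/27 * d A23 * h5
    · linear_combination (-1/9 * d A12) * h0 + (-1/18 * d A23) * h1 + 1/18 * d A23 * h2 + 1/9 *
        d B12 * h3 + (-1/18 * d A23) * h5
    · linear_combination (-2/9 * d A22 + 1/3 * d A33 + 5/9 * d B12) * h0 + (1/18 * d A13 - 1/6 *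
        d B23) * h1 + (-5/18 * d A13 + 1/6 * d B23) * h2 + 1/3 * d B22 * h3 + (-2/9 * d A23) * h4
        + (1/18 * d A13 - 1/18 * d B23) * h5
    · linear_combination (-2/9 * d A23) * h0 + (-1/18 * d A12 + 1/108 * d B22 + 1/18 * d B33) *
        h1 + (1/18 * d A12 - 1/108 * d B22 + 1/6 * d B33) * h2 + (1/18 * d B23 + 1/9 * d C33) * h3
        + 1/9 * d A33 * h4 + (-1/18 * d A12 + 1/108 * d B22 - 1/18 * d B33) * h5
    · linear_combination 1/9 * d B12 * h0 + (-5/27 * d B23 - 1/27 * d C33) * h1 + (-1/9 * d A13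
        - 1/27 * d B23 + 1/27 * d C33) * h2 + (-1/9 * d A12 + 1/9 * d B22) * h3 + (1/27 * d B23 -
        1/27 * d C33) * h5
    · linear_combination (1/9 * d A12 + 1/6 * d B33) * h1 + (-2/9 * d A12 + 1/6 * d B33) * h2 +
        (-2/9 * d B23 + 1/9 * d C33) * h3 + 1/3 * d A33 * h4 + 1/18 * d B33 * h5
  fin_cases l <;> fin_cases m
  exacts [rfl, h01, h02, h01.symm, rfl, h12, h02.symm, h12.symm, rfl]

end DerivativeRelations

/-! ### The structure equations of a superintegrable system -/

section StructureEquations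

open MvPolynomial Label

/-- The coefficients `A^{ij}, B^{ij}, C^{ij}` of the canonical equations in terms of the ten basic
functions. -/
def coef {R : Type*} [CommRing R] (d : Label → R) : Fin 3 → Fin 3 → Fin 3 → R
  | _, 0, 0 => 0
  | 0, 0, 1 | 0, 1, 0 => d A12
  | 0, 0, 2 | 0, 2, 0 => d A13
  | 0, 1, 1 => d A22
  | 0, 1, 2 | 0, 2, 1 => d A23
  | 0, 2, 2 => d A33
  | 1, 0, 1 | 1, 1, 0 => d B12
  | 1, 0, 2 | 1, 2, 0 => d A23
  | 1, 1, 1 => d B22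
  | 1, 1, 2 | 1, 2, 1 => d B23
  | 1, 2, 2 => d B33
  | 2, 0, 1 | 2, 1, 0 => d A23
  | 2, 0, 2 | 2, 2, 0 => d B12 - d A22 + d A33
  | 2, 1, 1 => d B23 - d A13
  | 2, 1, 2 | 2, 2, 1 => d A12 + d B33
  | 2, 2, 2 => d C33

theorem coef_symm {R : Type*} [CommRing R] (d : Label → R) (s i j : Fin 3) :
    coef d s i j = coef d s j i := by
  fin_cases s <;> fin_cases i <;> fin_cases j <;> rfl

theorem coef_zero_zero {R : Type*} [CommRing R] (d : Label → R) (s : Fin 3) :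
    coef d s 0 0 = 0 := by
  fin_cases s <;> rfl

theorem map_coef {R S F : Type*} [CommRing R] [CommRing S] [FunLike F R S]
    [AddMonoidHomClass F R S] (f : F) (d : Label → R) (s i j : Fin 3) :
    f (coef d s i j) = coef (fun k => f (d k)) s i j := by
  fin_cases s <;> fin_cases i <;> fin_cases j <;> simp [coef]

/-! ### Formal derivatives of potentials and quadratic forms -/

section Formulas

variable {R : Type*} [CommRing R] [Algebra ℂ R]

/-- The second derivatives of a potential with gradient `v` and `V_{11} = w`. -/
def hess (κ : Fin 3 → Fin 3 → Fin 3 → R) (v : Fin 3 → R) (w : R) (i j : Fin 3) : R :=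
  (if i = j then w else 0) + ∑ s, κ s i j * v s

/-- The derivatives of `V_{11}` for a potential with gradient `v` and `V_{11} = w`; the derivatives
of the coefficients `κ` are `κ' 0, κ' 1, κ' 2`. -/
def lapDeriv (κ : Fin 3 → Fin 3 → Fin 3 → R) (κ' : Fin 3 → Fin 3 → Fin 3 → Fin 3 → R)
    (v : Fin 3 → R) (w : R) (k : Fin 3) : R :=
  -- For `k ≠ 0` one has `V_{11k} = ∂_1 V_{1k}`, and `V_{1k}` contains no `V_{11}`. For `k = 0` the
  -- equality `∂_1 V_{22} = ∂_2 V_{12}` is solved for `V_{111}`.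
  if k = 0 then ∑ s, (κ' 1 s 0 1 * v s + κ s 0 1 * hess κ v w s 1
    - κ' 0 s 1 1 * v s - κ s 1 1 * hess κ v w s 0)
  else ∑ s, (κ' 0 s 0 k * v s + κ s 0 k * hess κ v w s 0)

/-- The third derivatives `V_{ijl}` of a potential with gradient `v` and `V_{11} = w`. -/
def hessDeriv (κ : Fin 3 → Fin 3 → Fin 3 → R) (κ' : Fin 3 → Fin 3 → Fin 3 → Fin 3 → R)
    (v : Fin 3 → R) (w : R) (l i j : Fin 3) : R :=
  (if i = j then lapDeriv κ κ' v w l else 0) + ∑ s, (κ' l s i j * v s + κ s i j * hess κ v w s l)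

/-- The derivatives `V_{11lk}` of a potential with gradient `v` and `V_{11} = w`, computed as the
derivatives of `V_{11k}` in direction `l`. -/
def lapDeriv₂ (κ : Fin 3 → Fin 3 → Fin 3 → R) (κ' : Fin 3 → Fin 3 → Fin 3 → Fin 3 → R)
    (κ'' : Fin 3 → Fin 3 → Fin 3 → Fin 3 → Fin 3 → R) (v : Fin 3 → R) (w : R) (l k : Fin 3) : R :=
  if k = 0 then ∑ s, (κ'' l 1 s 0 1 * v s + κ' 1 s 0 1 * hess κ v w s l
    + (κ' l s 0 1 * hess κ v w s 1 + κ s 0 1 * hessDeriv κ κ' v w l s 1)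
    - (κ'' l 0 s 1 1 * v s + κ' 0 s 1 1 * hess κ v w s l)
    - (κ' l s 1 1 * hess κ v w s 0 + κ s 1 1 * hessDeriv κ κ' v w l s 0))
  else ∑ s, (κ'' l 0 s 0 k * v s + κ' 0 s 0 k * hess κ v w s l
    + (κ' l s 0 k * hess κ v w s 0 + κ s 0 k * hessDeriv κ κ' v w l s 0))

/-- The derivative `∂_k a^{ij}` of the quadratic form of a constant of the motion. -/
def formDeriv (κ : Fin 3 → Fin 3 → Fin 3 → R) (a : Fin 3 → Fin 3 → R) (k i j : Fin 3) : R :=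
  -- This solves two sets of linear equations for the derivatives of `a`: the cyclic sums vanish
  -- (Killing equation), and `a dV` is closed for every admissible gradient of `V`.
  (1 / 3 : ℂ) • ∑ m, (a k m * (κ j m i + κ i m j) - a i m * κ j m k - a j m * κ i m k)

theorem formDeriv_symm (κ : Fin 3 → Fin 3 → Fin 3 → R) (a : Fin 3 → Fin 3 → R) (k i j : Fin 3) :
    formDeriv κ a k i j = formDeriv κ a k j i := by
  unfold formDeriv
  congr 1
  exact Finset.sum_congr rfl fun m _ => by ring

end Formulas

/-- The commutator of the derivatives of the quadratic form `a`, where `κ' k` is the derivative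
of the coefficients `κ` in direction `k`. -/
def curv (κ : Fin 3 → Fin 3 → Fin 3 → ℂ) (κ' : Fin 3 → Fin 3 → Fin 3 → Fin 3 → ℂ)
    (a : Fin 3 → Fin 3 → ℂ) (k l i j : Fin 3) : ℂ :=
  formDeriv (κ' k) a l i j + formDeriv κ (formDeriv κ a k) l i j
    - (formDeriv (κ' l) a k i j + formDeriv κ (formDeriv κ a l) k i j)

/-- The position of the entry `(i, j)` in the list of the entries of a symmetric matrix. -/
def symIdx : Fin 3 → Fin 3 → Fin 6
  | 0, 0 => 0
  | 0, 1 | 1, 0 => 1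
  | 0, 2 | 2, 0 => 2
  | 1, 1 => 3
  | 1, 2 | 2, 1 => 4
  | 2, 2 => 5

/-- The entries of a symmetric matrix on and above the diagonal. -/
def symPair : Fin 6 → Fin 3 × Fin 3
  | 0 => (0, 0)
  | 1 => (0, 1)
  | 2 => (0, 2)
  | 3 => (1, 1)
  | 4 => (1, 2)
  | 5 => (2, 2)

/-- The symmetric matrix with given entries. -/
def symForm {R : Type*} (t : Fin 6 → R) (i j : Fin 3) : R := t (symIdx i j)

theorem symIdx_symm (i j : Fin 3) : symIdx i j = symIdx j i := by
  fin_cases i <;> fin_cases j <;> rfl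

theorem symIdx_symPair (n : Fin 6) : symIdx (symPair n).1 (symPair n).2 = n := by
  fin_cases n <;> rfl

theorem apply_symPair_symIdx {R : Type*} {f : Fin 3 → Fin 3 → R} (hf : ∀ i j, f i j = f j i)
    (i j : Fin 3) : f (symPair (symIdx i j)).1 (symPair (symIdx i j)).2 = f i j := by
  fin_cases i <;> fin_cases j <;> first | rfl | exact hf _ _

/-! ### Integrability on the zero set of the quadrics -/

section Integrability

/-- The derivatives of the coefficients of the canonical equations. -/
def coefDeriv (d : Label → ℂ) (l : Fin 3) : Fin 3 → Fin 3 → Fin 3 → ℂ :=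
  coef (derivForm (1 / 6) d l)

/-- The second derivatives of the coefficients of the canonical equations. -/
def coefDeriv₂ (d : Label → ℂ) (l m : Fin 3) : Fin 3 → Fin 3 → Fin 3 → ℂ :=
  coef fun k => eval d (mkDerivation ℂ (derivPoly l) (derivPoly m k))

-- Compatibility of the equations for `V_{11}`, the last unknown in the jet of a potential. It
-- involves second derivatives of the coefficients, and all six quadrics enter.
set_option maxHeartbeats 2000000 in
theorem lap_integrable {d : Label → ℂ} (hd : ∀ m, eval d (quadric m) = 0)
    (v : Fin 3 → ℂ) (w : ℂ) (l m : Fin 3) :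
    lapDeriv₂ (coef d) (coefDeriv d) (coefDeriv₂ d) v w l m
      = lapDeriv₂ (coef d) (coefDeriv d) (coefDeriv₂ d) v w m l := by
  have h0 := hd 0
  have h1 := hd 1
  have h2 := hd 2
  have h3 := hd 3
  have h4 := hd 4
  have h5 := hd 5
  simp [quadric] at h0 h1 h2 h3 h4 h5
  have key : ∀ l m : Fin 3, l < m →
      lapDeriv₂ (coef d) (coefDeriv d) (coefDeriv₂ d) v w l m
        = lapDeriv₂ (coef d) (coefDeriv d) (coefDeriv₂ d) v w m l := by
    intro l m hlm
    rcases fin_three_lt hlm with ⟨rfl, rfl⟩ | ⟨rfl, rfl⟩ | ⟨rfl, rfl⟩ <;>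
      simp only [lapDeriv₂, hessDeriv, lapDeriv, hess, coefDeriv, coefDeriv₂, Fin.sum_univ_three,
        Fin.isValue, Fin.reduceEq, if_true, if_false] <;>
      dsimp only [coef, derivPoly] <;> dsimp only [derivForm] <;>
      simp only [Derivation.leibniz, derivation_C, mkDerivation_X, mkDerivation_ofNat, map_add,
        map_sub, map_mul, smul_eq_mul, eval_X, eval_C, map_ofNat, mul_zero, add_zero,
        eval_derivPoly] <;>
      dsimp only [derivForm]
    · linear_combination (7/3 * d A12 * v 2 - 25/18 * d A13 * v 1 + 20/9 * d A23 * v 0 + 1/3 * d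
      B22 * v 2 + d B23 * v 1 + 4/3 * d B33 * v 2) * h0 + (7/54 * d A12 * v 0 + 5/108 * d A22 * v
      1 - 1/2 * d A23 * v 2 - 1/6 * d B12 * v 1 + 11/108 * d B22 * v 0) * h1 + (-7/54 * d A12 * v
      0 - 5/108 * d A22 * v 1 + 1/18 * d A23 * v 2 + 1/6 * d B12 * v 1 - 11/108 * d B22 * v 0) *
      h2 + (5/3 * d A22 * v 2 - 17/9 * d A23 * v 1 - 4/3 * d A33 * v 2 - 22/9 * d B12 * v 2 +
      11/18 * d B23 * v 0) * h3 + (7/54 * d A12 * v 0 + 5/108 * d A22 * v 1 - 1/18 * d A23 * v 2 -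
      1/6 * d B12 * v 1 + 11/108 * d B22 * v 0) * h5
    · linear_combination (4/3 * d A12 * v 1 - 17/18 * d A13 * v 2 - 11/18 * d A22 * v 0 + 20/9 * d
      A33 * v 0 + 11/6 * d B12 * v 0 + d B33 * v 1 + 5/3 * d C33 * v 2 + w) * h0 + (-55/36 * d A13
      * v 0 - 5/108 * d A22 * v 2 - 11/9 * d A23 * v 1 - 13/54 * d A33 * v 2 + 2/3 * d B12 * v 2 -
      55/108 * d B23 * v 0) * h1 + (-23/36 * d A13 * v 0 + 29/108 * d A22 * v 2 + 1/9 * d A23 * v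
      1 - 17/54 * d A33 * v 2 + 4/9 * d B12 * v 2 - 11/108 * d B23 * v 0) * h2 + (5/3 * d A22 * v
      1 - 17/9 * d A23 * v 2 - 4/3 * d A33 * v 1 - 19/9 * d B12 * v 1 + 11/18 * d B22 * v 0) * h3
      + (-4/3 * d A12 * v 2 - 11/9 * d A23 * v 0 - 1/3 * d B22 * v 2) * h4 + (1/36 * d A13 * v 0 +
      7/108 * d A22 * v 2 - 1/9 * d A23 * v 1 - 1/54 * d A33 * v 2 - 1/9 * d B12 * v 2 + 11/108 *
      d B23 * v 0) * h5
    · linear_combination (-25/18 * d A22 * v 1 - 5/9 * d A23 * v 2 + 13/9 * d A33 * v 1 + 59/18 *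
      d B12 * v 1) * h0 + (-1/6 * d A12 * v 2 + 5/108 * d A13 * v 1 - 2/3 * d A23 * v 0 - 5/108 *
      d B22 * v 2 - 77/108 * d B23 * v 1 + 55/27 * d B33 * v 2) * h1 + (-47/18 * d A12 * v 2 -
      11/108 * d A13 * v 1 + 5/108 * d B22 * v 2 - 1/108 * d B23 * v 1 - 1/27 * d B33 * v 2) * h2
      + (-1/3 * d A12 * v 1 + 1/3 * d A13 * v 2 + 1/18 * d B22 * v 1 - 53/18 * d B23 * v 2 + 26/9
      * d C33 * v 2) * h3 + (4/3 * d A22 * v 2 - 5/9 * d A23 * v 1 + 4/3 * d A33 * v 2) * h4 +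
      (-1/18 * d A12 * v 2 + 5/108 * d A13 * v 1 - 5/108 * d B22 * v 2 + 1/108 * d B23 * v 1 +
      1/27 * d B33 * v 2) * h5
  rcases lt_trichotomy l m with h | h | h
  · exact key l m h
  · rw [h]
  · exact (key m l h).symm

-- Compatibility of the equations for the gradient of a potential. First derivatives of the
-- coefficients suffice here, and the difference of the two sides is a combination of the first five
-- quadrics.
set_option maxHeartbeats 1000000 in
theorem hess_integrable {d : Label → ℂ} (hd : ∀ m, eval d (quadric m) = 0)
    (v : Fin 3 → ℂ) (w : ℂ) (l m i : Fin 3) :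
    hessDeriv (coef d) (coefDeriv d) v w l i m = hessDeriv (coef d) (coefDeriv d) v w m i l := by
  have h0 := hd 0
  have h1 := hd 1
  have h2 := hd 2
  have h3 := hd 3
  have h4 := hd 4
  simp [quadric] at h0 h1 h2 h3 h4
  have key : ∀ l m i : Fin 3, l < m →
      hessDeriv (coef d) (coefDeriv d) v w l i m = hessDeriv (coef d) (coefDeriv d) v w m i l := by
    intro l m i hlm
    rcases fin_three_lt hlm with ⟨rfl, rfl⟩ | ⟨rfl, rfl⟩ | ⟨rfl, rfl⟩ <;>
      rcases fin_three i with rfl | rfl | rfl <;>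
      simp only [hessDeriv, lapDeriv, hess, coefDeriv, Fin.sum_univ_three, Fin.isValue,
        Fin.reduceEq, if_true, if_false] <;>
      dsimp only [coef] <;> dsimp only [derivForm]
    · ring
    · ring
    · linear_combination (-v 1) * h0 + v 0 * h3
    · ring
    · linear_combination v 0 * h3 + (-v 2) * h4
    · linear_combination (-v 2) * h0 + (-5/3 * v 0) * h1 + v 1 * h4
    · linear_combination v 1 * h0 + (-v 2) * h4
    · linear_combination (-v 0) * h0 + (-1/3 * v 2) * h1 + (-2/3 * v 2) * h2 + 4/3 * v 1 * h3
    · linear_combination 4/3 * v 1 * h2 + (-v 2) * h3 + v 0 * h4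
  rcases lt_trichotomy l m with h | h | h
  · exact key l m i h
  · rw [h]
  · exact (key m l i h).symm

-- The symmetric matrix is arbitrary, so on the zero set the equations for `a` can be solved with
-- every initial matrix: the local solutions form a space of the full dimension six, although a
-- system requires only five.
set_option maxHeartbeats 1000000 in
theorem curv_eq_zero {d : Label → ℂ} (hd : ∀ m, eval d (quadric m) = 0)
    (t : Fin 6 → ℂ) (k l i j : Fin 3) :
    curv (coef d) (coefDeriv d) (symForm t) k l i j = 0 := by
  have h0 := hd 0
  have h1 := hd 1
  have h2 := hd 2
  have h3 := hd 3
  have h4 := hd 4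
  simp [quadric] at h0 h1 h2 h3 h4
  have key : ∀ k l i j : Fin 3, k < l → i ≤ j →
      curv (coef d) (coefDeriv d) (symForm t) k l i j = 0 := by
    intro k l i j hkl hij
    rcases fin_three_lt hkl with ⟨rfl, rfl⟩ | ⟨rfl, rfl⟩ | ⟨rfl, rfl⟩ <;>
      rcases fin_three_le hij with ⟨rfl, rfl⟩ | ⟨rfl, rfl⟩ | ⟨rfl, rfl⟩ | ⟨rfl, rfl⟩ | ⟨rfl, rfl⟩ |
        ⟨rfl, rfl⟩ <;>
      simp only [curv, formDeriv, coefDeriv, Fin.sum_univ_three, smul_eq_mul] <;>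
      dsimp only [coef, symForm, symIdx] <;> dsimp only [derivForm]
    · linear_combination 4/9 * t 2 * h3
    · linear_combination (-1/9 * t 2) * h0 + 1/9 * t 4 * h3
    · linear_combination 5/9 * t 1 * h0 + (-2/3 * t 4) * h1 + (-1/9 * t 0 + 2/9 * t 3 - 1/9 * t 5)
      * h3 + (-4/9 * t 2) * h4
    · linear_combination (-4/9 * t 4) * h0
    · linear_combination (-2/9 * t 0 + 1/9 * t 3 + 1/9 * t 5) * h0 + (-4/9 * t 2) * h2 + (-5/9 * t
      1) * h3 + 4/9 * t 4 * h4
    · linear_combination (-2/9 * t 4) * h0 + 2/9 * t 1 * h1 + 4/9 * t 1 * h2 + 4/9 * t 2 * h3 +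
      (4/9 * t 0 - 4/9 * t 3) * h4
    · linear_combination 4/9 * t 1 * h3
    · linear_combination (-2/9 * t 1) * h0 + 1/3 * t 4 * h1 + (-1/9 * t 0 - 1/9 * t 3 + 2/9 * t 5)
      * h3 + 1/3 * t 2 * h4
    · linear_combination (1/3 * t 0 - 1/3 * t 5) * h1 + 1/9 * t 4 * h3 + (-1/3 * t 1) * h4
    · linear_combination (2/3 * t 0 - 2/3 * t 5) * h0 + 2/3 * t 2 * h2 + 4/9 * t 1 * h3 + (-2/9 *
      t 4) * h4
    · linear_combination 2/9 * t 4 * h0 + 1/9 * t 1 * h1 + (-2/9 * t 1) * h2 + (-1/3 * t 2) * h3 +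
      (-4/9 * t 0 + 1/9 * t 3 + 1/3 * t 5) * h4
    · linear_combination 2/9 * t 1 * h3 + (-2/9 * t 4) * h4
    · linear_combination 2/9 * t 1 * h0 + (-2/3 * t 4) * h1 + (2/3 * t 3 - 2/3 * t 5) * h3 + (-2/9
      * t 2) * h4
    · linear_combination (-1/9 * t 0 - 1/9 * t 3 + 2/9 * t 5) * h0 + (-2/9 * t 2) * h2 + (-1/3 * t
      1) * h3 + 1/3 * t 4 * h4
    · linear_combination (-5/9 * t 4) * h0 + 2/9 * t 1 * h1 + 2/9 * t 2 * h3 + (1/9 * t 0 - 4/9 *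
      t 3 + 1/3 * t 5) * h4
    · linear_combination 4/9 * t 1 * h0 + 2/9 * t 4 * h2
    · linear_combination 1/9 * t 2 * h0 + (-2/9 * t 3 + 2/9 * t 5) * h2 + 1/9 * t 4 * h3 + (-1/3 *
      t 1) * h4
    · linear_combination (-4/9 * t 4) * h1 + (-4/9 * t 4) * h2 + (2/9 * t 3 - 2/9 * t 5) * h3 +
      (-2/9 * t 2) * h4
  have hsymm : ∀ k l i j : Fin 3, curv (coef d) (coefDeriv d) (symForm t) k l i j
      = curv (coef d) (coefDeriv d) (symForm t) k l j i := fun k l i j => by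
    simp only [curv, formDeriv_symm _ _ _ i j]
  have hanti : ∀ k l i j : Fin 3, curv (coef d) (coefDeriv d) (symForm t) k l i j
      = -curv (coef d) (coefDeriv d) (symForm t) l k i j := fun k l i j => by
    simp only [curv, neg_sub]
  rcases lt_trichotomy k l with h | h | h
  · rcases le_total i j with h' | h'
    · exact key k l i j h h'
    · rw [hsymm, key k l j i h h']
  · rw [h, curv, sub_self]
  · rw [hanti, neg_eq_zero]
    rcases le_total i j with h' | h'
    · exact key l k i j h h'
    · rw [hsymm, key l k j i h h']

end Integrability

end StructureEquations

/-! ### The joint system for the basic functions, a potential and a constant of the motion -/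

section JointSystem

open MvPolynomial Label

/-! ### Behaviour of the formulas under ring maps and derivations -/

section Maps

variable {R S : Type*} [CommRing R] [CommRing S]

theorem map_hess (f : R →+* S) (κ : Fin 3 → Fin 3 → Fin 3 → R) (v : Fin 3 → R) (w : R)
    (i j : Fin 3) :
    f (hess κ v w i j)
      = hess (fun s i j => f (κ s i j)) (fun s => f (v s)) (f w) i j := by
  simp only [hess, map_add, map_sum, map_mul, apply_ite f, map_zero]

theorem map_lapDeriv (f : R →+* S) (κ : Fin 3 → Fin 3 → Fin 3 → R)
    (κ' : Fin 3 → Fin 3 → Fin 3 → Fin 3 → R) (v : Fin 3 → R) (w : R) (k : Fin 3) :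
    f (lapDeriv κ κ' v w k) = lapDeriv (fun s i j => f (κ s i j)) (fun l s i j => f (κ' l s i j))
      (fun s => f (v s)) (f w) k := by
  simp only [lapDeriv, apply_ite f, map_sum, map_add, map_sub, map_mul, map_hess]

theorem map_hessDeriv (f : R →+* S) (κ : Fin 3 → Fin 3 → Fin 3 → R)
    (κ' : Fin 3 → Fin 3 → Fin 3 → Fin 3 → R) (v : Fin 3 → R) (w : R) (l i j : Fin 3) :
    f (hessDeriv κ κ' v w l i j) = hessDeriv (fun s i j => f (κ s i j))
      (fun l s i j => f (κ' l s i j)) (fun s => f (v s)) (f w) l i j := by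
  simp only [hessDeriv, apply_ite f, map_sum, map_add, map_mul, map_zero, map_hess, map_lapDeriv]

theorem map_lapDeriv₂ (f : R →+* S) (κ : Fin 3 → Fin 3 → Fin 3 → R)
    (κ' : Fin 3 → Fin 3 → Fin 3 → Fin 3 → R) (κ'' : Fin 3 → Fin 3 → Fin 3 → Fin 3 → Fin 3 → R)
    (v : Fin 3 → R) (w : R) (l k : Fin 3) :
    f (lapDeriv₂ κ κ' κ'' v w l k) = lapDeriv₂ (fun s i j => f (κ s i j))
      (fun l s i j => f (κ' l s i j)) (fun l m s i j => f (κ'' l m s i j)) (fun s => f (v s)) (f w)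
      l k := by
  simp only [lapDeriv₂, apply_ite f, map_sum, map_add, map_sub, map_mul, map_hess, map_hessDeriv]

variable [Algebra ℂ R] [Algebra ℂ S]

theorem map_formDeriv (f : R →+* S) (hf : ∀ r (c : ℂ), f (c • r) = c • f r)
    (κ : Fin 3 → Fin 3 → Fin 3 → R) (a : Fin 3 → Fin 3 → R) (k i j : Fin 3) :
    f (formDeriv κ a k i j)
      = formDeriv (fun s i j => f (κ s i j)) (fun i j => f (a i j)) k i j := by
  simp only [formDeriv, hf, map_sum, map_add, map_sub, map_mul]

variable (D : Derivation ℂ R R) {κ : Fin 3 → Fin 3 → Fin 3 → R}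
  {κ' : Fin 3 → Fin 3 → Fin 3 → Fin 3 → R} {v : Fin 3 → R} {w : R} {l : Fin 3}

/-- Here `D` stands for differentiation along direction `l` of the system. Applied to the derivation
defined by `jointPoly l`, this and the next two lemmas translate commutation of the polynomial
derivations into symmetry of `hessDeriv`, symmetry of `lapDeriv₂` and vanishing of `curv`. -/
theorem derivation_hess (hκ : ∀ s i j, D (κ s i j) = κ' l s i j)
    (hv : ∀ s, D (v s) = hess κ v w s l) (hw : D w = lapDeriv κ κ' v w l) (i j : Fin 3) :
    D (hess κ v w i j) = hessDeriv κ κ' v w l i j := by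
  unfold hess hessDeriv
  rw [map_add, map_sum, apply_ite D, map_zero, hw]
  congr 1
  refine Finset.sum_congr rfl fun s _ => ?_
  rw [Derivation.leibniz, hκ, hv, smul_eq_mul, smul_eq_mul]
  ring

theorem derivation_lapDeriv {κ'' : Fin 3 → Fin 3 → Fin 3 → Fin 3 → Fin 3 → R}
    (hκ : ∀ s i j, D (κ s i j) = κ' l s i j) (hκ' : ∀ m s i j, D (κ' m s i j) = κ'' l m s i j)
    (hv : ∀ s, D (v s) = hess κ v w s l) (hw : D w = lapDeriv κ κ' v w l) (k : Fin 3) :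
    D (lapDeriv κ κ' v w k) = lapDeriv₂ κ κ' κ'' v w l k := by
  have hh := derivation_hess D hκ hv hw
  unfold lapDeriv lapDeriv₂
  simp only [apply_ite D, map_sum, map_add, map_sub, Derivation.leibniz, hκ, hκ', hv, hh,
    smul_eq_mul]
  split_ifs <;> exact Finset.sum_congr rfl fun s _ => by ring

theorem derivation_formDeriv {a : Fin 3 → Fin 3 → R} (hκ : ∀ s i j, D (κ s i j) = κ' l s i j)
    (ha : ∀ i j, D (a i j) = formDeriv κ a l i j) (k i j : Fin 3) :
    D (formDeriv κ a k i j)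
      = formDeriv (κ' l) a k i j + formDeriv κ (formDeriv κ a l) k i j := by
  rw [formDeriv]
  simp only [Derivation.map_smul, map_sum, map_add, map_sub, Derivation.leibniz, hκ, ha, smul_eq_mul]
  rw [formDeriv, formDeriv, ← smul_add, ← Finset.sum_add_distrib]
  congr 1
  exact Finset.sum_congr rfl fun s _ => by ring

end Maps

/-- The unknowns of the joint system: the ten basic functions, a potential `V`, its derivatives
`V_1, V_2, V_3` and `V_{11}`, a quadratic form `a^{ij}`, and the function `W`. -/
inductive Var : Type
  | base (k : Label)
  | pot
  | grad (i : Fin 3)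
  | lap
  | form (n : Fin 6)
  | aux

open Var

instance : Finite Var :=
  Finite.of_surjective (α := Label ⊕ Fin 3 ⊕ Fin 6 ⊕ Fin 3)
    (Sum.elim base (Sum.elim grad (Sum.elim form ![pot, lap, aux]))) (by
      rintro (k | _ | i | _ | n | _)
      · exact ⟨.inl k, rfl⟩
      · exact ⟨.inr (.inr (.inr 0)), rfl⟩
      · exact ⟨.inr (.inl i), rfl⟩
      · exact ⟨.inr (.inr (.inr 1)), rfl⟩
      · exact ⟨.inr (.inr (.inl n)), rfl⟩
      · exact ⟨.inr (.inr (.inr 2)), rfl⟩)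

instance : Fintype Var := Fintype.ofFinite _

/-- The right hand sides of the joint system. -/
def jointPoly (l : Fin 3) : Var → MvPolynomial Var ℂ
  | base k => rename base (derivPoly l k)
  | pot => X (grad l)
  | grad i => hess (coef fun k => X (base k)) (fun i => X (grad i)) (X lap) i l
  | lap => lapDeriv (coef fun k => X (base k)) (fun m => coef fun k => rename base (derivPoly m k))
      (fun i => X (grad i)) (X lap) l
  | form n => formDeriv (coef fun k => X (base k)) (symForm fun n => X (form n)) l
      (symPair n).1 (symPair n).2
  -- The part of the Poisson bracket that is linear in the momenta vanishes exactly when `dW = a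
  -- dV`.
  | aux => ∑ m, symForm (fun n => X (form n)) l m * X (grad m)

theorem eval_jointPoly_base (z : Var → ℂ) (l : Fin 3) (k : Label) :
    eval z (jointPoly l (base k)) = derivForm (1 / 6) (fun k => z (base k)) l k := by
  rw [jointPoly, eval_rename, eval_derivPoly]
  rfl

theorem eval_jointPoly_pot (z : Var → ℂ) (l : Fin 3) :
    eval z (jointPoly l pot) = z (grad l) := by
  simp [jointPoly]

theorem eval_coef (z : Var → ℂ) :
    (fun s i j => eval z (coef (fun k => X (base k)) s i j)) = coef fun k => z (base k) := by
  funext s i j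
  simp [map_coef]

theorem eval_coefDeriv (z : Var → ℂ) :
    (fun l s i j => eval z (coef (fun k => rename base (derivPoly l k)) s i j))
      = coefDeriv fun k => z (base k) := by
  funext l s i j
  simp only [map_coef, eval_rename, eval_derivPoly, coefDeriv]
  rfl

theorem eval_symForm (z : Var → ℂ) :
    (fun i j => eval z (symForm (fun n => X (form n)) i j)) = symForm fun n => z (form n) := by
  funext i j
  simp [symForm]

theorem eval_jointPoly_grad (z : Var → ℂ) (l i : Fin 3) :
    eval z (jointPoly l (grad i))
      = hess (coef fun k => z (base k)) (fun i => z (grad i)) (z lap) i l := by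
  have := map_hess (eval z) (coef fun k => X (base k)) (fun i => X (grad i)) (X lap) i l
  simpa only [eval_coef, eval_X, jointPoly] using this

theorem eval_jointPoly_lap (z : Var → ℂ) (l : Fin 3) :
    eval z (jointPoly l lap) = lapDeriv (coef fun k => z (base k)) (coefDeriv fun k => z (base k))
      (fun i => z (grad i)) (z lap) l := by
  have := map_lapDeriv (eval z) (coef fun k => X (base k))
    (fun m => coef fun k => rename base (derivPoly m k)) (fun i => X (grad i)) (X lap) l
  simpa only [eval_coef, eval_coefDeriv, eval_X, jointPoly] using this

theorem eval_jointPoly_form (z : Var → ℂ) (l : Fin 3) (n : Fin 6) :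
    eval z (jointPoly l (form n)) = formDeriv (coef fun k => z (base k))
      (symForm fun n => z (form n)) l (symPair n).1 (symPair n).2 := by
  have := map_formDeriv (eval z) (smul_eval z) (coef fun k => X (base k)) (symForm fun n => X (form n)) l
    (symPair n).1 (symPair n).2
  simpa only [eval_coef, eval_symForm, jointPoly] using this

theorem eval_jointPoly_aux (z : Var → ℂ) (l : Fin 3) :
    eval z (jointPoly l aux) = ∑ m, symForm (fun n => z (form n)) l m * z (grad m) := by
  simp [jointPoly, symForm]

theorem hess_symm (d : Label → ℂ) (v : Fin 3 → ℂ) (w : ℂ) (i j : Fin 3) :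
    hess (coef d) v w i j = hess (coef d) v w j i := by
  simp only [hess, coef_symm d _ i j, eq_comm]

/-- Closedness of `a dV`, for which `formDeriv` was designed. It is an identity without any quadric:
the linear relations between the coefficients built into `coef` are enough. -/
theorem aux_integrable (d : Label → ℂ) (t : Fin 6 → ℂ) (v : Fin 3 → ℂ) (w : ℂ) (k l : Fin 3) :
    ∑ m, (formDeriv (coef d) (symForm t) l k m * v m + symForm t k m * hess (coef d) v w m l)
      = ∑ m, (formDeriv (coef d) (symForm t) k l m * v m
        + symForm t l m * hess (coef d) v w m k) := by
  have key : ∀ k l : Fin 3, k < l →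
      ∑ m, (formDeriv (coef d) (symForm t) l k m * v m + symForm t k m * hess (coef d) v w m l)
        = ∑ m, (formDeriv (coef d) (symForm t) k l m * v m
          + symForm t l m * hess (coef d) v w m k) := by
    intro k l hkl
    rcases fin_three_lt hkl with ⟨rfl, rfl⟩ | ⟨rfl, rfl⟩ | ⟨rfl, rfl⟩ <;>
      simp only [formDeriv, hess, Fin.sum_univ_three, smul_eq_mul, Fin.isValue, Fin.reduceEq,
        if_true, if_false] <;>
      dsimp only [coef, symForm, symIdx] <;> ring
  rcases lt_trichotomy k l with h | h | h
  · exact key k l h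
  · rw [h]
  · exact (key l k h).symm

/-- The basic functions form a closed subsystem, so invariance of the quadrics and integrability of
`derivPoly` carry over to the joint system. -/
theorem derivation_rename_base (l : Fin 3) (p : MvPolynomial Label ℂ) :
    mkDerivation ℂ (jointPoly l) (rename base p)
      = rename base (mkDerivation ℂ (derivPoly l) p) := by
  induction p using MvPolynomial.induction_on with
  | C a => simp
  | add p q h1 h2 => simp only [map_add, h1, h2]
  | mul_X p i h1 =>
    simp only [map_mul, rename_X, Derivation.leibniz, h1, mkDerivation_X, smul_eq_mul, map_add]
    rfl

theorem derivation_coef (l s i j : Fin 3) :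
    mkDerivation ℂ (jointPoly l) (coef (fun k => X (base k)) s i j)
      = coef (fun k => rename base (derivPoly l k)) s i j := by
  rw [map_coef]
  simp only [mkDerivation_X]
  rfl

theorem derivation_coefDeriv (l m s i j : Fin 3) :
    mkDerivation ℂ (jointPoly l) (coef (fun k => rename base (derivPoly m k)) s i j)
      = coef (fun k => rename base (mkDerivation ℂ (derivPoly l) (derivPoly m k))) s i j := by
  rw [map_coef]
  simp only [derivation_rename_base]

theorem derivation_symForm (l i j : Fin 3) :
    mkDerivation ℂ (jointPoly l) (symForm (fun n => X (form n)) i j)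
      = formDeriv (coef fun k => X (base k)) (symForm fun n => X (form n)) l i j := by
  rw [symForm, mkDerivation_X]
  exact apply_symPair_symIdx (formDeriv_symm _ _ l) i j

/-- The joint system is integrable along the common zeros of the six quadrics. -/
theorem jointPoly_integrable {z : Var → ℂ} (hz : ∀ m, eval (fun k => z (base k)) (quadric m) = 0)
    (l m : Fin 3) (k : Var) :
    eval z (mkDerivation ℂ (jointPoly l) (jointPoly m k))
      = eval z (mkDerivation ℂ (jointPoly m) (jointPoly l k)) := by
  have hv : ∀ l s, mkDerivation ℂ (jointPoly l) (X (grad s))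
      = hess (coef fun k => X (base k)) (fun i => X (grad i)) (X lap) s l :=
    fun l s => mkDerivation_X _ _ _
  have hw : ∀ l, mkDerivation ℂ (jointPoly l) (X lap) = lapDeriv (coef fun k => X (base k))
      (fun m => coef fun k => rename base (derivPoly m k)) (fun i => X (grad i)) (X lap) l :=
    fun l => mkDerivation_X _ _ _
  rcases k with k | _ | i | _ | n | _
  · simp only [jointPoly, derivation_rename_base, eval_rename]
    exact derivPoly_integrable hz l m k
  · simp only [jointPoly, mkDerivation_X]
    change eval z (jointPoly l (grad m)) = eval z (jointPoly m (grad l))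
    rw [eval_jointPoly_grad, eval_jointPoly_grad, hess_symm]
  · have e : ∀ l m, eval z (mkDerivation ℂ (jointPoly l) (jointPoly m (grad i)))
        = hessDeriv (coef fun k => z (base k)) (coefDeriv fun k => z (base k))
          (fun i => z (grad i)) (z lap) l i m := fun l m => by
      rw [jointPoly, derivation_hess _ (κ' := fun m => coef fun k => rename base (derivPoly m k))
        (derivation_coef l) (hv l) (hw l)]
      have := map_hessDeriv (eval z) (coef fun k => X (base k))
        (fun m => coef fun k => rename base (derivPoly m k)) (fun i => X (grad i)) (X lap) l i m
      simpa only [eval_coef, eval_coefDeriv, eval_X] using this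
    rw [e, e]
    exact hess_integrable hz _ _ l m i
  · have e : ∀ l m, eval z (mkDerivation ℂ (jointPoly l) (jointPoly m lap))
        = lapDeriv₂ (coef fun k => z (base k)) (coefDeriv fun k => z (base k))
          (coefDeriv₂ fun k => z (base k)) (fun i => z (grad i)) (z lap) l m := fun l m => by
      rw [jointPoly, derivation_lapDeriv _ (κ' := fun m => coef fun k => rename base (derivPoly m k))
        (κ'' := fun l m => coef fun k =>
          rename base (mkDerivation ℂ (derivPoly l) (derivPoly m k)))
        (derivation_coef l) (derivation_coefDeriv l) (hv l) (hw l)]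
      have := map_lapDeriv₂ (eval z) (coef fun k => X (base k))
        (fun m => coef fun k => rename base (derivPoly m k))
        (fun l m => coef fun k => rename base (mkDerivation ℂ (derivPoly l) (derivPoly m k)))
        (fun i => X (grad i)) (X lap) l m
      have e2 : (fun l m s i j => eval z (coef (fun k =>
          rename base (mkDerivation ℂ (derivPoly l) (derivPoly m k))) s i j))
          = coefDeriv₂ fun k => z (base k) := by
        funext l m s i j
        simp only [map_coef, eval_rename, coefDeriv₂]
        rfl
      simpa only [eval_coef, eval_coefDeriv, e2, eval_X] using this
    rw [e, e]
    exact lap_integrable hz _ _ l m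
  · have e : ∀ l m, eval z (mkDerivation ℂ (jointPoly l) (jointPoly m (form n)))
        = formDeriv (coefDeriv (fun k => z (base k)) l) (symForm fun n => z (form n)) m
            (symPair n).1 (symPair n).2
          + formDeriv (coef fun k => z (base k)) (formDeriv (coef fun k => z (base k))
            (symForm fun n => z (form n)) l) m (symPair n).1 (symPair n).2 := fun l m => by
      rw [jointPoly, derivation_formDeriv _
        (κ' := fun m => coef fun k => rename base (derivPoly m k)) (derivation_coef l)
        (derivation_symForm l)]
      have h1 := map_formDeriv (eval z) (smul_eval z) (coef fun k => rename base (derivPoly l k))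
        (symForm fun n => X (form n)) m (symPair n).1 (symPair n).2
      have h2 := map_formDeriv (eval z) (smul_eval z) (coef fun k => X (base k))
        (formDeriv (coef fun k => X (base k)) (symForm fun n => X (form n)) l) m
        (symPair n).1 (symPair n).2
      have h3 : (fun i j => eval z (formDeriv (coef fun k => X (base k))
          (symForm fun n => X (form n)) l i j)) = formDeriv (coef fun k => z (base k))
            (symForm fun n => z (form n)) l := by
        funext i j
        rw [map_formDeriv (eval z) (smul_eval z), eval_coef, eval_symForm]
      simp only [eval_coef, congrFun (eval_coefDeriv z) l, eval_symForm, h3] at h1 h2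
      rw [map_add, h1, h2]
    rw [e, e, ← sub_eq_zero]
    exact curv_eq_zero hz _ l m _ _
  · have e : ∀ l m, eval z (mkDerivation ℂ (jointPoly l) (jointPoly m aux))
        = ∑ i, (formDeriv (coef fun k => z (base k)) (symForm fun n => z (form n)) l m i
            * z (grad i) + symForm (fun n => z (form n)) m i
            * hess (coef fun k => z (base k)) (fun i => z (grad i)) (z lap) i l) := fun l m => by
      rw [jointPoly, map_sum, map_sum]
      refine Finset.sum_congr rfl fun i _ => ?_
      have h1 := map_formDeriv (eval z) (smul_eval z) (coef fun k => X (base k)) (symForm fun n => X (form n))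
        l m i
      have h2 := eval_jointPoly_grad z l i
      simp only [eval_coef, eval_symForm] at h1
      rw [Derivation.leibniz, derivation_symForm, mkDerivation_X, map_add, smul_eq_mul,
        smul_eq_mul, map_mul, map_mul, h1, h2]
      simp only [symForm, eval_X]
      ring
    rw [e, e]
    exact aux_integrable _ _ _ _ m l

/-- Local solutions of the joint system with prescribed values at a point. -/
theorem exists_joint_solution (x : Space) (z : Var → ℂ)
    (hz : ∀ m, eval (fun k => z (base k)) (quadric m) = 0) :
    ∃ g : Space → Var → ℂ, g x = z ∧ SolvesSystemAt jointPoly Set.univ g x ∧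
      ∀ᶠ y in 𝓝 x, ∀ m, eval (fun k => g y (base k)) (quadric m) = 0 := by
  have := exists_solvesSystemAt (P := jointPoly) (q := fun m => rename base (quadric m))
    (c := fun l m j => rename base (cofactor (C (1 / 18)) X l m j)) ?_ ?_ x z ?_
  · simp only [eval_rename] at this
    exact this
  · intro l m z
    simp only [derivation_rename_base, eval_rename, eval_derivation_quadric, map_cofactor, eval_C,
      eval_X]
  · intro z hz l m k
    simp only [eval_rename] at hz
    exact jointPoly_integrable hz l m k
  · simp only [eval_rename]
    exact hz

end JointSystem

/-! ### Constants of the motion -/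

section ConstantsOfMotion

theorem pd_momentum_sq (p : Space) (j i : Fin 3) :
    pd j (fun q => q i ^ 2) p = if j = i then 2 * p j else 0 := by
  have hc : ∀ i, DifferentiableAt ℂ (fun q : Space => q i) p := fun i => by fun_prop
  have h := pd_mul j (hc i) (hc i)
  have h' := pd_coord (x := p) j i 0
  simp only [sub_zero] at h'
  simp only [pow_two]
  rw [h, h']
  split_ifs with hji
  · rw [hji]; ring
  · ring

theorem pd_position_quadraticFunction {W : Space → ℂ} {a : Space → Matrix (Fin 3) (Fin 3) ℂ}
    {x : Space} (hW : DifferentiableAt ℂ W x)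
    (ha : ∀ i j, DifferentiableAt ℂ (fun y => a y i j) x) (p : Space) (j : Fin 3) :
    pd j (fun y => quadraticFunction a W y p) x
      = ∑ i, ∑ k, pd j (fun y => a y i k) x * p i * p k + pd j W x := by
  unfold quadraticFunction
  have hd : ∀ i k, DifferentiableAt ℂ (fun y => a y i k * p i * p k) x := fun i k =>
    ((ha i k).mul_const _).mul_const _
  have hd' : ∀ i, DifferentiableAt ℂ (fun y => ∑ k, a y i k * p i * p k) x := fun i =>
    DifferentiableAt.fun_sum fun k _ => hd i k
  rw [pd_add j (DifferentiableAt.fun_sum fun i _ => hd' i) hW, pd_sum _ _ fun i _ => hd' i]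
  congr 1
  refine Finset.sum_congr rfl fun i _ => ?_
  rw [pd_sum _ _ fun k _ => hd i k]
  refine Finset.sum_congr rfl fun k _ => ?_
  rw [pd_mul j ((ha i k).mul_const _) (differentiableAt_const _),
    pd_mul j (ha i k) (differentiableAt_const _), pd_const, pd_const]
  ring

theorem pd_momentum_quadraticFunction (W : Space → ℂ) {a : Space → Matrix (Fin 3) (Fin 3) ℂ}
    {x : Space} (hs : (a x).IsSymm) (p : Space) (j : Fin 3) :
    pd j (fun q => quadraticFunction a W x q) p = 2 * ∑ i, a x j i * p i := by
  have hc : ∀ i, DifferentiableAt ℂ (fun q : Space => q i) p := fun i => by fun_prop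
  have hpd : ∀ j i, pd j (fun q : Space => q i) p = if j = i then 1 else 0 := fun j i => by
    simpa using pd_coord (x := p) j i 0
  unfold quadraticFunction
  have hd : ∀ i k, DifferentiableAt ℂ (fun q : Space => a x i k * q i * q k) p := fun i k => by
    fun_prop
  rw [pd_add j (by fun_prop) (by fun_prop), pd_const, add_zero,
    pd_sum _ _ (fun i _ => by fun_prop)]
  have e : ∀ i, pd j (fun q : Space => ∑ k, a x i k * q i * q k) p
      = (if j = i then ∑ k, a x j k * p k else 0) + a x j i * p i := fun i => by
    rw [pd_sum _ _ fun k _ => hd i k]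
    have e' : ∀ k, pd j (fun q : Space => a x i k * q i * q k) p
        = (if j = i then a x j k * p k else 0) + (if j = k then a x j i * p i else 0) :=
      fun k => by
      rw [pd_mul j (by fun_prop) (hc k), pd_mul j (differentiableAt_const _) (hc i), pd_const,
        hpd, hpd]
      split_ifs with h h' h'
      · subst h; subst h'; ring
      · subst h; ring
      · subst h'; rw [hs.apply]; ring
      · ring
    simp only [e', Finset.sum_add_distrib, Finset.sum_ite_eq, Finset.mem_univ, if_true]
    congr 1
    split_ifs <;> simp
  simp only [e, Finset.sum_add_distrib, Finset.sum_ite_eq, Finset.mem_univ, if_true]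
  ring

/-- Sorts the bracket by degree in the momenta: the linear part compares `a dV` with `dW`, the cubic
part is the symmetrised derivative of `a`. -/
theorem poisson_hamiltonian_quadraticFunction {V W : Space → ℂ}
    {a : Space → Matrix (Fin 3) (Fin 3) ℂ} {x : Space}
    (hV : DifferentiableAt ℂ V x) (hW : DifferentiableAt ℂ W x)
    (ha : ∀ i j, DifferentiableAt ℂ (fun y => a y i j) x) (hs : (a x).IsSymm) (p : Space) :
    poisson (hamiltonian V) (quadraticFunction a W) x p
      = 2 * ∑ j, (∑ i, a x j i * pd i V x - pd j W x) * p j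
        - 2 * ∑ j, ∑ i, ∑ k, pd j (fun y => a y i k) x * p j * p i * p k := by
  have h1 : ∀ j, pd j (fun y => hamiltonian V y p) x = pd j V x := fun j => by
    unfold hamiltonian
    rw [pd_add j (by fun_prop) hV, pd_const, zero_add]
  have h2 : ∀ j, pd j (fun q => hamiltonian V x q) p = 2 * p j := fun j => by
    unfold hamiltonian
    rw [pd_add j (by fun_prop) (by fun_prop), pd_const, add_zero,
      pd_sum _ _ (fun i _ => by fun_prop)]
    simp [pd_momentum_sq]
  have h3 := pd_position_quadraticFunction hW ha p
  have h4 := pd_momentum_quadraticFunction W hs p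
  unfold poisson
  simp only [h1, h2, h3, h4]
  have e1 : ∑ j, pd j V x * (2 * ∑ i, a x j i * p i)
      = 2 * ∑ j, (∑ i, a x j i * pd i V x) * p j := by
    simp only [Finset.mul_sum, Finset.sum_mul]
    rw [Finset.sum_comm]
    refine Finset.sum_congr rfl fun i _ => Finset.sum_congr rfl fun k _ => ?_
    rw [← hs.apply k i]; ring
  have e2 : ∑ j, ∑ i, ∑ k, pd j (fun y => a y i k) x * p j * p i * p k
      = ∑ j, p j * ∑ i, ∑ k, pd j (fun y => a y i k) x * p i * p k := by
    simp only [Finset.mul_sum]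
    refine Finset.sum_congr rfl fun j _ => Finset.sum_congr rfl fun i _ =>
      Finset.sum_congr rfl fun k _ => by ring
  rw [Finset.sum_sub_distrib, e1, e2]
  simp only [sub_mul, mul_add, Finset.sum_sub_distrib, Finset.sum_add_distrib, Finset.mul_sum,
    mul_assoc, mul_sub, mul_comm (pd _ W x)]
  ring

/-- The Killing equation. Contracted with three copies of `p`, the four terms of `formDeriv` become
the same sum, twice with each sign. -/
theorem cubic_formDeriv_eq_zero (κ : Fin 3 → Fin 3 → Fin 3 → ℂ) (a : Fin 3 → Fin 3 → ℂ)
    (p : Fin 3 → ℂ) : ∑ j, ∑ i, ∑ k, formDeriv κ a j i k * p j * p i * p k = 0 := by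
  simp only [formDeriv, Fin.sum_univ_three, smul_eq_mul]
  ring

theorem pd_coef {f : Space → Label → ℂ} {x : Space} (hf : DifferentiableAt ℂ f x)
    (l s i j : Fin 3) :
    pd l (fun y => coef (f y) s i j) x = coef (fun k => pd l (fun y => f y k) x) s i j := by
  have h : ∀ k, DifferentiableAt ℂ (fun y => f y k) x := differentiableAt_pi.1 hf
  have h1 := pd_add l ((h .B12).fun_sub (h .A22)) (h .A33)
  rw [pd_sub l (h .B12) (h .A22)] at h1
  fin_cases s <;> fin_cases i <;> fin_cases j <;>
    first
      | rfl
      | exact pd_const l 0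
      | exact h1
      | exact pd_sub l (h _) (h _)
      | exact pd_add l (h _) (h _)

theorem analyticAt_coef {f : Space → Label → ℂ} {x : Space} (hf : AnalyticAt ℂ f x)
    (s i j : Fin 3) : AnalyticAt ℂ (fun y => coef (f y) s i j) x := by
  have h : ∀ k, AnalyticAt ℂ (fun y => f y k) x := analyticAt_pi_iff.1 hf
  fin_cases s <;> fin_cases i <;> fin_cases j <;>
    first
      | exact h _
      | exact analyticAt_const
      | exact ((h .B12).fun_sub (h .A22)).fun_add (h .A33)
      | exact (h _).fun_sub (h _)
      | exact (h _).fun_add (h _)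

/-- The third derivatives of a solution of the canonical equations. -/
theorem SolvesAt.third_derivative {K : Coefficients} {V : Space → ℂ} {x : Space}
    (h : SolvesAt K V x) (hK : ∀ s i j, DifferentiableAt ℂ (K s i j) x) (i j k : Fin 3) :
    pd k (pd j (pd i V)) x = (if i = j then pd k (pd 0 (pd 0 V)) x else 0)
      + ∑ s, (pd k (K s i j) x * pd s V x + K s i j x * pd k (pd s V) x) := by
  have hV := fun s => (analyticAt_pd s h.1).differentiableAt
  have hL := (analyticAt_pd 0 (analyticAt_pd 0 h.1)).differentiableAt
  have e : pd j (pd i V) =ᶠ[𝓝 x]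
      fun y => (if i = j then pd 0 (pd 0 V) y else 0) + ∑ s, K s i j y * pd s V y :=
    h.2.mono fun y hy => hy i j
  have hd : ∀ s, DifferentiableAt ℂ (fun y => K s i j y * pd s V y) x := fun s =>
    (hK s i j).fun_mul (hV s)
  rw [pd_congr k e, pd_add k (by split_ifs; exacts [hL, differentiableAt_const _])
    (DifferentiableAt.fun_sum fun s _ => hd s), pd_sum _ _ fun s _ => hd s]
  congr 1
  · split_ifs
    · rfl
    · exact pd_const k 0
  · exact Finset.sum_congr rfl fun s _ => pd_mul k (hK s i j) (hV s)

theorem SolvesAt.eventually {K : Coefficients} {V : Space → ℂ} {x : Space} (h : SolvesAt K V x) :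
    ∀ᶠ z in 𝓝 x, SolvesAt K V z := by
  filter_upwards [h.1.eventually_analyticAt, h.2.eventually_nhds] with z h1 h2 using ⟨h1, h2⟩

end ConstantsOfMotion

/-! ### Systems from solutions of the derivative relations -/

section Construction

open MvPolynomial Var

/-- Near `x`, the function `f` satisfies the derivative relations and the six quadratic
identities. -/
def IsBaseAt (f : Space → Label → ℂ) (x : Space) : Prop :=
  SolvesSystemAt derivPoly Set.univ f x ∧ ∀ᶠ z in 𝓝 x, ∀ m, eval (f z) (quadric m) = 0

/-- Near `x`, the matrix function `a` is symmetric and satisfies the differential equations for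
the quadratic form of a constant of the motion. -/
def IsFormAt (f : Space → Label → ℂ) (a : Space → Matrix (Fin 3) (Fin 3) ℂ) (x : Space) : Prop :=
  (∀ i j, AnalyticAt ℂ (fun y => a y i j) x) ∧
    ∀ᶠ z in 𝓝 x, (a z).IsSymm ∧
      ∀ l i j, pd l (fun y => a y i j) z = formDeriv (coef (f z)) (a z) l i j

theorem IsBaseAt.eventually {f : Space → Label → ℂ} {x : Space} (h : IsBaseAt f x) :
    ∀ᶠ z in 𝓝 x, IsBaseAt f z := by
  filter_upwards [h.1.eventually, h.2.eventually_nhds] with z h1 h2 using ⟨h1, h2⟩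

theorem IsFormAt.eventually {f : Space → Label → ℂ} {a : Space → Matrix (Fin 3) (Fin 3) ℂ}
    {x : Space} (h : IsFormAt f a x) : ∀ᶠ z in 𝓝 x, IsFormAt f a z := by
  filter_upwards [eventually_all.2 fun i => eventually_all.2 fun j => (h.1 i j).eventually_analyticAt,
    h.2.eventually_nhds] with z h1 h2 using ⟨h1, h2⟩

theorem exists_isBaseAt (x₀ : Space) {d : Label → ℂ} (hd : ∀ m, eval d (quadric m) = 0) :
    ∃ f, f x₀ = d ∧ IsBaseAt f x₀ := by
  refine exists_solvesSystemAt (P := derivPoly) (q := quadric)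
    (c := fun l m j => cofactor (C (1 / 18)) X l m j) ?_ (fun z hz => derivPoly_integrable hz)
    x₀ d hd
  intro l m z
  simp only [eval_derivation_quadric, map_cofactor, eval_C, eval_X]

/-- The closedness hypothesis of `SolvesSystemAt.unique`: equations for basic functions involve only
basic functions, and no right-hand side involves `W`. -/
theorem eval_jointPoly_congr {S : Set Var} (hS : S = Set.range base ∨ S = {aux}ᶜ) :
    ∀ k ∈ S, ∀ (l : Fin 3) (z z' : Var → ℂ), (∀ j ∈ S, z j = z' j) →
      eval z (jointPoly l k) = eval z' (jointPoly l k) := by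
  intro k hk l z z' h
  have hb : (fun k => z (base k)) = fun k => z' (base k) := by
    funext k
    refine h _ ?_
    rcases hS with rfl | rfl <;> simp
  rcases hS with rfl | rfl
  · obtain ⟨k, rfl⟩ := hk
    rw [eval_jointPoly_base, eval_jointPoly_base, hb]
  · have hg : (fun i => z (grad i)) = fun i => z' (grad i) := by
      funext i; exact h _ (by simp)
    have ht : (fun i => z (form i)) = fun i => z' (form i) := by
      funext i; exact h _ (by simp)
    have hl : z lap = z' lap := h _ (by simp)
    rcases k with k | _ | i | _ | n | _
    · rw [eval_jointPoly_base, eval_jointPoly_base, hb]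
    · rw [eval_jointPoly_pot, eval_jointPoly_pot, h _ (by simp)]
    · rw [eval_jointPoly_grad, eval_jointPoly_grad, hb, hg, hl]
    · rw [eval_jointPoly_lap, eval_jointPoly_lap, hb, hg, hl]
    · rw [eval_jointPoly_form, eval_jointPoly_form, hb, ht]
    · exact absurd rfl hk

theorem SolvesSystemAt.mono {ι : Type*} [Fintype ι] {P : Fin 3 → ι → MvPolynomial ι ℂ}
    {S T : Set ι} (hST : S ⊆ T) {f : Space → ι → ℂ} {x : Space} (h : SolvesSystemAt P T f x) :
    SolvesSystemAt P S f x :=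
  ⟨h.1, h.2.mono fun _ hz l k hk => hz l k (hST hk)⟩

/-- The joint function of basic functions, a potential and a quadratic form. -/
def jointFun (f : Space → Label → ℂ) (V : Space → ℂ) (a : Space → Matrix (Fin 3) (Fin 3) ℂ)
    (x : Space) : Var → ℂ
  | base k => f x k
  | pot => V x
  | grad i => pd i V x
  | lap => pd 0 (pd 0 V) x
  | form n => a x (symPair n).1 (symPair n).2
  | aux => 0

/-- Solutions of the joint system that extend a given solution of the derivative relations. -/
theorem IsBaseAt.exists_joint {f : Space → Label → ℂ} {x : Space} (h : IsBaseAt f x) (z : Var → ℂ)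
    (hz : ∀ k, z (base k) = f x k) :
    ∃ g : Space → Var → ℂ, g x = z ∧ SolvesSystemAt jointPoly Set.univ g x ∧
      ∀ᶠ y in 𝓝 x, ∀ k, g y (base k) = f y k := by
  obtain ⟨g, hg, hs, -⟩ := exists_joint_solution x z (by simpa only [hz] using h.2.self_of_nhds)
  refine ⟨g, hg, hs, ?_⟩
  have := SolvesSystemAt.unique (P := derivPoly) (S := Set.univ) (x₀ := x)
    (f := fun y k => g y (base k)) (f' := f) (fun k _ l z z' hz => by
      rw [show z = z' from funext fun j => hz j trivial]) ⟨?_, ?_⟩ h.1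
      (fun k _ => by rw [hg, hz])
  · exact this.mono fun y hy k => hy k trivial
  · exact analyticAt_pi_iff.2 fun k => analyticAt_pi_iff.1 hs.1 (base k)
  · filter_upwards [hs.2] with y hy l k _
    rw [hy l (base k) trivial, eval_jointPoly_base, eval_derivPoly]

theorem symForm_symPair {a : Matrix (Fin 3) (Fin 3) ℂ} (ha : a.IsSymm) :
    (symForm fun n => a (symPair n).1 (symPair n).2) = a := by
  funext i j
  exact apply_symPair_symIdx (fun i j => ha.apply j i) i j

theorem isSymm_symForm (t : Fin 6 → ℂ) : (Matrix.of (symForm t)).IsSymm :=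
  Matrix.IsSymm.ext fun i j => by simp only [Matrix.of_apply, symForm, symIdx_symm]

theorem IsBaseAt.exists_isFormAt {f : Space → Label → ℂ} {x : Space} (h : IsBaseAt f x)
    (t : Fin 6 → ℂ) : ∃ a, IsFormAt f a x ∧ a x = Matrix.of (symForm t) := by
  obtain ⟨g, hg, hs, hb⟩ := h.exists_joint
    (jointFun f 0 (fun _ => Matrix.of (symForm t)) x) (fun _ => rfl)
  refine ⟨fun y => Matrix.of (symForm fun n => g y (form n)), ⟨fun i j => ?_, ?_⟩, ?_⟩
  · exact analyticAt_pi_iff.1 hs.1 (form (symIdx i j))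
  · filter_upwards [hs.2, hb] with y hy hyb
    refine ⟨isSymm_symForm _, fun l i j => ?_⟩
    have := hy l (form (symIdx i j)) trivial
    rw [eval_jointPoly_form, funext hyb] at this
    exact this.trans (apply_symPair_symIdx (formDeriv_symm _ _ l) i j)
  · simp only [hg]
    congr 1
    exact symForm_symPair (isSymm_symForm t)

/-- For the identity matrix the terms of `formDeriv` cancel in pairs by the symmetry of the
coefficients in their two superscripts. -/
theorem isFormAt_one {f : Space → Label → ℂ} {x : Space} : IsFormAt f (fun _ => 1) x := by
  refine ⟨fun i j => analyticAt_const, Eventually.of_forall fun z => ⟨Matrix.isSymm_one, ?_⟩⟩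
  intro l i j
  rw [pd_const]
  change 0 = (1 / 3 : ℂ) • ∑ m, ((1 : Matrix (Fin 3) (Fin 3) ℂ) l m
    * (coef (f z) j m i + coef (f z) i m j) - (1 : Matrix (Fin 3) (Fin 3) ℂ) i m * coef (f z) j m l
    - (1 : Matrix (Fin 3) (Fin 3) ℂ) j m * coef (f z) i m l)
  simp only [Matrix.one_apply, Finset.sum_sub_distrib, ite_mul, one_mul, zero_mul,
    Finset.sum_ite_eq, Finset.mem_univ, if_true, coef_symm _ _ l]
  simp

/-! ### Potentials and constants of the motion as solutions of the joint system -/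

section Jets

variable {f : Space → Label → ℂ} {V : Space → ℂ} {a : Space → Matrix (Fin 3) (Fin 3) ℂ} {x : Space}

theorem IsBaseAt.pd_coef_eq (h : IsBaseAt f x) (l s i j : Fin 3) :
    pd l (fun y => coef (f y) s i j) x = coefDeriv (f x) l s i j := by
  rw [pd_coef h.1.1.differentiableAt, coefDeriv]
  congr 1
  funext k
  rw [h.1.2.self_of_nhds l k trivial, eval_derivPoly]

theorem SolvesAt.hess_eq {K : Coefficients} (hV : SolvesAt K V x) (i j : Fin 3) :
    pd j (pd i V) x
      = hess (fun s i j => K s i j x) (fun s => pd s V x) (pd 0 (pd 0 V) x) i j :=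
  hV.2.self_of_nhds i j

theorem SolvesAt.lapDeriv_eq (h : IsBaseAt f x)
    (hV : SolvesAt (fun s i j y => coef (f y) s i j) V x) (l : Fin 3) :
    pd l (pd 0 (pd 0 V)) x
      = lapDeriv (coef (f x)) (coefDeriv (f x)) (fun s => pd s V x) (pd 0 (pd 0 V) x) l := by
  have ht := hV.third_derivative fun s i j => (analyticAt_coef h.1.1 s i j).differentiableAt
  have hs : ∀ i j, pd j (pd i V) x
      = hess (coef (f x)) (fun s => pd s V x) (pd 0 (pd 0 V) x) i j := hV.hess_eq
  have hc : ∀ i j, pd i (pd j V) =ᶠ[𝓝 x] pd j (pd i V) := fun i j =>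
    hV.1.eventually_analyticAt.mono fun y hy => pd_comm i j hy
  simp only [h.pd_coef_eq] at ht
  unfold lapDeriv
  split_ifs with hl
  · subst hl
    -- The equality `V_{221} = V_{122}`: the left side contains `V_{111}`, the right side only lower
    -- derivatives.
    have h1 := ht 1 1 0
    have h2 := ht 0 1 1
    rw [pd_comm 0 1 (analyticAt_pd 1 hV.1), pd_congr 1 (hc 0 1), h2] at h1
    simp only [Fin.isValue, zero_ne_one, if_false, if_true] at h1
    simp only [← hs, Finset.sum_sub_distrib, Finset.sum_add_distrib] at h1 ⊢
    linear_combination -h1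
  · have h1 := ht 0 l 0
    rw [if_neg (Ne.symm hl), zero_add] at h1
    rw [pd_comm l 0 (analyticAt_pd 0 hV.1), h1]
    simp only [← hs]

/-- The potential of a system and the quadratic form of a constant of the motion solve the joint
system. -/
theorem solvesSystemAt_jointFun (h : IsBaseAt f x)
    (hV : SolvesAt (fun s i j y => coef (f y) s i j) V x) (ha : IsFormAt f a x) :
    SolvesSystemAt jointPoly {aux}ᶜ (jointFun f V a) x := by
  refine ⟨analyticAt_pi_iff.2 ?_, ?_⟩
  · rintro (k | _ | i | _ | n | _)
    · exact analyticAt_pi_iff.1 h.1.1 k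
    · exact hV.1
    · exact analyticAt_pd i hV.1
    · exact analyticAt_pd 0 (analyticAt_pd 0 hV.1)
    · exact ha.1 _ _
    · exact analyticAt_const
  · filter_upwards [h.eventually, hV.eventually, ha.2] with z h1 h2 h3 l k hk
    rcases k with k | _ | i | _ | n | _
    · rw [eval_jointPoly_base, ← eval_derivPoly]
      exact h1.1.2.self_of_nhds l k trivial
    · rw [eval_jointPoly_pot]; rfl
    · rw [eval_jointPoly_grad]
      exact h2.hess_eq i l
    · rw [eval_jointPoly_lap]
      exact SolvesAt.lapDeriv_eq h1 h2 l
    · rw [eval_jointPoly_form]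
      refine (h3.2 l _ _).trans ?_
      exact congrArg (fun b => formDeriv (coef (f z)) b l (symPair n).1 (symPair n).2)
        (symForm_symPair h3.1).symm
    · exact absurd rfl hk

theorem IsBaseAt.potential_unique (h : IsBaseAt f x) {V' : Space → ℂ}
    (hV : SolvesAt (fun s i j y => coef (f y) s i j) V x)
    (hV' : SolvesAt (fun s i j y => coef (f y) s i j) V' x) {c : ℂ} {v : Fin 3 → ℂ} {w : ℂ}
    (hd : HasData V x c v w) (hd' : HasData V' x c v w) : V =ᶠ[𝓝 x] V' := by
  -- The form component is irrelevant for the potential; the identity matrix fills it with a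
  -- solution.
  have := SolvesSystemAt.unique (eval_jointPoly_congr (.inr rfl))
    (solvesSystemAt_jointFun h hV (isFormAt_one (f := f)))
    (solvesSystemAt_jointFun h hV' (isFormAt_one (f := f))) (fun k _ => ?_)
  · exact this.mono fun y hy => hy pot (by simp)
  · rcases k with k | _ | i | _ | n | _
    · rfl
    · exact hd.1.trans hd'.1.symm
    · exact (hd.2.1 i).trans (hd'.2.1 i).symm
    · exact hd.2.2.trans hd'.2.2.symm
    · rfl
    · rfl

theorem IsBaseAt.exists_potential (h : IsBaseAt f x) (c : ℂ) (v : Fin 3 → ℂ) (w : ℂ) :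
    ∃ V, SolvesAt (fun s i j y => coef (f y) s i j) V x ∧ HasData V x c v w := by
  obtain ⟨g, hg, hs, hb⟩ := h.exists_joint (fun
    | base k => f x k
    | pot => c
    | grad i => v i
    | lap => w
    | form _ => 0
    | aux => 0) (fun _ => rfl)
  have h1 : ∀ᶠ y in 𝓝 x, ∀ i, pd i (fun y => g y pot) y = g y (grad i) := by
    filter_upwards [hs.2] with y hy i
    rw [hy i pot trivial, eval_jointPoly_pot]
  have h2 : ∀ᶠ y in 𝓝 x, ∀ i j, pd j (pd i (fun y => g y pot)) y
      = hess (coef (f y)) (fun i => g y (grad i)) (g y lap) i j := by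
    filter_upwards [h1.eventually_nhds, hs.2, hb] with y hy1 hy2 hy3 i j
    rw [pd_congr j (hy1.mono fun y hy => hy i), hy2 j (grad i) trivial, eval_jointPoly_grad,
      funext hy3]
  have h3 : ∀ᶠ y in 𝓝 x, pd 0 (pd 0 (fun y => g y pot)) y = g y lap := by
    filter_upwards [h2] with y hy
    rw [hy]
    simp [hess, coef_zero_zero]
  refine ⟨fun y => g y pot, ⟨analyticAt_pi_iff.1 hs.1 pot, ?_⟩, ?_, ?_, ?_⟩
  · filter_upwards [h1, h2, h3] with y hy1 hy2 hy3 i j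
    rw [hy2, hy3]
    simp only [hy1]
    rfl
  · simp only [hg]
  · intro i
    rw [h1.self_of_nhds, hg]
  · rw [h3.self_of_nhds, hg]

/-- Solve the joint system with the jet of `V` and the value of `a` as initial data. Uniqueness on
`{aux}ᶜ` gives back `V` and `a`, so the only new component is `W`. Its gradient is recorded because
functional independence depends on it. -/
theorem IsBaseAt.exists_constant (h : IsBaseAt f x)
    (hV : SolvesAt (fun s i j y => coef (f y) s i j) V x) (ha : IsFormAt f a x) :
    ∃ W, IsConstantOfMotionAt V a W x ∧ ∀ j, pd j W x = ∑ i, a x j i * pd i V x := by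
  obtain ⟨g, hg, hs, hb⟩ := h.exists_joint (jointFun f V a x) (fun _ => rfl)
  have hj := SolvesSystemAt.unique (eval_jointPoly_congr (.inr rfl)) (hs.mono (Set.subset_univ _))
    (solvesSystemAt_jointFun h hV ha) (fun k _ => by rw [hg])
  have hW : ∀ᶠ y in 𝓝 x, ∀ j, pd j (fun y => g y aux) y = ∑ i, a y j i * pd i V y := by
    filter_upwards [hs.2, hj, ha.2] with y h1 h2 h3 j
    rw [h1 j aux trivial, eval_jointPoly_aux]
    simp only [h2 (form _) (by simp), h2 (grad _) (by simp)]
    have : (symForm fun n => jointFun f V a y (form n)) = a y := symForm_symPair h3.1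
    rw [this]
    rfl
  have haux : AnalyticAt ℂ (fun y => g y aux) x := analyticAt_pi_iff.1 hs.1 aux
  refine ⟨fun y => g y aux, ⟨haux, ?_⟩, hW.self_of_nhds⟩
  filter_upwards [hW, ha.eventually, ha.2, hV.1.eventually_analyticAt, haux.eventually_analyticAt]
    with y h1 h2 h3 h4 h5 p
  rw [poisson_hamiltonian_quadraticFunction h4.differentiableAt h5.differentiableAt
    (fun i j => (h2.1 i j).differentiableAt) h3.1]
  simp only [h1, h3.2, sub_self, zero_mul, Finset.sum_const_zero, mul_zero]
  rw [zero_sub, neg_eq_zero, mul_eq_zero]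
  exact .inr (cubic_formDeriv_eq_zero _ (a y) p)

end Jets

end Construction

/-! ### Existence of a system through every common zero -/

section Existence

open MvPolynomial

theorem analyticAt_quadraticFunction {W : Space → ℂ} {a : Space → Matrix (Fin 3) (Fin 3) ℂ}
    {x : Space} (hW : AnalyticAt ℂ W x) (ha : ∀ i j, AnalyticAt ℂ (fun y => a y i j) x)
    (p : Space) :
    AnalyticAt ℂ (fun z : Space × Space => quadraticFunction a W z.1 z.2) (x, p) := by
  have hc : ∀ i, AnalyticAt ℂ (fun z : Space × Space => z.2 i) (x, p) := fun i =>
    ((ContinuousLinearMap.proj (R := ℂ) (φ := fun _ : Fin 3 => ℂ) i) ∘L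
      ContinuousLinearMap.snd ℂ Space Space).analyticAt _
  refine AnalyticAt.fun_add (Finset.analyticAt_fun_sum _ fun i _ =>
    Finset.analyticAt_fun_sum _ fun j _ => ((AnalyticAt.fun_mul ?_ (hc i)).fun_mul (hc j))) ?_
  · exact (ha i j).comp_of_eq analyticAt_fst rfl
  · exact hW.comp_of_eq analyticAt_fst rfl

theorem fderiv_apply_single_left {F : Space → Space → ℂ} {x p : Space}
    (hF : DifferentiableAt ℂ (fun z : Space × Space => F z.1 z.2) (x, p)) (k : Fin 3) :
    fderiv ℂ (fun z : Space × Space => F z.1 z.2) (x, p) (Pi.single k 1, 0)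
      = pd k (fun y => F y p) x := by
  have := hF.hasFDerivAt.comp x (hasFDerivAt_prodMk_left (𝕜 := ℂ) x p)
  rw [pd, show (fun y => F y p) = (fun z : Space × Space => F z.1 z.2) ∘ fun y => (y, p) from rfl,
    this.fderiv]
  simp

theorem fderiv_apply_single_right {F : Space → Space → ℂ} {x p : Space}
    (hF : DifferentiableAt ℂ (fun z : Space × Space => F z.1 z.2) (x, p)) (k : Fin 3) :
    fderiv ℂ (fun z : Space × Space => F z.1 z.2) (x, p) (0, Pi.single k 1)
      = pd k (fun q => F x q) p := by
  have := hF.hasFDerivAt.comp p (hasFDerivAt_prodMk_right (𝕜 := ℂ) x p)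
  rw [pd, show (fun q => F x q) = (fun z : Space × Space => F z.1 z.2) ∘ fun q => (x, q) from rfl,
    this.fderiv]
  simp

/-- The initial values of the five quadratic forms. -/
def initialForm : Fin 5 → Fin 6 → ℂ :=
  ![![1, 0, 0, 1, 0, 1], ![0, 1, 0, 0, 0, 0], ![0, 0, 1, 0, 0, 0], ![0, 0, 0, 0, 1, 0],
    ![1, 0, 0, 0, 0, 0]]

theorem of_symForm_initialForm_zero : Matrix.of (symForm (initialForm 0)) = 1 := by
  ext i j
  fin_cases i <;> fin_cases j <;> simp [symForm, symIdx, initialForm]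

theorem linearIndependent_initialForm :
    LinearIndependent ℂ fun h => Matrix.of (symForm (initialForm h)) := by
  rw [Fintype.linearIndependent_iff]
  intro c hc
  have e : ∀ i j, ∑ h, c h * symForm (initialForm h) i j = 0 := fun i j => by
    simpa [Matrix.sum_apply] using congrFun (congrFun hc i) j
  have e00 := e 0 0
  have e01 := e 0 1
  have e02 := e 0 2
  have e11 := e 1 1
  have e12 := e 1 2
  simp [Fin.sum_univ_five, symForm, symIdx, initialForm] at e00 e01 e02 e11 e12
  intro h
  fin_cases h <;> simp [e01, e02, e11, e12]
  simpa [e11] using e00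

/-- Functional independence of the five constants of the motion for a suitable potential. -/
theorem IsBaseAt.linearIndependent_fderiv {f : Space → Label → ℂ} {x : Space}
    {a : Fin 5 → Space → Matrix (Fin 3) (Fin 3) ℂ} {V : Space → ℂ} {W : Fin 5 → Space → ℂ}
    (ha : ∀ h, IsFormAt f (a h) x) (ha0 : ∀ h, a h x = Matrix.of (symForm (initialForm h)))
    (hW : ∀ h, AnalyticAt ℂ (W h) x)
    (hWV : ∀ h j, pd j (W h) x = ∑ i, a h x j i * pd i V x)
    (hV : ∀ i, pd i V x = (if i = 0 then 1 else 0) - 2 / 3 * coef (f x) 2 i 2) :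
    LinearIndependent ℂ fun h => fderiv ℂ (fun z : Space × Space =>
      quadraticFunction (a h) (W h) z.1 z.2) (x, Pi.single 2 1) := by
  rw [Fintype.linearIndependent_iff]
  intro c hc
  have hF := fun h => (analyticAt_quadraticFunction (hW h) (ha h).1 (Pi.single 2 1)).differentiableAt
  -- At `p = e_3` the momentum derivatives say that the third column of `∑ c h • a h x` vanishes.
  have hr : ∀ k, ∑ h, c h * a h x k 2 = 0 := fun k => by
    have := congrArg (fun L => L (0, Pi.single k 1)) hc
    simp only [sum_apply, smul_apply, smul_eq_mul,
      fderiv_apply_single_right (hF _), zero_apply,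
      pd_momentum_quadraticFunction (W _) (ha _).2.self_of_nhds.1] at this
    simp only [Pi.single_apply, mul_ite, mul_one, mul_zero, Finset.sum_ite_eq', Finset.mem_univ,
      if_true, ← mul_assoc, mul_comm _ (2 : ℂ)] at this
    simpa only [mul_assoc, ← Finset.mul_sum, mul_eq_zero, OfNat.ofNat_ne_zero, false_or] using this
  have hl : ∀ k, ∑ h, c h * a h x k 0 = 0 := fun k => by
    have := congrArg (fun L => L (Pi.single k 1, 0)) hc
    simp only [sum_apply, smul_apply, smul_eq_mul,
      fderiv_apply_single_left (hF _), zero_apply,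
      pd_position_quadraticFunction (hW _).differentiableAt
        fun i j => ((ha _).1 i j).differentiableAt, (ha _).2.self_of_nhds.2, hWV] at this
    -- The derivative of `a^{33}` contributes `(2/3) ∑ (a^{km} C^{m3} - a^{3m} C^{mk})`. The
    -- correction `-(2/3) C^{i3}` in the gradient of `V` cancels the first sum, the part `e_1` of
    -- the gradient leaves `a^{k1}`, and the second sum disappears by `hr`.
    have e : ∀ h, ∑ i, ∑ j, formDeriv (coef (f x)) (a h x) k i j
          * (Pi.single 2 1 : Space) i * (Pi.single 2 1 : Space) j + ∑ i, a h x k i * pd i V x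
        = a h x k 0 - ∑ m, (2 / 3 * coef (f x) 2 m k) * a h x m 2 := fun h => by
      have hs := fun i j => (ha h).2.self_of_nhds.1.apply i j
      simp only [hV, Pi.single_apply, mul_ite, mul_one, mul_zero, Finset.sum_ite_eq',
        Finset.mem_univ, if_true, formDeriv, Fin.sum_univ_three, smul_eq_mul, Fin.isValue,
        Fin.reduceEq, if_false, hs 0 2, hs 1 2]
      ring
    have e2 : ∑ h, c h * ∑ m, (2 / 3 * coef (f x) 2 m k) * a h x m 2 = 0 := by
      have : ∀ h, c h * ∑ m, (2 / 3 * coef (f x) 2 m k) * a h x m 2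
          = ∑ m, (2 / 3 * coef (f x) 2 m k) * (c h * a h x m 2) := fun h => by
        rw [Finset.mul_sum]
        exact Finset.sum_congr rfl fun m _ => by ring
      simp only [this]
      rw [Finset.sum_comm]
      simp only [← Finset.mul_sum, hr, mul_zero, Finset.sum_const_zero]
    simp only [e, mul_sub, Finset.sum_sub_distrib] at this
    rw [e2, sub_zero] at this
    exact this
  -- The first and third columns of the combination vanish, and these columns already separate the
  -- five initial matrices.
  have r0 := hr 0
  have r1 := hr 1
  have r2 := hr 2
  have l0 := hl 0
  have l1 := hl 1
  simp [Fin.sum_univ_five, ha0, symForm, symIdx, initialForm] at r0 r1 r2 l0 l1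
  intro h
  fin_cases h <;> simp [r0, r1, r2, l1]
  simpa [r2] using l0

theorem IsConstantOfMotionAt.eventually {V W : Space → ℂ} {a : Space → Matrix (Fin 3) (Fin 3) ℂ}
    {x : Space} (h : IsConstantOfMotionAt V a W x) :
    ∀ᶠ z in 𝓝 x, IsConstantOfMotionAt V a W z := by
  filter_upwards [h.1.eventually_analyticAt, h.2.eventually_nhds] with z h1 h2 using ⟨h1, h2⟩

theorem basic_coef (f : Space → Label → ℂ) (x : Space) :
    basic (fun s i j y => coef (f y) s i j) x = f x := by
  funext k
  cases k <;> rfl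

theorem eventually_linearIndependent {a : Fin 5 → Space → Matrix (Fin 3) (Fin 3) ℂ} {x₀ : Space}
    (ha : ∀ h i j, ContinuousAt (fun x => a h x i j) x₀)
    (h : LinearIndependent ℂ fun h => a h x₀) : ∀ᶠ x in 𝓝 x₀, LinearIndependent ℂ fun h => a h x := by
  let e : Matrix (Fin 3) (Fin 3) ℂ ≃ₗ[ℂ] (Fin 3 → Fin 3 → ℂ) := (Matrix.ofLinearEquiv ℂ).symm
  have he : ∀ x, LinearIndependent ℂ (fun h => e (a h x)) ↔ LinearIndependent ℂ fun h => a h x :=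
    fun x => LinearMap.linearIndependent_iff_of_injOn e.toLinearMap e.injective.injOn
  have hc : ContinuousAt (fun x h => e (a h x)) x₀ :=
    continuousAt_pi.2 fun h => continuousAt_pi.2 fun i => continuousAt_pi.2 fun j => ha h i j
  filter_upwards [hc.eventually (isOpen_setOfPred_linearIndependent.mem_nhds ((he x₀).2 h))]
    with x hx using (he x).1 hx

/-- Every common zero of the six quadrics is the value at `x₀` of the basic functions of a
superintegrable system. -/
theorem exists_isSystemOn (x₀ : Space) {d : Label → ℂ} (hd : ∀ m, eval d (quadric m) = 0) :
    ∃ (U : Set Space) (K : Coefficients), x₀ ∈ U ∧ IsSystemOn K U ∧ basic K x₀ = d := by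
  obtain ⟨f, hf0, hf⟩ := exists_isBaseAt x₀ hd
  have hex : ∀ h : Fin 5, ∃ a, IsFormAt f a x₀ ∧ a x₀ = Matrix.of (symForm (initialForm h)) ∧
      -- The first form has to be the identity on the whole domain, not only at `x₀`.
      (h = 0 → ∀ y, a y = 1) := by
    intro h
    by_cases h0 : h = 0
    · subst h0
      exact ⟨fun _ => 1, isFormAt_one, of_symForm_initialForm_zero.symm, fun _ _ => rfl⟩
    · obtain ⟨a, h1, h2⟩ := hf.exists_isFormAt (initialForm h)
      exact ⟨a, h1, h2, fun h => absurd h h0⟩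
  choose a ha ha0 ha1 using hex
  obtain ⟨V, hV, hVd⟩ := hf.exists_potential 0
    (fun i => (if i = 0 then 1 else 0) - 2 / 3 * coef (f x₀) 2 i 2) 0
  choose W hW hWd using fun h => hf.exists_constant hV (ha h)
  have hli := IsBaseAt.linearIndependent_fderiv ha ha0 (fun h => (hW h).1) hWd hVd.2.1
  have hopen1 : ∀ᶠ x in 𝓝 x₀, LinearIndependent ℂ fun h => fderiv ℂ (fun z : Space × Space =>
      quadraticFunction (a h) (W h) z.1 z.2) (x, Pi.single 2 1) := by
    have hc : ContinuousAt (fun x h => fderiv ℂ (fun z : Space × Space =>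
        quadraticFunction (a h) (W h) z.1 z.2) (x, Pi.single 2 1)) x₀ := by
      refine continuousAt_pi.2 fun h => ?_
      exact (analyticAt_quadraticFunction (hW h).1 (ha h).1 _).fderiv.continuousAt.comp_of_eq
        (by fun_prop) rfl
    exact hc.eventually (isOpen_setOfPred_linearIndependent.mem_nhds hli)
  have hopen2 : ∀ᶠ x in 𝓝 x₀, LinearIndependent ℂ fun h => a h x := by
    refine eventually_linearIndependent (fun h i j => ((ha h).1 i j).continuousAt) ?_
    simp only [ha0]
    exact linearIndependent_initialForm
  have hall : ∀ᶠ x in 𝓝 x₀, IsBaseAt f x ∧ (∀ h, IsFormAt f (a h) x) ∧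
      SolvesAt (fun s i j y => coef (f y) s i j) V x ∧
      (∀ h, IsConstantOfMotionAt V (a h) (W h) x) := by
    filter_upwards [hf.eventually, eventually_all.2 fun h => (ha h).eventually, hV.eventually,
      eventually_all.2 fun h => (hW h).eventually] with x h1 h2 h3 h4 using ⟨h1, h2, h3, h4⟩
  -- All requirements hold on a neighbourhood of `x₀`; a ball inside it is convex and hence
  -- connected.
  obtain ⟨r, hr, hball⟩ := Metric.eventually_nhds_iff_ball.1 (hall.and (hopen1.and hopen2))
  refine ⟨Metric.ball x₀ r, fun s i j y => coef (f y) s i j, Metric.mem_ball_self hr, ?_, ?_⟩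
  · exact {
      isOpen := Metric.isOpen_ball
      isConnected := ⟨⟨x₀, Metric.mem_ball_self hr⟩, (convex_ball x₀ r).isPreconnected⟩
      analytic := fun s i j x hx => analyticAt_coef (hball x hx).1.1.1.1 s i j
      symm := fun s i j x _ => coef_symm _ _ _ _
      zero_zero := fun s x _ => coef_zero_zero _ _
      nondegenerate := fun x hx c v w =>
        ⟨(hball x hx).1.1.exists_potential c v w, fun V V' h1 h2 h3 h4 =>
          (hball x hx).1.1.potential_unique h1 h3 h2 h4⟩
      superintegrable := ⟨a, {
        analytic := fun h i j x hx => ((hball x hx).1.2.1 h).1 i j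
        symm := fun h x hx => ((hball x hx).1.2.1 h).2.self_of_nhds.1
        first := fun x _ => ha1 0 rfl x
        constants := fun x hx V hV h =>
          ((hball x hx).1.1.exists_constant hV ((hball x hx).1.2.1 h)).imp fun _ => And.left
        linearIndependent := fun x hx => (hball x hx).2.2
        functionallyIndependent := fun x hx =>
          ⟨V, W, (hball x hx).1.2.2.1, (hball x hx).1.2.2.2, _, (hball x hx).2.1⟩ }⟩ }
  · rw [basic_coef, hf0]

end Existence

/-! ### Necessity of the derivative relations -/

section Necessity

open MvPolynomial Label

/-- The integrability conditions of the canonical equations, in terms of the deviation `ε` of the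
derivatives of the basic functions from the derivative relations and of the values `Q` of the six
quadrics. -/
structure PotentialRelations (ε : Fin 3 → Label → ℂ) (Q : Fin 6 → ℂ) : Prop where
  e0B23 : ε 0 B23 = ε 2 B12
  e0A23 : ε 0 A23 = ε 2 A12 - Q 3
  e0A12 : ε 0 A12 = -ε 1 A33 + ε 2 A23 - Q 4
  e1A13 : ε 1 A13 = ε 2 A12
  e1A22 : ε 1 A22 = ε 1 A33 + ε 1 B12 - ε 2 A23 - Q 4
  e1A23 : ε 1 A23 = ε 2 B12 - Q 0
  e0A13 : ε 0 A13 = -ε 2 A22 + ε 2 B12 - 2 * Q 0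
  e0A22 : ε 0 A22 = ε 0 A33 - ε 1 B33 - ε 2 A13 + ε 2 B23 - 2/3 * Q 1 - 1/3 * Q 2
  e1B23 : ε 1 B23 = ε 2 A12 + ε 2 B22 - 7/3 * Q 3
  e0B12 : ε 0 B12 = -ε 1 B33 + ε 2 B23 - 4/3 * Q 2
  e0C33 : ε 0 C33 = ε 2 A33 + 4 * Q 0
  e0B22 : ε 0 B22 = ε 1 A33 + ε 1 B12 - ε 2 A23 + 3 * Q 4
  e0B33 : ε 0 B33 = ε 1 A33 + 2 * Q 4
  e1C33 : ε 1 C33 = ε 2 B33 + 2 * Q 3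
  e1A12 : ε 1 A12 = -ε 1 B33 + ε 2 B23 + Q 1 - 1/3 * Q 2

/-- For each `s` the numbers `T` are the unknown derivatives of `V_{11}` for a potential with
gradient `e_s`. There are eight equations for each `s`, the case `(2, 0, 1)` being the difference of
`(1, 0, 2)` and `(0, 1, 2)`. Eliminating the nine unknowns from these twenty-four equations leaves
fifteen relations. -/
theorem potentialRelations {d : Label → ℂ} {ε : Fin 3 → Label → ℂ}
    (h : ∀ s, ∃ T : Fin 3 → ℂ, ∀ i j k,
      (if i = j then T k else 0) + coef (fun n => derivForm (1 / 6) d k n + ε k n) s i j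
        + ∑ m, coef d m i j * coef d s m k
      = (if i = k then T j else 0) + coef (fun n => derivForm (1 / 6) d j n + ε j n) s i k
        + ∑ m, coef d m i k * coef d s m j) :
    PotentialRelations ε fun m => eval d (quadric m) := by
  choose T hT using h
  have g0001 := hT 0 0 0 1
  have g0002 := hT 0 0 0 2
  have g0012 := hT 0 0 1 2
  have g0101 := hT 0 1 0 1
  have g0102 := hT 0 1 0 2
  have g0112 := hT 0 1 1 2
  have g0202 := hT 0 2 0 2
  have g0212 := hT 0 2 1 2
  have g1001 := hT 1 0 0 1
  have g1002 := hT 1 0 0 2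
  have g1012 := hT 1 0 1 2
  have g1101 := hT 1 1 0 1
  have g1102 := hT 1 1 0 2
  have g1112 := hT 1 1 1 2
  have g1202 := hT 1 2 0 2
  have g1212 := hT 1 2 1 2
  have g2001 := hT 2 0 0 1
  have g2002 := hT 2 0 0 2
  have g2012 := hT 2 0 1 2
  have g2101 := hT 2 1 0 1
  have g2102 := hT 2 1 0 2
  have g2112 := hT 2 1 1 2
  have g2202 := hT 2 2 0 2
  have g2212 := hT 2 2 1 2
  simp only [Fin.sum_univ_three, Fin.isValue, Fin.reduceEq, if_true, if_false]
    at g0001 g0002 g0012 g0101 g0102 g0112 g0202 g0212 g1001 g1002 g1012 g1101 g1102 g1112 g1202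
      g1212 g2001 g2002 g2012 g2101 g2102 g2112 g2202 g2212
  dsimp only [coef]
    at g0001 g0002 g0012 g0101 g0102 g0112 g0202 g0212 g1001 g1002 g1012 g1101 g1102 g1112 g1202
      g1212 g2001 g2002 g2012 g2101 g2102 g2112 g2202 g2212
  dsimp only [derivForm]
    at g0001 g0002 g0012 g0101 g0102 g0112 g0202 g0212 g1001 g1002 g1012 g1101 g1102 g1112 g1202
      g1212 g2001 g2002 g2012 g2101 g2102 g2112 g2202 g2212
  constructor <;>
    try simp only [quadric, Fin.isValue, Matrix.cons_val, map_add, map_sub, map_mul, map_neg,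
      map_pow, eval_X]
  · linear_combination -g1102
  · linear_combination -g0102
  · linear_combination -g0001 - g0212
  · linear_combination -g0012
  · linear_combination g2012
  · linear_combination -g1012
  · linear_combination -g0002 + g0112 - g1012
  · linear_combination -1/2 * g0101 + 1/2 * g0202 - 1/2 * g1001 - 1/2 * g1212 + 1/2 * g2002 - 1/2
      * g2112
  · linear_combination g1002 - g0102 - g1112
  · linear_combination -g1001 - g1212
  · linear_combination g0002 - g0112 + 2 * g1012 - g1102 - g2202 + g2101
  · linear_combination g0001 + g0212 - g1101 + g1202 - g2102
  · linear_combination g0001 + g0212 - g2102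
  · linear_combination g0102 - g2212 - g2001
  · linear_combination 1/2 * g0101 - 1/2 * g0202 - 1/2 * g1001 - 1/2 * g1212 + 1/2 * g2002 - 1/2 *
      g2112

/-- The integrability conditions for the quadratic form of a constant of the motion, as linear
forms on the space of symmetric matrices. -/
def defectRow (ε : Fin 3 → Label → ℂ) (Q : Fin 6 → ℂ) : Fin 3 → Fin 6 → Fin 6 → ℂ
  | 0, 0 => ![2/3 * ε 1 A33 - 2/3 * ε 2 A23 + 2/3 * Q 4, -2/3 * ε 0 A33 + 2/3 * ε 1 B33 + 2/3 * ε
      2 A13 - 2/3 * ε 2 B23 + 4/9 * Q 1 + 2/9 * Q 2, -2/3 * ε 2 A12 + 10/9 * Q 3, -2/3 * ε 1 A33 +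
      2/3 * ε 2 A23 - 2/3 * Q 4, -2/3 * ε 2 A22 + 2/3 * ε 2 B12 - 4/3 * Q 0, 0]
  | 0, 1 => ![2/3 * ε 1 B33 - 2/3 * ε 2 B23 - 1/3 * Q 1 + 5/9 * Q 2, -2/3 * ε 1 A33 - 2/3 * ε 1
      B12 + 2/3 * ε 2 A23 - 2/3 * Q 4, -2/3 * ε 2 B12 + 2/9 * Q 0, -2/3 * ε 1 B33 + 2/3 * ε 2 B23
      + 1/3 * Q 1 - 5/9 * Q 2, 2/3 * ε 2 A12 - 2/9 * Q 3, 0]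
  | 0, 2 => ![-2/3 * ε 2 A12 + 2/9 * Q 3, -2/3 * ε 2 A22 - 4/9 * Q 0, -2/3 * ε 2 A23 - 4/9 * Q 4,
      2/3 * ε 2 A12 - 4/9 * Q 3, 2/3 * ε 2 A13 + 1/9 * Q 1 - 1/3 * Q 2, 2/9 * Q 3]
  | 0, 3 => ![-2/3 * ε 1 B12, -2/3 * ε 1 B22, -2/3 * ε 2 A12 - 2/3 * ε 2 B22 + 14/9 * Q 3, 2/3 * ε
      1 B12, 2/3 * ε 2 B12 - 10/9 * Q 0, 0]
  | 0, 4 => ![-2/3 * ε 2 B12 + 4/9 * Q 0, -2/3 * ε 2 B22 + 2/3 * Q 3, -2/3 * ε 2 B23 - 1/3 * Q 1 +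
      1/9 * Q 2, 2/3 * ε 2 B12 - 2/9 * Q 0, 2/3 * ε 2 A23 + 4/9 * Q 4, -2/9 * Q 0]
  | 0, 5 => ![-2/3 * ε 2 A23 - 2/9 * Q 4, 2/3 * ε 2 A13 - 2/3 * ε 2 B23, -2/3 * ε 2 A12 - 2/3 * ε
      2 B33 - 2/9 * Q 3, 2/3 * ε 2 A23 + 2/9 * Q 4, -2/3 * ε 2 A22 + 2/3 * ε 2 A33 + 2/3 * ε 2 B12
      + 4/9 * Q 0, 0]
  | 1, 0 => ![2/3 * ε 2 A22 - 2/3 * ε 2 B12 + 4/3 * Q 0, -2/3 * ε 2 A12 + 10/9 * Q 3, -2/3 * ε 0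
      A33, 0, -2/3 * ε 1 A33 + 2/3 * ε 2 A23 - 2/3 * Q 4, -2/3 * ε 2 A22 + 2/3 * ε 2 B12 - 4/3 * Q
      0]
  | 1, 1 => ![-2/3 * ε 2 A12 + 2/9 * Q 3, -2/3 * ε 2 B12 + 4/9 * Q 0, -2/3 * ε 1 A33 - 2/3 * Q 4,
      2/9 * Q 3, -2/3 * ε 1 B33 + 2/3 * ε 2 B23 + 1/9 * Q 1 - 5/9 * Q 2, 2/3 * ε 2 A12 - 4/9 * Q
      3]
  | 1, 2 => ![-2/3 * ε 2 A13 + 1/9 * Q 1 + 1/3 * Q 2, -2/3 * ε 2 A23 - 2/3 * Q 4, -2/3 * ε 2 A33 -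
      4/3 * Q 0, 0, 2/3 * ε 2 A12 - 2/9 * Q 3, 2/3 * ε 2 A13 - 1/9 * Q 1 - 1/3 * Q 2]
  | 1, 3 => ![-2/3 * ε 2 B12 + 2/3 * Q 0, -2/3 * ε 2 A12 - 2/3 * ε 2 B22 + 10/9 * Q 3, -2/3 * ε 1
      B33 - 2/9 * Q 2, 0, 2/3 * ε 1 B12 + 4/9 * Q 4, 2/3 * ε 2 B12 - 2/3 * Q 0]
  | 1, 4 => ![-2/3 * ε 2 A23 - 4/9 * Q 4, -2/3 * ε 2 B23 - 1/9 * Q 1 + 1/9 * Q 2, -2/3 * ε 2 B33 -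
      2/3 * Q 3, -2/9 * Q 4, 2/3 * ε 2 B12 - 4/9 * Q 0, 2/3 * ε 2 A23 + 2/3 * Q 4]
  | 1, 5 => ![2/3 * ε 2 A22 - 2/3 * ε 2 A33 - 2/3 * ε 2 B12, -2/3 * ε 2 A12 - 2/3 * ε 2 B33 + 2/9
      * Q 3, -2/3 * ε 2 C33, 0, 2/3 * ε 2 A23 - 2/9 * Q 4, -2/3 * ε 2 A22 + 2/3 * ε 2 A33 + 2/3 *
      ε 2 B12]
  | 2, 0 => ![0, 2/3 * ε 2 A22 - 2/3 * ε 2 B12 + 8/9 * Q 0, -2/3 * ε 1 A33 + 2/3 * ε 2 A23 - 2/9 *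
      Q 4, -2/3 * ε 2 A12 + 2/3 * Q 3, -2/3 * ε 1 B33 - 2/3 * ε 2 A13 + 2/3 * ε 2 B23 - 2/9 * Q 2,
      2/3 * ε 2 A12 - 2/3 * Q 3]
  | 2, 1 => ![2/9 * Q 0, -2/3 * ε 2 A12 + 4/9 * Q 3, -2/3 * ε 1 B33 + 2/3 * ε 2 B23 + 1/3 * Q 1 -
      1/3 * Q 2, -2/3 * ε 2 B12 + 2/9 * Q 0, 2/3 * ε 1 B12 - 2/3 * ε 2 A23, 2/3 * ε 2 B12 - 4/9 *
      Q 0]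
  | 2, 2 => ![-2/9 * Q 4, -2/3 * ε 2 A13 - 1/9 * Q 1 + 1/9 * Q 2, 2/3 * ε 2 A12 - 4/9 * Q 3, -2/3
      * ε 2 A23 - 4/9 * Q 4, 2/3 * ε 2 A22 - 2/3 * ε 2 A33 - 8/9 * Q 0, 2/3 * ε 2 A23 + 2/3 * Q 4]
  | 2, 3 => ![0, -2/3 * ε 2 B12 + 10/9 * Q 0, 2/3 * ε 1 B12, -2/3 * ε 2 A12 - 2/3 * ε 2 B22 + 14/9
      * Q 3, 2/3 * ε 1 B22 - 2/3 * ε 1 B33 + 2/9 * Q 2, 2/3 * ε 2 A12 + 2/3 * ε 2 B22 - 14/9 * Q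
      3]
  | 2, 4 => ![0, -2/3 * ε 2 A23 - 2/3 * Q 4, 2/3 * ε 2 B12 - 2/9 * Q 0, -2/3 * ε 2 B23 - 1/3 * Q 1
      - 1/9 * Q 2, 2/3 * ε 2 B22 - 2/3 * ε 2 B33 - 4/3 * Q 3, 2/3 * ε 2 B23 + 1/3 * Q 1 + 1/9 * Q
      2]
  | 2, 5 => ![0, 2/3 * ε 2 A22 - 2/3 * ε 2 A33 - 2/3 * ε 2 B12, 2/3 * ε 2 A23 - 2/9 * Q 4, -2/3 *
      ε 2 A12 - 2/3 * ε 2 B33 + 2/9 * Q 3, -2/3 * ε 2 A13 + 2/3 * ε 2 B23 - 2/3 * ε 2 C33 - 4/9 *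
      Q 1 - 4/9 * Q 2, 2/3 * ε 2 A12 + 2/3 * ε 2 B33 - 2/9 * Q 3]

/-- The pairs of different indices. -/
def indexPair : Fin 3 → Fin 3 × Fin 3
  | 0 => (0, 1)
  | 1 => (0, 2)
  | 2 => (1, 2)

-- Fifteen of the thirty deviations are eliminated by `PotentialRelations`; the contribution of
-- `derivForm` reduces to the first five quadrics, as in `curv_eq_zero`. What remains are eighteen
-- linear forms in `t`, given by their rows.
set_option maxHeartbeats 1000000 in
theorem curv_eq_sum_defectRow {d : Label → ℂ} {ε : Fin 3 → Label → ℂ}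
    {Q : Fin 6 → ℂ} (hQ : ∀ m, eval d (quadric m) = Q m) (h : PotentialRelations ε Q)
    (t : Fin 6 → ℂ) (p : Fin 3) (n : Fin 6) :
    curv (coef d) (fun l => coef fun k => derivForm (1 / 6) d l k + ε l k) (symForm t)
        (indexPair p).1 (indexPair p).2 (symPair n).1 (symPair n).2
      = ∑ m, t m * defectRow ε Q p n m := by
  rcases h with ⟨e0B23, e0A23, e0A12, e1A13, e1A22, e1A23, e0A13, e0A22, e1B23, e0B12, e0C33,
      e0B22, e0B33, e1C33, e1A12⟩
  have h0 := hQ 0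
  have h1 := hQ 1
  have h2 := hQ 2
  have h3 := hQ 3
  have h4 := hQ 4
  simp only [quadric, Fin.isValue, Matrix.cons_val, map_add, map_sub, map_mul, map_neg, map_pow,
    eval_X] at h0 h1 h2 h3 h4
  rcases fin_three p with rfl | rfl | rfl <;>
    rcases fin_six n with rfl | rfl | rfl | rfl | rfl | rfl <;>
    dsimp only [indexPair, symPair] <;>
    simp only [curv, formDeriv, Fin.sum_univ_three, Fin.sum_univ_six, smul_eq_mul] <;>
    dsimp only [coef, symForm, symIdx, defectRow] <;> dsimp only [derivForm] <;>
    simp only [Fin.isValue, Matrix.cons_val]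
  · linear_combination (-2/3 * t 0 + 2/3 * t 3) * e0A12 + (-2/3 * t 1) * e0A22 + (-2/3 * t 2) *
      e0A23 + 2/3 * t 4 * e0A13 + 4/9 * t 2 * h3
  · linear_combination (-1/3 * t 0 + 1/3 * t 3) * e0B12 + (-1/3 * t 1) * e0B22 + (-1/3 * t 2) *
      e0B23 + 1/3 * t 4 * e0A23 + (-1/3 * t 0 + 1/3 * t 3) * e1A12 + (-1/3 * t 1) * e1A22 + (-1/3
      * t 2) * e1A23 + 1/3 * t 4 * e1A13 + (-1/9 * t 2) * h0 + 1/9 * t 4 * h3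
  · linear_combination (-1/3 * t 0 + 2/3 * t 3 - 1/3 * t 5) * e0A23 + (-1/3 * t 1) * e0B23 + 2/3 *
      t 1 * e0A13 + (-2/3 * t 2) * e0A12 + (-1/3 * t 2) * e0B33 + 1/3 * t 4 * e0B12 + (-2/3 * t 4)
      * e0A22 + (-1/3 * t 0 + 1/3 * t 5) * e1A13 + (-1/3 * t 1) * e1A23 + 1/3 * t 4 * e1A12 + 5/9
      * t 1 * h0 + (-2/3 * t 4) * h1 + (-1/9 * t 0 + 2/9 * t 3 - 1/9 * t 5) * h3 + (-4/9 * t 2) *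
      h4
  · linear_combination (-2/3 * t 2) * e1B23 + 2/3 * t 4 * e1A23 + (-4/9 * t 4) * h0
  · linear_combination 1/3 * t 1 * e0A23 + (-1/3 * t 2) * e0B12 + (1/3 * t 3 - 1/3 * t 5) * e0B23
      + (-1/3 * t 4) * e0B22 + 1/3 * t 4 * e0B33 + (-2/3 * t 0 + 1/3 * t 3 + 1/3 * t 5) * e1A23 +
      (-2/3 * t 1) * e1B23 + 1/3 * t 1 * e1A13 + (-1/3 * t 2) * e1A12 + (-1/3 * t 4) * e1A22 +
      (-2/9 * t 0 + 1/9 * t 3 + 1/9 * t 5) * h0 + (-4/9 * t 2) * h2 + (-5/9 * t 1) * h3 + 4/9 * t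
      4 * h4
  · linear_combination 2/3 * t 1 * e0B12 + (-2/3 * t 1) * e0A22 + (-2/3 * t 2) * e0A23 + (2/3 * t
      3 - 2/3 * t 5) * e0A12 + (2/3 * t 3 - 2/3 * t 5) * e0B33 + (-2/3 * t 4) * e0B23 + 2/3 * t 4
      * e0A13 + 2/3 * t 4 * e0C33 + (2/3 * t 0 - 2/3 * t 5) * e1A22 + (-2/3 * t 1) * e1A12 + 2/3 *
      t 4 * e1A23 + (-2/3 * t 2) * e1C33 + (-2/9 * t 4) * h0 + 2/9 * t 1 * h1 + 4/9 * t 1 * h2 +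
      4/9 * t 2 * h3 + (4/9 * t 0 - 4/9 * t 3) * h4
  · linear_combination (-2/3 * t 0 + 2/3 * t 5) * e0A13 + (-2/3 * t 1) * e0A23 + 2/3 * t 4 * e0A12
      + 4/9 * t 1 * h3
  · linear_combination (-1/3 * t 0 - 1/3 * t 3 + 2/3 * t 5) * e0A23 + (-1/3 * t 1) * e0B23 + 1/3 *
      t 4 * e0B12 + (-1/3 * t 2) * e0B33 + (-1/3 * t 1) * e0A13 + 1/3 * t 2 * e0A12 + 1/3 * t 4 *
      e0A22 + (-2/9 * t 1) * h0 + 1/3 * t 4 * h1 + (-1/9 * t 0 - 1/9 * t 3 + 2/9 * t 5) * h3 + 1/3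
      * t 2 * h4
  · linear_combination (-1/3 * t 0 + 1/3 * t 5) * e0B12 + (1/3 * t 0 - 1/3 * t 5) * e0A22 + (-1/3
      * t 1) * e0A12 + (-1/3 * t 1) * e0B33 + 1/3 * t 4 * e0A23 + (-1/3 * t 2) * e0C33 + (1/3 * t
      0 - 1/3 * t 5) * h1 + 1/9 * t 4 * h3 + (-1/3 * t 1) * h4
  · linear_combination (-2/3 * t 1) * e0A23 + 2/3 * t 2 * e0B12 + (-2/3 * t 3 + 2/3 * t 5) * e0B23
      + 2/3 * t 4 * e0B22 + (-2/3 * t 4) * e0B33 + (2/3 * t 0 - 2/3 * t 5) * h0 + 2/3 * t 2 * h2 +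
      4/9 * t 1 * h3 + (-2/9 * t 4) * h4
  · linear_combination (-1/3 * t 1) * e0B12 + 1/3 * t 1 * e0A22 + 1/3 * t 2 * e0A23 + (-1/3 * t 3
      + 1/3 * t 5) * e0A12 + (-1/3 * t 3 + 1/3 * t 5) * e0B33 + 1/3 * t 4 * e0B23 + (-1/3 * t 4) *
      e0A13 + (-1/3 * t 4) * e0C33 + 2/9 * t 4 * h0 + 1/9 * t 1 * h1 + (-2/9 * t 1) * h2 + (-1/3 *
      t 2) * h3 + (-4/9 * t 0 + 1/9 * t 3 + 1/3 * t 5) * h4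
  · linear_combination 2/9 * t 1 * h3 + (-2/9 * t 4) * h4
  · linear_combination (-2/3 * t 0 + 2/3 * t 5) * e1A13 + (-2/3 * t 1) * e1A23 + 2/3 * t 4 * e1A12
      + 2/9 * t 1 * h0 + (-2/3 * t 4) * h1 + (2/3 * t 3 - 2/3 * t 5) * h3 + (-2/9 * t 2) * h4
  · linear_combination (-1/3 * t 0 - 1/3 * t 3 + 2/3 * t 5) * e1A23 + (-1/3 * t 1) * e1B23 + (-1/3
      * t 1) * e1A13 + 1/3 * t 2 * e1A12 + 1/3 * t 4 * e1A22 + (-1/9 * t 0 - 1/9 * t 3 + 2/9 * t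
      5) * h0 + (-2/9 * t 2) * h2 + (-1/3 * t 1) * h3 + 1/3 * t 4 * h4
  · linear_combination (1/3 * t 0 - 1/3 * t 5) * e1A22 + (-1/3 * t 1) * e1A12 + 1/3 * t 4 * e1A23
      + (-1/3 * t 2) * e1C33 + (-5/9 * t 4) * h0 + 2/9 * t 1 * h1 + 2/9 * t 2 * h3 + (1/9 * t 0 -
      4/9 * t 3 + 1/3 * t 5) * h4
  · linear_combination (-2/3 * t 1) * e1A23 + (-2/3 * t 3 + 2/3 * t 5) * e1B23 + 4/9 * t 1 * h0 +
      2/9 * t 4 * h2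
  · linear_combination 1/3 * t 1 * e1A22 + 1/3 * t 2 * e1A23 + (-1/3 * t 3 + 1/3 * t 5) * e1A12 +
      1/3 * t 4 * e1B23 + (-1/3 * t 4) * e1A13 + (-1/3 * t 4) * e1C33 + 1/9 * t 2 * h0 + (-2/9 * t
      3 + 2/9 * t 5) * h2 + 1/9 * t 4 * h3 + (-1/3 * t 1) * h4
  · linear_combination (-4/9 * t 4) * h1 + (-4/9 * t 4) * h2 + (2/9 * t 3 - 2/9 * t 5) * h3 +
      (-2/9 * t 2) * h4

/-- The way in which rank one is used: a row proportional to `r` that has a zero at a place where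
`r` does not must vanish entirely. -/
theorem eq_zero_of_eq_mul {ρ r : Fin 6 → ℂ} (h : ∃ s, ∀ n, ρ n = s * r n) {n : Fin 6}
    (hr : r n ≠ 0) (h0 : ρ n = 0) (m : Fin 6) : ρ m = 0 := by
  obtain ⟨s, hs⟩ := h
  rw [hs n] at h0
  rw [hs m, (mul_eq_zero.1 h0).resolve_right hr, zero_mul]

/-- The vanishing of the quantities that occur in the integrability conditions. -/
structure DefectVanishes (ε : Fin 3 → Label → ℂ) (Q : Fin 6 → ℂ) : Prop where
  e0A33 : ε 0 A33 = 0
  e1A33 : ε 1 A33 = 0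
  e1B12 : ε 1 B12 = 0
  e1B22 : ε 1 B22 = 0
  e1B33 : ε 1 B33 = 0
  e2A12 : ε 2 A12 = 0
  e2A13 : ε 2 A13 = 0
  e2A22 : ε 2 A22 = 0
  e2A23 : ε 2 A23 = 0
  e2A33 : ε 2 A33 = 0
  e2B12 : ε 2 B12 = 0
  e2B22 : ε 2 B22 = 0
  e2B23 : ε 2 B23 = 0
  e2B33 : ε 2 B33 = 0
  e2C33 : ε 2 C33 = 0
  q0 : Q 0 = 0
  q1 : Q 1 = 0
  q2 : Q 2 = 0
  q3 : Q 3 = 0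
  q4 : Q 4 = 0

/-! ### Case distinction on a nonzero entry of the annihilating form -/

section Cases

variable {ε : Fin 3 → Label → ℂ} {Q r : Fin 6 → ℂ}

/-- Some rows have a zero in column 5 by their shape and therefore vanish. Their entries yield zeros
in column 5 of further rows, until enough linear equations are available to determine everything.
The other cases work alike, with extra equations from columns where `r` is zero. -/
theorem defectVanishes_of_five (h : ∀ p n, ∃ s, ∀ m, defectRow ε Q p n m = s * r m) (hr : r 5 ≠ 0)
    :
    DefectVanishes ε Q := by
  have Z00 := eq_zero_of_eq_mul (h 0 0) hr (rfl)
  have z000 : 2/3 * ε 1 A33 - 2/3 * ε 2 A23 + 2/3 * Q 4 = 0 := Z00 0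
  have z001 : -2/3 * ε 0 A33 + 2/3 * ε 1 B33 + 2/3 * ε 2 A13 - 2/3 * ε 2 B23 + 4/9 * Q 1 + 2/9 * Q
      2 = 0 := Z00 1
  have z002 : -2/3 * ε 2 A12 + 10/9 * Q 3 = 0 := Z00 2
  have z004 : -2/3 * ε 2 A22 + 2/3 * ε 2 B12 - 4/3 * Q 0 = 0 := Z00 4
  have Z01 := eq_zero_of_eq_mul (h 0 1) hr (rfl)
  have z010 : 2/3 * ε 1 B33 - 2/3 * ε 2 B23 - 1/3 * Q 1 + 5/9 * Q 2 = 0 := Z01 0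
  have z011 : -2/3 * ε 1 A33 - 2/3 * ε 1 B12 + 2/3 * ε 2 A23 - 2/3 * Q 4 = 0 := Z01 1
  have z012 : -2/3 * ε 2 B12 + 2/9 * Q 0 = 0 := Z01 2
  have z014 : 2/3 * ε 2 A12 - 2/9 * Q 3 = 0 := Z01 4
  have Z05 := eq_zero_of_eq_mul (h 0 5) hr (rfl)
  have z050 : -2/3 * ε 2 A23 - 2/9 * Q 4 = 0 := Z05 0
  have z051 : 2/3 * ε 2 A13 - 2/3 * ε 2 B23 = 0 := Z05 1
  have z052 : -2/3 * ε 2 A12 - 2/3 * ε 2 B33 - 2/9 * Q 3 = 0 := Z05 2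
  have z054 : -2/3 * ε 2 A22 + 2/3 * ε 2 A33 + 2/3 * ε 2 B12 + 4/9 * Q 0 = 0 := Z05 4
  have Z03 := eq_zero_of_eq_mul (h 0 3) hr (rfl)
  have z031 : -2/3 * ε 1 B22 = 0 := Z03 1
  have z032 : -2/3 * ε 2 A12 - 2/3 * ε 2 B22 + 14/9 * Q 3 = 0 := Z03 2
  have z034 : 2/3 * ε 2 B12 - 10/9 * Q 0 = 0 := Z03 4
  -- From here on the entry in the pivot column is a combination of entries already known to vanish.
  have Z10 := eq_zero_of_eq_mul (h 1 0) hr (show -2/3 * ε 2 A22 + 2/3 * ε 2 B12 - 4/3 * Q 0 = 0 by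
      linear_combination z004)
  have z102 : -2/3 * ε 0 A33 = 0 := Z10 2
  have Z23 := eq_zero_of_eq_mul (h 2 3) hr (show 2/3 * ε 2 A12 + 2/3 * ε 2 B22 - 14/9 * Q 3 = 0 by
      linear_combination -z032)
  have z234 : 2/3 * ε 1 B22 - 2/3 * ε 1 B33 + 2/9 * Q 2 = 0 := Z23 4
  have Z02 := eq_zero_of_eq_mul (h 0 2) hr (show 2/9 * Q 3 = 0 by linear_combination 1/4 * z002 +
      1/4 * z014)
  have z022 : -2/3 * ε 2 A23 - 4/9 * Q 4 = 0 := Z02 2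
  have z024 : 2/3 * ε 2 A13 + 1/9 * Q 1 - 1/3 * Q 2 = 0 := Z02 4
  have Z15 := eq_zero_of_eq_mul (h 1 5) hr (show -2/3 * ε 2 A22 + 2/3 * ε 2 A33 + 2/3 * ε 2 B12 =
      0 by linear_combination z054 + 1/2 * z012 + 1/2 * z034)
  have z152 : -2/3 * ε 2 C33 = 0 := Z15 2
  constructor
  · linear_combination -3/2 * z102
  · linear_combination 3/2 * z000 - 15/2 * z050 + 6 * z022
  · linear_combination -3/2 * z000 - 3/2 * z011
  · linear_combination -3/2 * z031
  · linear_combination 1/4 * z001 - 3/4 * z031 + 1/2 * z010 - 3/4 * z051 - 1/4 * z102 - 3/4 * z234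
      + 1/2 * z024
  · linear_combination 3/8 * z002 + 15/8 * z014
  · linear_combination 1/8 * z001 + 9/8 * z031 + z010 - 9/8 * z051 - 1/8 * z102 + 9/8 * z234 + 5/2
      * z024
  · linear_combination -3/2 * z004 + 3/8 * z012 + 15/8 * z034
  · linear_combination -3 * z050 + 3/2 * z022
  · linear_combination -3/2 * z004 + 3/2 * z054 + 3 * z012 + 3 * z034
  · linear_combination -15/8 * z012 - 3/8 * z034
  · linear_combination 9/4 * z002 - 3/2 * z032 + 3/4 * z014
  · linear_combination 1/8 * z001 + 9/8 * z031 + z010 - 21/8 * z051 - 1/8 * z102 + 9/8 * z234 +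
      5/2 * z024
  · linear_combination -3/4 * z002 - 3/2 * z052 - 9/4 * z014
  · linear_combination -3/2 * z152
  · linear_combination -9/8 * z012 - 9/8 * z034
  · linear_combination 3/2 * z001 - 3/2 * z010 - 3/2 * z102 - 3/2 * z024
  · linear_combination 3/4 * z001 + 9/4 * z031 + 3/2 * z010 - 9/4 * z051 - 3/4 * z102 + 9/4 * z234
      + 3/2 * z024
  · linear_combination 9/8 * z002 + 9/8 * z014
  · linear_combination 9/2 * z050 - 9/2 * z022

theorem defectVanishes_of_three (h : ∀ p n, ∃ s, ∀ m, defectRow ε Q p n m = s * r m) (hr : r 3 ≠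
    0) (hz5 : ∀ p n, defectRow ε Q p n 5 = 0) :
    DefectVanishes ε Q := by
  have z025 : 2/9 * Q 3 = 0 := hz5 0 2
  have z045 : -2/9 * Q 0 = 0 := hz5 0 4
  have z105 : -2/3 * ε 2 A22 + 2/3 * ε 2 B12 - 4/3 * Q 0 = 0 := hz5 1 0
  have z115 : 2/3 * ε 2 A12 - 4/9 * Q 3 = 0 := hz5 1 1
  have z125 : 2/3 * ε 2 A13 - 1/9 * Q 1 - 1/3 * Q 2 = 0 := hz5 1 2
  have z135 : 2/3 * ε 2 B12 - 2/3 * Q 0 = 0 := hz5 1 3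
  have z145 : 2/3 * ε 2 A23 + 2/3 * Q 4 = 0 := hz5 1 4
  have z155 : -2/3 * ε 2 A22 + 2/3 * ε 2 A33 + 2/3 * ε 2 B12 = 0 := hz5 1 5
  have z235 : 2/3 * ε 2 A12 + 2/3 * ε 2 B22 - 14/9 * Q 3 = 0 := hz5 2 3
  have z245 : 2/3 * ε 2 B23 + 1/3 * Q 1 + 1/9 * Q 2 = 0 := hz5 2 4
  have z255 : 2/3 * ε 2 A12 + 2/3 * ε 2 B33 - 2/9 * Q 3 = 0 := hz5 2 5
  have Z10 := eq_zero_of_eq_mul (h 1 0) hr (rfl)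
  have z102 : -2/3 * ε 0 A33 = 0 := Z10 2
  have z104 : -2/3 * ε 1 A33 + 2/3 * ε 2 A23 - 2/3 * Q 4 = 0 := Z10 4
  have Z13 := eq_zero_of_eq_mul (h 1 3) hr (rfl)
  have z132 : -2/3 * ε 1 B33 - 2/9 * Q 2 = 0 := Z13 2
  have z134 : 2/3 * ε 1 B12 + 4/9 * Q 4 = 0 := Z13 4
  have Z15 := eq_zero_of_eq_mul (h 1 5) hr (rfl)
  have z152 : -2/3 * ε 2 C33 = 0 := Z15 2
  have z154 : 2/3 * ε 2 A23 - 2/9 * Q 4 = 0 := Z15 4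
  have Z00 := eq_zero_of_eq_mul (h 0 0) hr (show -2/3 * ε 1 A33 + 2/3 * ε 2 A23 - 2/3 * Q 4 = 0 by
      linear_combination z104)
  have z001 : -2/3 * ε 0 A33 + 2/3 * ε 1 B33 + 2/3 * ε 2 A13 - 2/3 * ε 2 B23 + 4/9 * Q 1 + 2/9 * Q
      2 = 0 := Z00 1
  have Z02 := eq_zero_of_eq_mul (h 0 2) hr (show 2/3 * ε 2 A12 - 4/9 * Q 3 = 0 by
      linear_combination z115)
  have z024 : 2/3 * ε 2 A13 + 1/9 * Q 1 - 1/3 * Q 2 = 0 := Z02 4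
  have Z23 := eq_zero_of_eq_mul (h 2 3) hr (show -2/3 * ε 2 A12 - 2/3 * ε 2 B22 + 14/9 * Q 3 = 0
      by linear_combination -z235)
  have z234 : 2/3 * ε 1 B22 - 2/3 * ε 1 B33 + 2/9 * Q 2 = 0 := Z23 4
  constructor
  · linear_combination -3/2 * z102
  · linear_combination -3/2 * z104 - 3/4 * z145 + 9/4 * z154
  · linear_combination 3/2 * z134 - 3/4 * z145 + 3/4 * z154
  · linear_combination 3/2 * z102 + 3/2 * z234 - 3 * z132 - 9/2 * z125 - 3/2 * z245 - 3/2 * z001 +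
      6 * z024
  · linear_combination 3/4 * z102 - 9/4 * z132 - 9/4 * z125 - 3/4 * z245 - 3/4 * z001 + 3 * z024
  · linear_combination 3/2 * z115 + 3 * z025
  · linear_combination -9/8 * z102 + 9/8 * z132 + 33/8 * z125 + 9/8 * z245 + 9/8 * z001 - 15/4 *
      z024
  · linear_combination -3/2 * z105 + 3/2 * z135 + 9/2 * z045
  · linear_combination 3/8 * z145 + 9/8 * z154
  · linear_combination -3/2 * z105 + 3/2 * z155 + 9 * z045
  · linear_combination 3/2 * z135 - 9/2 * z045
  · linear_combination -3/2 * z115 + 3/2 * z235 + 15/2 * z025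
  · linear_combination 3/8 * z102 - 3/8 * z132 + 9/8 * z125 + 9/8 * z245 - 3/8 * z001 - 3/4 * z024
  · linear_combination -3/2 * z115 + 3/2 * z255 - 3/2 * z025
  · linear_combination -3/2 * z152
  · linear_combination -9/2 * z045
  · linear_combination -9/2 * z125 + 9/2 * z024
  · linear_combination -9/4 * z102 + 9/4 * z132 + 27/4 * z125 + 9/4 * z245 + 9/4 * z001 - 9 * z024
  · linear_combination 9/2 * z025
  · linear_combination 9/8 * z145 - 9/8 * z154

theorem defectVanishes_of_one (h : ∀ p n, ∃ s, ∀ m, defectRow ε Q p n m = s * r m) (hr : r 1 ≠ 0)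
    (hz0 : ∀ p n, defectRow ε Q p n 0 = 0) (hz3 : ∀ p n, defectRow ε Q p n 3 = 0) :
    DefectVanishes ε Q := by
  have z000 : 2/3 * ε 1 A33 - 2/3 * ε 2 A23 + 2/3 * Q 4 = 0 := hz0 0 0
  have z010 : 2/3 * ε 1 B33 - 2/3 * ε 2 B23 - 1/3 * Q 1 + 5/9 * Q 2 = 0 := hz0 0 1
  have z020 : -2/3 * ε 2 A12 + 2/9 * Q 3 = 0 := hz0 0 2
  have z023 : 2/3 * ε 2 A12 - 4/9 * Q 3 = 0 := hz3 0 2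
  have z030 : -2/3 * ε 1 B12 = 0 := hz0 0 3
  have z040 : -2/3 * ε 2 B12 + 4/9 * Q 0 = 0 := hz0 0 4
  have z043 : 2/3 * ε 2 B12 - 2/9 * Q 0 = 0 := hz3 0 4
  have z050 : -2/3 * ε 2 A23 - 2/9 * Q 4 = 0 := hz0 0 5
  have z100 : 2/3 * ε 2 A22 - 2/3 * ε 2 B12 + 4/3 * Q 0 = 0 := hz0 1 0
  have z120 : -2/3 * ε 2 A13 + 1/9 * Q 1 + 1/3 * Q 2 = 0 := hz0 1 2
  have z140 : -2/3 * ε 2 A23 - 4/9 * Q 4 = 0 := hz0 1 4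
  have z150 : 2/3 * ε 2 A22 - 2/3 * ε 2 A33 - 2/3 * ε 2 B12 = 0 := hz0 1 5
  have z233 : -2/3 * ε 2 A12 - 2/3 * ε 2 B22 + 14/9 * Q 3 = 0 := hz3 2 3
  have z243 : -2/3 * ε 2 B23 - 1/3 * Q 1 - 1/9 * Q 2 = 0 := hz3 2 4
  have z253 : -2/3 * ε 2 A12 - 2/3 * ε 2 B33 + 2/9 * Q 3 = 0 := hz3 2 5
  have Z11 := eq_zero_of_eq_mul (h 1 1) hr (show -2/3 * ε 2 B12 + 4/9 * Q 0 = 0 by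
      linear_combination z040)
  have z114 : -2/3 * ε 1 B33 + 2/3 * ε 2 B23 + 1/9 * Q 1 - 5/9 * Q 2 = 0 := Z11 4
  have Z15 := eq_zero_of_eq_mul (h 1 5) hr (show -2/3 * ε 2 A12 - 2/3 * ε 2 B33 + 2/9 * Q 3 = 0 by
      linear_combination z253)
  have z152 : -2/3 * ε 2 C33 = 0 := Z15 2
  have Z21 := eq_zero_of_eq_mul (h 2 1) hr (show -2/3 * ε 2 A12 + 4/9 * Q 3 = 0 by
      linear_combination -z023)
  have z212 : -2/3 * ε 1 B33 + 2/3 * ε 2 B23 + 1/3 * Q 1 - 1/3 * Q 2 = 0 := Z21 2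
  have Z10 := eq_zero_of_eq_mul (h 1 0) hr (show -2/3 * ε 2 A12 + 10/9 * Q 3 = 0 by
      linear_combination -3 * z020 - 4 * z023)
  have z102 : -2/3 * ε 0 A33 = 0 := Z10 2
  have Z23 := eq_zero_of_eq_mul (h 2 3) hr (show -2/3 * ε 2 B12 + 10/9 * Q 0 = 0 by
      linear_combination 4 * z040 + 3 * z043)
  have z234 : 2/3 * ε 1 B22 - 2/3 * ε 1 B33 + 2/9 * Q 2 = 0 := Z23 4
  constructor
  · linear_combination -3/2 * z102
  · linear_combination 3/2 * z000 - 15/2 * z050 + 6 * z140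
  · linear_combination -3/2 * z030
  · linear_combination 3/2 * z234 - 9/2 * z010 - 3/2 * z243 - 6 * z212
  · linear_combination -3 * z010 - 3/2 * z243 - 9/2 * z212
  · linear_combination -3 * z020 - 3/2 * z023
  · linear_combination 3/2 * z010 - 3/2 * z120 - 3/4 * z114 + 9/4 * z212
  · linear_combination 3/2 * z100 - 15/2 * z040 - 6 * z043
  · linear_combination -3 * z050 + 3/2 * z140
  · linear_combination 3/2 * z100 - 3/2 * z150 - 9 * z040 - 9 * z043
  · linear_combination 3/2 * z040 + 3 * z043
  · linear_combination -15/2 * z020 - 3/2 * z233 - 9 * z023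
  · linear_combination 3/2 * z010 - 3/2 * z243 + 9/4 * z114 - 3/4 * z212
  · linear_combination 3/2 * z020 - 3/2 * z253
  · linear_combination -3/2 * z152
  · linear_combination 9/2 * z040 + 9/2 * z043
  · linear_combination -9/2 * z010 - 9/2 * z114
  · linear_combination 9/2 * z010 + 9/2 * z212
  · linear_combination -9/2 * z020 - 9/2 * z023
  · linear_combination 9/2 * z050 - 9/2 * z140

theorem defectVanishes_of_two (h : ∀ p n, ∃ s, ∀ m, defectRow ε Q p n m = s * r m) (hr : r 2 ≠ 0)
    (hz0 : ∀ p n, defectRow ε Q p n 0 = 0) (hz1 : ∀ p n, defectRow ε Q p n 1 = 0) (hz3 : ∀ p n,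
    defectRow ε Q p n 3 = 0) :
    DefectVanishes ε Q := by
  have z000 : 2/3 * ε 1 A33 - 2/3 * ε 2 A23 + 2/3 * Q 4 = 0 := hz0 0 0
  have z001 : -2/3 * ε 0 A33 + 2/3 * ε 1 B33 + 2/3 * ε 2 A13 - 2/3 * ε 2 B23 + 4/9 * Q 1 + 2/9 * Q
      2 = 0 := hz1 0 0
  have z010 : 2/3 * ε 1 B33 - 2/3 * ε 2 B23 - 1/3 * Q 1 + 5/9 * Q 2 = 0 := hz0 0 1
  have z011 : -2/3 * ε 1 A33 - 2/3 * ε 1 B12 + 2/3 * ε 2 A23 - 2/3 * Q 4 = 0 := hz1 0 1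
  have z020 : -2/3 * ε 2 A12 + 2/9 * Q 3 = 0 := hz0 0 2
  have z021 : -2/3 * ε 2 A22 - 4/9 * Q 0 = 0 := hz1 0 2
  have z023 : 2/3 * ε 2 A12 - 4/9 * Q 3 = 0 := hz3 0 2
  have z031 : -2/3 * ε 1 B22 = 0 := hz1 0 3
  have z040 : -2/3 * ε 2 B12 + 4/9 * Q 0 = 0 := hz0 0 4
  have z041 : -2/3 * ε 2 B22 + 2/3 * Q 3 = 0 := hz1 0 4
  have z043 : 2/3 * ε 2 B12 - 2/9 * Q 0 = 0 := hz3 0 4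
  have z050 : -2/3 * ε 2 A23 - 2/9 * Q 4 = 0 := hz0 0 5
  have z051 : 2/3 * ε 2 A13 - 2/3 * ε 2 B23 = 0 := hz1 0 5
  have z120 : -2/3 * ε 2 A13 + 1/9 * Q 1 + 1/3 * Q 2 = 0 := hz0 1 2
  have z121 : -2/3 * ε 2 A23 - 2/3 * Q 4 = 0 := hz1 1 2
  have z141 : -2/3 * ε 2 B23 - 1/9 * Q 1 + 1/9 * Q 2 = 0 := hz1 1 4
  have z150 : 2/3 * ε 2 A22 - 2/3 * ε 2 A33 - 2/3 * ε 2 B12 = 0 := hz0 1 5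
  have z151 : -2/3 * ε 2 A12 - 2/3 * ε 2 B33 + 2/9 * Q 3 = 0 := hz1 1 5
  have Z02 := eq_zero_of_eq_mul (h 0 2) hr (show -2/3 * ε 2 A23 - 4/9 * Q 4 = 0 by
      linear_combination 1/2 * z050 + 1/2 * z121)
  have z024 : 2/3 * ε 2 A13 + 1/9 * Q 1 - 1/3 * Q 2 = 0 := Z02 4
  have Z25 := eq_zero_of_eq_mul (h 2 5) hr (show 2/3 * ε 2 A23 - 2/9 * Q 4 = 0 by
      linear_combination -2 * z050 + z121)
  have z254 : -2/3 * ε 2 A13 + 2/3 * ε 2 B23 - 2/3 * ε 2 C33 - 4/9 * Q 1 - 4/9 * Q 2 = 0 := Z25 4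
  constructor
  · linear_combination -3/2 * z001 + 3/2 * z010 + 9/2 * z120 + 6 * z024
  · linear_combination 3/2 * z000 - 9/2 * z050 + 3 * z121
  · linear_combination -3/2 * z000 - 3/2 * z011
  · linear_combination -3/2 * z031
  · linear_combination 3/2 * z010 - 3 * z051 + 3/2 * z120 + 3/2 * z141 + 9/2 * z024
  · linear_combination -3 * z020 - 3/2 * z023
  · linear_combination 9/4 * z051 - 3/4 * z120 - 9/4 * z141 - 3/2 * z024
  · linear_combination -3/2 * z021 - 3 * z040 - 3 * z043
  · linear_combination -9/4 * z050 + 3/4 * z121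
  · linear_combination -3/2 * z021 - 3/2 * z150 - 9/2 * z040 - 6 * z043
  · linear_combination 3/2 * z040 + 3 * z043
  · linear_combination -9/2 * z020 - 3/2 * z041 - 9/2 * z023
  · linear_combination 3/4 * z051 - 3/4 * z120 - 9/4 * z141 - 3/2 * z024
  · linear_combination 3/2 * z020 - 3/2 * z151
  · linear_combination -9/2 * z051 - 3 * z120 - 3/2 * z254 + 3 * z141
  · linear_combination 9/2 * z040 + 9/2 * z043
  · linear_combination 9/2 * z120 + 9/2 * z024
  · linear_combination 9/2 * z051 - 9/2 * z141 - 9/2 * z024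
  · linear_combination -9/2 * z020 - 9/2 * z023
  · linear_combination 9/4 * z050 - 9/4 * z121

/-- No pivot is left, and none is needed: the entries of the first three columns already determine
all unknowns. -/
theorem defectVanishes_of_zero (hz0 : ∀ p n, defectRow ε Q p n 0 = 0) (hz1 : ∀ p n, defectRow ε Q
    p n 1 = 0) (hz2 : ∀ p n, defectRow ε Q p n 2 = 0) :
    DefectVanishes ε Q := by
  have z000 : 2/3 * ε 1 A33 - 2/3 * ε 2 A23 + 2/3 * Q 4 = 0 := hz0 0 0
  have z001 : -2/3 * ε 0 A33 + 2/3 * ε 1 B33 + 2/3 * ε 2 A13 - 2/3 * ε 2 B23 + 4/9 * Q 1 + 2/9 * Q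
      2 = 0 := hz1 0 0
  have z002 : -2/3 * ε 2 A12 + 10/9 * Q 3 = 0 := hz2 0 0
  have z010 : 2/3 * ε 1 B33 - 2/3 * ε 2 B23 - 1/3 * Q 1 + 5/9 * Q 2 = 0 := hz0 0 1
  have z011 : -2/3 * ε 1 A33 - 2/3 * ε 1 B12 + 2/3 * ε 2 A23 - 2/3 * Q 4 = 0 := hz1 0 1
  have z012 : -2/3 * ε 2 B12 + 2/9 * Q 0 = 0 := hz2 0 1
  have z020 : -2/3 * ε 2 A12 + 2/9 * Q 3 = 0 := hz0 0 2
  have z021 : -2/3 * ε 2 A22 - 4/9 * Q 0 = 0 := hz1 0 2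
  have z022 : -2/3 * ε 2 A23 - 4/9 * Q 4 = 0 := hz2 0 2
  have z031 : -2/3 * ε 1 B22 = 0 := hz1 0 3
  have z032 : -2/3 * ε 2 A12 - 2/3 * ε 2 B22 + 14/9 * Q 3 = 0 := hz2 0 3
  have z040 : -2/3 * ε 2 B12 + 4/9 * Q 0 = 0 := hz0 0 4
  have z042 : -2/3 * ε 2 B23 - 1/3 * Q 1 + 1/9 * Q 2 = 0 := hz2 0 4
  have z050 : -2/3 * ε 2 A23 - 2/9 * Q 4 = 0 := hz0 0 5
  have z051 : 2/3 * ε 2 A13 - 2/3 * ε 2 B23 = 0 := hz1 0 5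
  have z052 : -2/3 * ε 2 A12 - 2/3 * ε 2 B33 - 2/9 * Q 3 = 0 := hz2 0 5
  have z102 : -2/3 * ε 0 A33 = 0 := hz2 1 0
  have z120 : -2/3 * ε 2 A13 + 1/9 * Q 1 + 1/3 * Q 2 = 0 := hz0 1 2
  have z122 : -2/3 * ε 2 A33 - 4/3 * Q 0 = 0 := hz2 1 2
  have z152 : -2/3 * ε 2 C33 = 0 := hz2 1 5
  constructor
  · linear_combination -3/2 * z102
  · linear_combination 3/2 * z000 + 6 * z022 - 15/2 * z050
  · linear_combination -3/2 * z000 - 3/2 * z011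
  · linear_combination -3/2 * z031
  · linear_combination 3/2 * z001 - 3 * z051 + 3/2 * z042 - 3/2 * z102 - 3/2 * z120
  · linear_combination 3/8 * z002 - 15/8 * z020
  · linear_combination -15/16 * z001 + 15/16 * z010 + 9/4 * z051 - 9/4 * z042 + 15/16 * z102 -
      3/16 * z120
  · linear_combination -3/2 * z021 + 3 * z012 - 3 * z040
  · linear_combination 3/2 * z022 - 3 * z050
  · linear_combination -3/2 * z122 + 9 * z012 - 9 * z040
  · linear_combination -3 * z012 + 3/2 * z040
  · linear_combination 9/4 * z002 - 3/2 * z032 - 3/4 * z020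
  · linear_combination -15/16 * z001 + 15/16 * z010 + 3/4 * z051 - 9/4 * z042 + 15/16 * z102 -
      3/16 * z120
  · linear_combination -3/4 * z002 - 3/2 * z052 + 9/4 * z020
  · linear_combination -3/2 * z152
  · linear_combination -9/2 * z012 + 9/2 * z040
  · linear_combination 9/8 * z001 - 9/8 * z010 - 9/8 * z102 + 9/8 * z120
  · linear_combination -9/4 * z001 + 9/4 * z010 + 9/2 * z051 - 9/2 * z042 + 9/4 * z102 + 9/4 *
      z120
  · linear_combination 9/8 * z002 - 9/8 * z020
  · linear_combination -9/2 * z022 + 9/2 * z050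

end Cases

/-- If the integrability conditions have rank at most one, then all the defects vanish. -/
theorem defectVanishes {ε : Fin 3 → Label → ℂ} {Q r : Fin 6 → ℂ} (htr : r 0 + r 3 + r 5 = 0)
    (h : ∀ p n, ∃ s, ∀ m, defectRow ε Q p n m = s * r m) : DefectVanishes ε Q := by
  have hz : ∀ m, r m = 0 → ∀ p n, defectRow ε Q p n m = 0 := fun m hm p n => by
    obtain ⟨s, hs⟩ := h p n
    rw [hs, hm, mul_zero]
  by_cases h5 : r 5 = 0
  · by_cases h3 : r 3 = 0
    · have h0 : r 0 = 0 := by linear_combination htr - h3 - h5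
      by_cases h1 : r 1 = 0
      · by_cases h2 : r 2 = 0
        · exact defectVanishes_of_zero (hz 0 h0) (hz 1 h1) (hz 2 h2)
        · exact defectVanishes_of_two h h2 (hz 0 h0) (hz 1 h1) (hz 3 h3)
      · exact defectVanishes_of_one h h1 (hz 0 h0) (hz 3 h3)
    · exact defectVanishes_of_three h h3 (hz 5 h5)
  · exact defectVanishes_of_five h h5

/-- Five independent vectors span a hyperplane in dimension six, so by rank and nullity the linear
forms vanishing on them form a line. -/
theorem exists_annihilator {τ : Fin 5 → Fin 6 → ℂ} (hτ : LinearIndependent ℂ τ) :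
    ∃ r : Fin 6 → ℂ, (∀ h, ∑ n, τ h n * r n = 0) ∧
      ∀ ρ : Fin 6 → ℂ, (∀ h, ∑ n, τ h n * ρ n = 0) → ∃ s, ∀ n, ρ n = s * r n := by
  let L : (Fin 6 → ℂ) →ₗ[ℂ] (Fin 5 → ℂ) := (Matrix.of τ).mulVecLin
  have hL : ∀ ρ h, L ρ h = ∑ n, τ h n * ρ n := fun ρ h => rfl
  have hrank : Module.finrank ℂ (LinearMap.range L) = 5 := by
    have := hτ.rank_matrix (M := Matrix.of τ)
    simpa [Matrix.rank] using this
  have hker : Module.finrank ℂ (LinearMap.ker L) = 1 := by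
    have := L.finrank_range_add_finrank_ker
    rw [hrank, Module.finrank_fin_fun] at this
    omega
  obtain ⟨⟨r, hr⟩, -, hspan⟩ := finrank_eq_one_iff'.1 hker
  refine ⟨r, fun h => by rw [← hL, LinearMap.mem_ker.1 hr]; rfl, fun ρ hρ => ?_⟩
  obtain ⟨s, hs⟩ := hspan ⟨ρ, LinearMap.mem_ker.2 (funext fun h => hρ h)⟩
  refine ⟨s, fun n => ?_⟩
  exact (congrFun (congrArg Subtype.val hs) n).symm

/-- The integrability conditions force the derivative relations. -/
theorem eq_derivForm {d : Label → ℂ} {e : Fin 3 → Label → ℂ}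
    (hpot : ∀ s, ∃ T : Fin 3 → ℂ, ∀ i j k,
      (if i = j then T k else 0) + coef (e k) s i j + ∑ m, coef d m i j * coef d s m k
      = (if i = k then T j else 0) + coef (e j) s i k + ∑ m, coef d m i k * coef d s m j)
    {τ : Fin 5 → Fin 6 → ℂ} (hτ : LinearIndependent ℂ τ) (hτ0 : symForm (τ 0) = (1 : Matrix _ _ ℂ))
    (hcurv : ∀ h k l i j, curv (coef d) (fun l => coef (e l)) (symForm (τ h)) k l i j = 0)
    (l : Fin 3) (k : Label) : e l k = derivForm (1 / 6) d l k := by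
  -- Everything is rewritten in the deviation `ε` from the expected derivatives, which has to be
  -- shown to vanish.
  obtain ⟨ε, rfl⟩ : ∃ ε : Fin 3 → Label → ℂ, e = fun l k => derivForm (1 / 6) d l k + ε l k :=
    ⟨fun l k => e l k - derivForm (1 / 6) d l k, by funext l k; ring⟩
  have hrel := potentialRelations hpot
  obtain ⟨r, hr0, hr⟩ := exists_annihilator hτ
  have htr : r 0 + r 3 + r 5 = 0 := by
    have h1 := hr0 0
    have e : ∀ n, τ 0 n = (1 : Matrix (Fin 3) (Fin 3) ℂ) (symPair n).1 (symPair n).2 := fun n => by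
      rw [← hτ0, symForm, symIdx_symPair]
    rw [Fin.sum_univ_six] at h1
    simp only [e, symPair, Matrix.one_apply, Fin.isValue, Fin.reduceEq, if_true, if_false] at h1
    linear_combination h1
  -- Each row kills the five independent matrices `τ h` and is therefore a multiple of `r`.
  have hv := defectVanishes (ε := ε) (Q := fun m => eval d (quadric m)) htr fun p n =>
    hr _ fun h => by rw [← curv_eq_sum_defectRow (fun _ => rfl) hrel, hcurv]
  have h0 : ε l k = 0 := by
    obtain ⟨e0A33, e1A33, e1B12, e1B22, e1B33, e2A12, e2A13, e2A22, e2A23, e2A33, e2B12, e2B22,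
        e2B23, e2B33, e2C33, q0, q1, q2, q3, q4⟩ := hv
    obtain ⟨e0B23, e0A23, e0A12, e1A13, e1A22, e1A23, e0A13, e0A22, e1B23, e0B12, e0C33, e0B22,
        e0B33, e1C33, e1A12⟩ := hrel
    simp only [e0A33, e1A33, e1B12, e1B33, e2A12, e2A13, e2A22, e2A23, e2A33, e2B12, e2B22, e2B23,
        e2B33, q0, q1, q2, q3, q4, sub_zero, add_zero, mul_zero, neg_zero]
      at e0B23 e0A23 e0A12 e1A13 e1A22 e1A23 e0A13 e0A22 e1B23 e0B12 e0C33 e0B22 e0B33 e1C33 e1A12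
    rcases fin_three l with rfl | rfl | rfl <;> cases k <;> assumption
  simp only [h0, add_zero]

end Necessity

/-! ### Differential equations satisfied by a system, and uniqueness -/

section SystemEquations

open MvPolynomial

/-- The coefficients of an odd polynomial `ℓ - c` with `ℓ` linear and `c` cubic. -/
theorem eq_zero_of_linear_sub_cubic {b : Fin 3 → ℂ} {t : Fin 3 → Fin 3 → Fin 3 → ℂ}
    (ht : ∀ j i k, t j i k = t j k i)
    (h : ∀ p : Fin 3 → ℂ,
      2 * ∑ j, b j * p j - 2 * ∑ j, ∑ i, ∑ k, t j i k * p j * p i * p k = 0) :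
    (∀ j, b j = 0) ∧ ∀ i j k, t i j k + t j k i + t k i j = 0 := by
  -- Replacing `p` by `2 p` multiplies the linear part by 2 and the cubic part by 8, which separates
  -- them.
  have hl : ∀ p : Fin 3 → ℂ, ∑ j, b j * p j = 0 := fun p => by
    have h1 := h p
    have h2 := h fun i => 2 * p i
    have e1 : ∑ j, b j * (2 * p j) = 2 * ∑ j, b j * p j := by
      rw [Finset.mul_sum]
      exact Finset.sum_congr rfl fun j _ => by ring
    have e2 : ∑ j, ∑ i, ∑ k, t j i k * (2 * p j) * (2 * p i) * (2 * p k)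
        = 8 * ∑ j, ∑ i, ∑ k, t j i k * p j * p i * p k := by
      simp only [Finset.mul_sum]
      exact Finset.sum_congr rfl fun j _ => Finset.sum_congr rfl fun i _ =>
        Finset.sum_congr rfl fun k _ => by ring
    rw [e1, e2] at h2
    linear_combination (2 / 3) * h1 - (1 / 12) * h2
  have hc : ∀ p : Fin 3 → ℂ, ∑ j, ∑ i, ∑ k, t j i k * p j * p i * p k = 0 := fun p => by
    have h1 := h p
    rw [hl p] at h1
    linear_combination -(1 / 2) * h1
  refine ⟨fun j => by simpa [Pi.single_apply] using hl (Pi.single j 1), fun i j k => ?_⟩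
  -- Polarisation of the cubic form by inclusion and exclusion over the subsets of `{x, y, z}`.
  have hpol : ∀ x y z : Fin 3 → ℂ, ∑ j, ∑ i, ∑ k, t j i k * (x j * y i * z k + x j * z i * y k
      + y j * x i * z k + y j * z i * x k + z j * x i * y k + z j * y i * x k) = 0 := by
    intro x y z
    have h1 := hc (fun i => x i + y i + z i)
    have h2 := hc (fun i => x i + y i)
    have h3 := hc (fun i => x i + z i)
    have h4 := hc (fun i => y i + z i)
    have h5 := hc x
    have h6 := hc y
    have h7 := hc z
    have e : ∀ j i k, t j i k * (x j * y i * z k + x j * z i * y k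
        + y j * x i * z k + y j * z i * x k + z j * x i * y k + z j * y i * x k)
        = t j i k * (x j + y j + z j) * (x i + y i + z i) * (x k + y k + z k)
          - t j i k * (x j + y j) * (x i + y i) * (x k + y k)
          - t j i k * (x j + z j) * (x i + z i) * (x k + z k)
          - t j i k * (y j + z j) * (y i + z i) * (y k + z k)
          + t j i k * x j * x i * x k + t j i k * y j * y i * y k + t j i k * z j * z i * z k :=
      fun j i k => by ring
    simp only [e, Finset.sum_add_distrib, Finset.sum_sub_distrib, h1, h2, h3, h4, h5, h6, h7]
    ring
  have := hpol (Pi.single i 1) (Pi.single j 1) (Pi.single k 1)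
  have e : ∀ a b c : Fin 3, ∑ j, ∑ i, ∑ k, t j i k * ((Pi.single a 1 : Fin 3 → ℂ) j
      * (Pi.single b 1 : Fin 3 → ℂ) i * (Pi.single c 1 : Fin 3 → ℂ) k) = t a b c := fun a b c => by
    simp [Pi.single_apply]
  simp only [mul_add, Finset.sum_add_distrib, e] at this
  linear_combination (1 / 2) * this + (1 / 2) * ht i j k + (1 / 2) * ht j k i + (1 / 2) * ht k i j

theorem pd_formDeriv {κ : Fin 3 → Fin 3 → Fin 3 → Space → ℂ}
    {a : Space → Matrix (Fin 3) (Fin 3) ℂ} {x : Space}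
    (hκ : ∀ s i j, DifferentiableAt ℂ (κ s i j) x)
    (ha : ∀ i j, DifferentiableAt ℂ (fun y => a y i j) x) (l k i j : Fin 3) :
    pd l (fun y => formDeriv (fun s i j => κ s i j y) (a y) k i j) x
      = formDeriv (fun s i j => pd l (κ s i j) x) (a x) k i j
        + formDeriv (fun s i j => κ s i j x) (fun i j => pd l (fun y => a y i j) x) k i j := by
  have hd : ∀ i j s m n, DifferentiableAt ℂ (fun y => a y i j * κ s m n y) x :=
    fun i j s m n => (ha i j).fun_mul (hκ s m n)
  have hd' : ∀ i j m k, DifferentiableAt ℂ (fun y => a y k m * (κ j m i y + κ i m j y)) x :=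
    fun i j m k => (ha k m).fun_mul ((hκ j m i).fun_add (hκ i m j))
  simp only [formDeriv, smul_eq_mul]
  rw [pd_mul l (differentiableAt_const _) (DifferentiableAt.fun_sum fun m _ =>
      ((hd' i j m k).fun_sub (hd i m j m k)).fun_sub (hd j m i m k)), pd_const, zero_mul, zero_add,
    pd_sum _ _ fun m _ => ((hd' i j m k).fun_sub (hd i m j m k)).fun_sub (hd j m i m k),
    ← mul_add, ← Finset.sum_add_distrib]
  congr 1
  refine Finset.sum_congr rfl fun m _ => ?_
  rw [pd_sub l ((hd' i j m k).fun_sub (hd i m j m k)) (hd j m i m k),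
    pd_sub l (hd' i j m k) (hd i m j m k), pd_mul l (ha k m) ((hκ j m i).fun_add (hκ i m j)),
    pd_add l (hκ j m i) (hκ i m j), pd_mul l (ha i m) (hκ j m k), pd_mul l (ha j m) (hκ i m k)]
  ring

variable {K : Coefficients} {U : Set Space} {x : Space}

theorem IsSystemOn.differentiableAt (h : IsSystemOn K U) (hx : x ∈ U) (s i j : Fin 3) :
    DifferentiableAt ℂ (K s i j) x :=
  (h.analytic s i j x hx).differentiableAt

/-- The integrability conditions of the canonical equations for a potential. -/
theorem IsSystemOn.third_derivative_symm (h : IsSystemOn K U) (hx : x ∈ U) {V : Space → ℂ}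
    (hV : SolvesAt K V x) (i j k : Fin 3) :
    (if i = j then pd k (pd 0 (pd 0 V)) x else 0)
        + ∑ s, (pd k (K s i j) x * pd s V x + K s i j x * pd k (pd s V) x)
      = (if i = k then pd j (pd 0 (pd 0 V)) x else 0)
        + ∑ s, (pd j (K s i k) x * pd s V x + K s i k x * pd j (pd s V) x) := by
  rw [← hV.third_derivative (h.differentiableAt hx), ← hV.third_derivative (h.differentiableAt hx)]
  exact pd_comm k j (analyticAt_pd i hV.1)

/-- All coefficients of the canonical equations are linear combinations of the basic functions. -/
theorem IsSystemOn.eq_coef (h : IsSystemOn K U) (hx : x ∈ U) (s i j : Fin 3) :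
    K s i j x = coef (basic K x) s i j := by
  -- With zero gradient and `V_{11} = 1` the Hessian is the identity, and the derivatives of the
  -- coefficients drop out of the third derivatives. Their symmetry leaves linear relations between
  -- the coefficients, with the derivatives of `V_{11}` to be eliminated.
  obtain ⟨V, hV, -, hv, hw⟩ := (h.nondegenerate x hx 0 0 1).1
  have hh : ∀ i j, pd j (pd i V) x = if i = j then 1 else 0 := fun i j => by
    rw [hV.2.self_of_nhds i j, hw]
    simp [hv]
  have ht := h.third_derivative_symm hx hV
  simp only [hv, hh, Pi.zero_apply, mul_zero, zero_add, mul_ite, mul_one, Finset.sum_ite_eq',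
    Finset.mem_univ, if_true] at ht
  have hs := fun s i j => h.symm s i j x hx
  have hz := fun s => h.zero_zero s x hx
  have t1 := ht 0 0 1
  have t2 := ht 0 0 2
  have t3 := ht 1 1 0
  have t4 := ht 2 2 0
  have t5 := ht 0 1 2
  have t6 := ht 1 0 2
  have t7 := ht 1 1 2
  have t8 := ht 2 2 1
  simp only [Fin.isValue, Fin.reduceEq, if_true, if_false, hz, hs _ 1 0, hs _ 2 0, hs _ 2 1]
    at t1 t2 t3 t4 t5 t6 t7 t8
  rcases fin_three s with rfl | rfl | rfl <;> rcases fin_three i with rfl | rfl | rfl <;>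
    rcases fin_three j with rfl | rfl | rfl <;> dsimp only [coef, basic] <;>
    first
      | rfl
      | exact hz _
      | exact hs _ _ _
      | (try simp only [hs _ 1 0, hs _ 2 0, hs _ 2 1]
         first
          | linear_combination t6
          | linear_combination t6 - t5
          | linear_combination t3 - t4
          | linear_combination t7 - t2
          | linear_combination t1 - t8)

theorem IsSystemOn.eventuallyEq_coef (h : IsSystemOn K U) (hx : x ∈ U) (s i j : Fin 3) :
    K s i j =ᶠ[𝓝 x] fun y => coef (basic K y) s i j := by
  filter_upwards [h.isOpen.mem_nhds hx] with y hy using h.eq_coef hy s i j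

theorem IsSystemOn.analyticAt_basic (h : IsSystemOn K U) (hx : x ∈ U) :
    AnalyticAt ℂ (basic K) x := by
  refine analyticAt_pi_iff.2 fun k => ?_
  cases k <;> exact h.analytic _ _ _ x hx

theorem IsSystemOn.pd_eq_coef (h : IsSystemOn K U) (hx : x ∈ U) (l s i j : Fin 3) :
    pd l (K s i j) x = coef (fun k => pd l (fun y => basic K y k) x) s i j := by
  rw [pd_congr l (h.eventuallyEq_coef hx s i j)]
  exact pd_coef (h.analyticAt_basic hx).differentiableAt l s i j

/-- A potential with gradient `e_s` and `V_{11} = 0` at a point. -/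
theorem IsSystemOn.exists_potential (h : IsSystemOn K U) (hx : x ∈ U) (s : Fin 3) :
    ∃ V, SolvesAt K V x ∧ (∀ i, pd i V x = if i = s then 1 else 0) ∧
      ∀ i j, pd j (pd i V) x = K s i j x := by
  obtain ⟨V, hV, -, hv, hw⟩ := (h.nondegenerate x hx 0 (fun i => if i = s then 1 else 0) 0).1
  refine ⟨V, hV, hv, fun i j => ?_⟩
  rw [hV.2.self_of_nhds i j, hw]
  simp [hv]

theorem IsSystemOn.potential_integrable (h : IsSystemOn K U) (hx : x ∈ U) (s : Fin 3) :
    ∃ T : Fin 3 → ℂ, ∀ i j k,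
      (if i = j then T k else 0) + coef (fun n => pd k (fun y => basic K y n) x) s i j
        + ∑ m, coef (basic K x) m i j * coef (basic K x) s m k
      = (if i = k then T j else 0) + coef (fun n => pd j (fun y => basic K y n) x) s i k
        + ∑ m, coef (basic K x) m i k * coef (basic K x) s m j := by
  obtain ⟨V, hV, hv, hh⟩ := h.exists_potential hx s
  refine ⟨fun k => pd k (pd 0 (pd 0 V)) x, fun i j k => ?_⟩
  have ht := h.third_derivative_symm hx hV i j k
  have hh' : ∀ i j, pd j (pd i V) x = coef (basic K x) s i j := fun i j => by
    rw [hh, h.eq_coef hx]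
  simpa only [hv, hh', mul_ite, mul_one, mul_zero, Finset.sum_add_distrib, Finset.sum_ite_eq',
    Finset.mem_univ, if_true, h.pd_eq_coef hx, h.eq_coef hx, ← add_assoc] using ht

variable {a : Fin 5 → Space → Matrix (Fin 3) (Fin 3) ℂ}

/-- The differential equations for the quadratic form of a constant of the motion. -/
theorem IsSystemOn.pd_form (h : IsSystemOn K U) (ha : IsSymmetryFamilyOn K U a) (hx : x ∈ U)
    (n : Fin 5) (k i j : Fin 3) :
    pd k (fun y => a n y i j) x = formDeriv (fun s i j => K s i j x) (a n x) k i j := by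
  have hda : ∀ y ∈ U, ∀ i j, DifferentiableAt ℂ (fun y => a n y i j) y := fun y hy i j =>
    (ha.analytic n i j y hy).differentiableAt
  have hU : ∀ᶠ y in 𝓝 x, y ∈ U := h.isOpen.mem_nhds hx
  -- Both parts of the bracket vanish near `x`, so that the equations for `W` may be differentiated
  -- once more.
  have key : ∀ V W : Space → ℂ, SolvesAt K V x → IsConstantOfMotionAt V (a n) W x → ∀ᶠ y in 𝓝 x,
      (∀ j, pd j W y = ∑ i, a n y j i * pd i V y) ∧
      ∀ i j k, pd i (fun y => a n y j k) y + pd j (fun y => a n y k i) y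
        + pd k (fun y => a n y i j) y = 0 := fun V W hV hW => by
    filter_upwards [hU.eventually_nhds, hW.2, hV.1.eventually_analyticAt,
      hW.1.eventually_analyticAt] with y hyU hy hVy hWy
    have hys : ∀ᶠ z in 𝓝 y, (a n z).IsSymm := hyU.mono fun z hz => ha.symm n z hz
    have hp := eq_zero_of_linear_sub_cubic
      (b := fun j => ∑ i, a n y j i * pd i V y - pd j W y)
      (t := fun j i k => pd j (fun y => a n y i k) y)
      (fun j i k => pd_congr j (hys.mono fun z hz => hz.apply k i)) fun p => by
        rw [← hy p, poisson_hamiltonian_quadraticFunction hVy.differentiableAt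
          hWy.differentiableAt (hda y hyU.self_of_nhds) hys.self_of_nhds]
    exact ⟨fun j => (sub_eq_zero.1 (hp.1 j)).symm, hp.2⟩
  -- Equality of the mixed derivatives of `W`, for a potential whose gradient at `x` is `e_s` and
  -- whose Hessian there is `K s`; this isolates the column `s` of `a`.
  have hcurl : ∀ s j k, pd k (fun y => a n y j s) x + ∑ m, a n x j m * K s m k x
      = pd j (fun y => a n y k s) x + ∑ m, a n x k m * K s m j x := fun s j k => by
    obtain ⟨V, hV, hv, hh⟩ := h.exists_potential hx s
    obtain ⟨W, hW⟩ := ha.constants x hx V hV n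
    have hWd := key V W hV hW
    have e : ∀ j k, pd k (pd j W) x
        = pd k (fun y => a n y j s) x + ∑ m, a n x j m * K s m k x := fun j k => by
      have hd : ∀ m, DifferentiableAt ℂ (fun y => a n y j m * pd m V y) x := fun m =>
        (hda x hx j m).fun_mul (analyticAt_pd m hV.1).differentiableAt
      rw [pd_congr k (hWd.mono fun y hy => hy.1 j), pd_sum _ _ fun m _ => hd m]
      simp only [fun m => pd_mul k (hda x hx j m) (analyticAt_pd m hV.1).differentiableAt, hv, hh,
        Finset.sum_add_distrib, mul_ite, mul_one, mul_zero, Finset.sum_ite_eq', Finset.mem_univ,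
        if_true]
    rw [← e, ← e]
    exact pd_comm k j hW.1
  obtain ⟨V, hV, -⟩ := h.exists_potential hx 0
  obtain ⟨W, hW⟩ := ha.constants x hx V hV n
  have hcyc := (key V W hV hW).self_of_nhds.2
  have hsym : ∀ l i j, pd l (fun y => a n y i j) x = pd l (fun y => a n y j i) x := fun l i j =>
    pd_congr l (hU.mono fun z hz => (ha.symm n z hz).apply j i)
  have h1 := hcurl j i k
  have h2 := hcurl i j k
  have h3 := hcyc i j k
  simp only [formDeriv, smul_eq_mul, Finset.sum_sub_distrib, Finset.sum_add_distrib, mul_add]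
  -- Two closedness equations and the Killing equation add up to three times the derivative of
  -- `a^{ij}` in direction `k`.
  linear_combination (1 / 3) * h1 + (1 / 3) * h2 + (1 / 3) * h3 + (1 / 3) * hsym k i j
    - (1 / 3) * hsym i j k

theorem IsSystemOn.curv_eq_zero (h : IsSystemOn K U) (ha : IsSymmetryFamilyOn K U a) (hx : x ∈ U)
    (n : Fin 5) (k l i j : Fin 3) :
    curv (coef (basic K x)) (fun l => coef fun m => pd l (fun y => basic K y m) x) (a n x) k l i j
      = 0 := by
  have hda : ∀ i j, DifferentiableAt ℂ (fun y => a n y i j) x := fun i j =>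
    (ha.analytic n i j x hx).differentiableAt
  have e : ∀ k l, pd k (pd l fun y => a n y i j) x
      = formDeriv (coef fun m => pd k (fun y => basic K y m) x) (a n x) l i j
        + formDeriv (coef (basic K x)) (formDeriv (coef (basic K x)) (a n x) k) l i j :=
    fun k l => by
    have h1 : (pd l fun y => a n y i j) =ᶠ[𝓝 x]
        fun y => formDeriv (fun s i j => K s i j y) (a n y) l i j := by
      filter_upwards [h.isOpen.mem_nhds hx] with y hy using h.pd_form ha hy n l i j
    rw [pd_congr k h1, pd_formDeriv (fun s i j => h.differentiableAt hx s i j) hda]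
    simp only [h.pd_form ha hx, h.pd_eq_coef hx, h.eq_coef hx]
  have hc := sub_eq_zero.2 (pd_comm k l (ha.analytic n i j x hx))
  rw [e, e] at hc
  exact hc

/-- Every superintegrable system satisfies the derivative relations. -/
theorem IsSystemOn.pd_basic (h : IsSystemOn K U) (hx : x ∈ U) (l : Fin 3) (k : Label) :
    pd l (fun y => basic K y k) x = eval (basic K x) (derivPoly l k) := by
  obtain ⟨a, ha⟩ := h.superintegrable
  rw [eval_derivPoly]
  let τ : Fin 5 → Fin 6 → ℂ := fun n m => a n x (symPair m).1 (symPair m).2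
  have hτ : ∀ n, symForm (τ n) = a n x := fun n => symForm_symPair (ha.symm n x hx)
  let S : (Fin 6 → ℂ) →ₗ[ℂ] Matrix (Fin 3) (Fin 3) ℂ :=
    { toFun := fun t => Matrix.of (symForm t), map_add' := fun _ _ => rfl,
      map_smul' := fun _ _ => rfl }
  have hli : LinearIndependent ℂ τ := by
    refine LinearIndependent.of_comp S ?_
    have : S ∘ τ = fun n => a n x := funext fun n => hτ n
    rw [this]
    exact ha.linearIndependent x hx
  refine eq_derivForm (e := fun l k => pd l (fun y => basic K y k) x)
    (h.potential_integrable hx) hli ?_ ?_ l k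
  · rw [hτ, ha.first x hx]
  · intro n k l i j
    rw [hτ]
    exact h.curv_eq_zero ha hx n k l i j

theorem IsSystemOn.solvesSystemAt (h : IsSystemOn K U) (hx : x ∈ U) :
    SolvesSystemAt derivPoly Set.univ (basic K) x := by
  refine ⟨h.analyticAt_basic hx, ?_⟩
  filter_upwards [h.isOpen.mem_nhds hx] with y hy l k _ using h.pd_basic hy l k

/-- Two systems with the same basic functions at a point agree on connected sets. -/
theorem IsSystemOn.eq_of_basic_eq {K' : Coefficients} {U' : Set Space} (h : IsSystemOn K U)
    (h' : IsSystemOn K' U') {x₀ : Space} (h0 : basic K x₀ = basic K' x₀) {N : Set Space}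
    (hN : IsPreconnected N) (hx₀ : x₀ ∈ N) (hNU : N ⊆ U ∩ U') {x : Space} (hx : x ∈ N)
    (s i j : Fin 3) : K s i j x = K' s i j x := by
  let u : Set Space := {y | ∀ᶠ z in 𝓝 y, basic K z = basic K' z}
  -- Equality at one point of `N` spreads to a neighbourhood, because both functions solve the same
  -- system there.
  have hstep : ∀ y ∈ N, basic K y = basic K' y → y ∈ u := fun y hy hyb => by
    have := SolvesSystemAt.unique (S := Set.univ) (fun k _ l z z' hz => by
      rw [show z = z' from funext fun j => hz j trivial]) (h.solvesSystemAt (hNU hy).1)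
      (h'.solvesSystemAt (hNU hy).2) (fun k _ => congrFun hyb k)
    exact this.mono fun z hz => funext fun k => hz k trivial
  have hsub : N ⊆ u := by
    refine hN.subset_of_closure_inter_subset isOpen_setOfPred_eventually_nhds
      ⟨x₀, hx₀, hstep x₀ hx₀ h0⟩ ?_
    rintro y ⟨hyu, hyN⟩
    refine hstep y hyN ?_
    -- At a limit point of `u` in `N` equality follows by continuity, so `u` is relatively closed in
    -- `N` as well as open.
    have hc := (h.analyticAt_basic (hNU hyN).1).continuousAt
    have hc' := (h'.analyticAt_basic (hNU hyN).2).continuousAt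
    by_contra hne
    have hev := (hc.prodMk hc').eventually (isClosed_diagonal.isOpen_compl.mem_nhds hne)
    obtain ⟨z, hz, hzu⟩ := (mem_closure_iff_frequently.1 hyu).and_eventually hev |>.exists
    exact hzu hz.self_of_nhds
  rw [h.eq_coef (hNU hx).1, h'.eq_coef (hNU hx).2, (hsub hx).self_of_nhds]

end SystemEquations

/-- The ideal of the six quadrics is closed under the derivative relations. -/
theorem derivation_mem_idealSigma (l : Fin 3) {f : MvPolynomial Label ℂ} (hf : f ∈ idealSigma) :
    MvPolynomial.mkDerivation ℂ (derivPoly l) f ∈ idealSigma := by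
  open MvPolynomial in
  have hgen : ∀ m, mkDerivation ℂ (derivPoly l) (quadric m) ∈ idealSigma := fun m => by
    have e : mkDerivation ℂ (derivPoly l) (quadric m)
        = ∑ j, cofactor (C (1 / 18)) X l m j * quadric j := by
      -- Over an infinite field a polynomial identity may be checked on values, where
      -- `eval_derivation_quadric` applies.
      refine MvPolynomial.funext fun d => ?_
      rw [eval_derivation_quadric, map_sum]
      simp only [map_mul, map_cofactor, eval_C, eval_X]
    rw [e]
    exact Ideal.sum_mem _ fun j _ => Ideal.mul_mem_left _ _ (Ideal.subset_span ⟨j, rfl⟩)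
  induction hf using Submodule.span_induction with
  | mem f hf =>
    obtain ⟨m, rfl⟩ := hf
    exact hgen m
  | zero => simp
  | add f g _ _ hf hg =>
    rw [map_add]
    exact Ideal.add_mem _ hf hg
  | smul c f hf' hf =>
    rw [smul_eq_mul, Derivation.leibniz, smul_eq_mul, smul_eq_mul]
    exact Ideal.add_mem _ (Ideal.mul_mem_left _ _ hf) (Ideal.mul_mem_right _ _ hf')

end Superintegrable

end

open Superintegrable in
theorem theorem7 :
    -- existence and uniqueness of the system with prescribed values at a regular point
    (∀ (x₀ : Space) (d : Label → ℂ), (∀ m, MvPolynomial.eval d (quadric m) = 0) →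
      (∃ (U : Set Space) (K : Coefficients), x₀ ∈ U ∧ IsSystemOn K U ∧ basic K x₀ = d) ∧
      (∀ (U U' : Set Space) (K K' : Coefficients),
        x₀ ∈ U → IsSystemOn K U → basic K x₀ = d →
        x₀ ∈ U' → IsSystemOn K' U' → basic K' x₀ = d →
        ∀ N : Set Space, IsPreconnected N → x₀ ∈ N → N ⊆ U ∩ U' →
          ∀ x ∈ N, ∀ s i j, K s i j x = K' s i j x)) ∧
    -- the derivative relations, and closure of the ideal under them
    (∃ P : Fin 3 → Label → MvPolynomial Label ℂ,
      (∀ l k, (P l k).IsHomogeneous 2) ∧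
      (∀ (U : Set Space) (K : Coefficients), IsSystemOn K U →
        ∀ x ∈ U, ∀ l k,
          pd l (fun y => basic K y k) x = MvPolynomial.eval (basic K x) (P l k)) ∧
      (∀ l, ∀ f ∈ idealSigma, MvPolynomial.mkDerivation ℂ (P l) f ∈ idealSigma)) := by
  refine ⟨fun x₀ d hd => ⟨exists_isSystemOn x₀ hd, ?_⟩, derivPoly, isHomogeneous_derivPoly,
    fun U K h x hx l k => h.pd_basic hx l k, fun l f hf => derivation_mem_idealSigma l hf⟩
  intro U U' K K' _ h hd _ h' hd' N hN hx₀ hNU x hx s i j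
  exact h.eq_of_basic_eq h' (hd.trans hd'.symm) hN hx₀ hNU hx s i j
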